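/- Let $\overline M$ be a smooth manifold with boundary $\partial M$ and interior $M$, of dimension $n+1\ge 2$. A local defining function for $\partial M$ is a smooth function $\rho:U\to[0,\infty)$ on an open set $U\subseteq\overline M$ with $\rho^{-1}(0)=U\cap\partial M$ and $d\rho(y)\neq 0$ for all $y\in U\cap\partial M$. A pseudo-Riemannian metric $g$ on $M$ with Levi-Civita connection $\nabla$ is called projectively compact of order $2$ if each $x\in\partial M$ has a neighbourhood $U$ with a local defining function $\rho:U\to[0,\infty)$ such that the connection $$\hat\nabla_\xi\eta=\nabla_\xi\eta+\tfrac{1}{2\rho}d\rho(\xi)\,\eta+\tfrac{1}{2\rho}d\rho(\eta)\,\xi$$ on $U\cap M$ extends smoothly to the boundary near $x$ (i.e. its Christoffel symbols in a chart of $\overline M$ around $x$ extend smoothly up to the boundary). **Theorem 2.5.** Let $g$ be a pseudo-Riemannian metric on $M$ which is projectively compact of order $2$. Then: (1) The scalar curvature of $g$ extends to a smooth function $S$ on $\overline M$, and $S|_{\partial M}$ is locally constant and nowhere zero. (2) Let $x\in\partial M$, let $\rho:U\to[0,\infty)$ be a local defining function for $\partial M$ with $x\in U$, and put $C=-\frac{n(n+1)}{4S(x)}$.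 Let $W$ be the set of all $y\in U$ such that $y\in M$, or $y\in\partial M$ and $S(y)=S(x)$; this is a neighbourhood of $x$. Then the tensor field $$h=\rho\, g-\frac{C}{\rho}\,d\rho\otimes d\rho$$ on $W\cap M$ extends smoothly to $W$, and for each $y\in W\cap\partial M$ its value at $y$ is non-degenerate as a bilinear form on $T_y\partial M$. -/

import Mathlib

open Set Filter Topology Bundle
open scoped Manifold ContDiff

noncomputable section

namespace ProjCompact

/-! ### Levi-Civita connection and curvature of a metric given in coordinates

`G` is a field of bilinear forms on (an open subset of) the coordinate space `ℝ^m`. All the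
formulas below are meaningful at points near which `G` is smooth, symmetric and non-degenerate. -/

section Coordinates

variable {m : ℕ}

/-- The Christoffel symbols `Γ(u, v) = u^i v^j Γ^k_{ij} ∂_k` of the Levi-Civita connection of `G`:
the vector determined by
`G(Γ(u, v), w) = ½ ((∂_u G)(v, w) + (∂_v G)(u, w) - (∂_w G)(u, v))` for all `w`. -/
def christoffel
    (G : EuclideanSpace ℝ (Fin m) →
      EuclideanSpace ℝ (Fin m) →L[ℝ] EuclideanSpace ℝ (Fin m) →L[ℝ] ℝ)
    (y u v : EuclideanSpace ℝ (Fin m)) : EuclideanSpace ℝ (Fin m) :=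
  (G y).inverse ((1 / 2 : ℝ) •
    (fderiv ℝ G y u v + fderiv ℝ G y v u - ((fderiv ℝ G y).flip u).flip v))

/-- The Riemann curvature `R(u, v) w = ∇_u ∇_v w - ∇_v ∇_u w` for constant vector fields
`u, v, w` in coordinates. -/
def riemann
    (G : EuclideanSpace ℝ (Fin m) →
      EuclideanSpace ℝ (Fin m) →L[ℝ] EuclideanSpace ℝ (Fin m) →L[ℝ] ℝ)
    (y u v w : EuclideanSpace ℝ (Fin m)) : EuclideanSpace ℝ (Fin m) :=
  fderiv ℝ (fun z => christoffel G z v w) y u - fderiv ℝ (fun z => christoffel G z u w) y v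
    + christoffel G y u (christoffel G y v w) - christoffel G y v (christoffel G y u w)

/-- The Ricci curvature `Ric(v, w)`, the trace of `u ↦ R(u, v) w`. -/
def ricci
    (G : EuclideanSpace ℝ (Fin m) →
      EuclideanSpace ℝ (Fin m) →L[ℝ] EuclideanSpace ℝ (Fin m) →L[ℝ] ℝ)
    (y v w : EuclideanSpace ℝ (Fin m)) : ℝ :=
  ∑ i : Fin m, riemann G y (EuclideanSpace.single i 1) v w i

/-- The scalar curvature `∑_{j k} G^{jk} Ric_{jk}`, where `∑_k G^{jk} ∂_k` is the vector that
`G` identifies with the coordinate covector `dx^j`. -/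
def coordScalarCurvature
    (G : EuclideanSpace ℝ (Fin m) →
      EuclideanSpace ℝ (Fin m) →L[ℝ] EuclideanSpace ℝ (Fin m) →L[ℝ] ℝ)
    (y : EuclideanSpace ℝ (Fin m)) : ℝ :=
  ∑ j : Fin m, ricci G y (EuclideanSpace.single j 1) ((G y).inverse (EuclideanSpace.proj j))

end Coordinates

/-! ### Manifolds with boundary

`M` is a manifold with boundary of dimension `n + 1`, with interior
`(𝓡∂ (n + 1)).interior M` and boundary `(𝓡∂ (n + 1)).boundary M`. -/

section Manifold

variable {n : ℕ} {M : Type*} [TopologicalSpace M] [ChartedSpace (EuclideanHalfSpace (n + 1)) M]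

/-- A field of bilinear forms on the tangent spaces of `M` is smooth on `s`, as a section of the
bundle of bilinear forms. -/
def SmoothFormOn [IsManifold (𝓡∂ (n + 1)) ∞ M]
    (h : ∀ x : M, TangentSpace (𝓡∂ (n + 1)) x →L[ℝ] TangentSpace (𝓡∂ (n + 1)) x →L[ℝ] ℝ)
    (s : Set M) : Prop :=
  ContMDiffOn (𝓡∂ (n + 1)) ((𝓡∂ (n + 1)).prod
      𝓘(ℝ, EuclideanSpace ℝ (Fin (n + 1)) →L[ℝ] EuclideanSpace ℝ (Fin (n + 1)) →L[ℝ] ℝ)) ∞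
    (fun x => TotalSpace.mk'
      (EuclideanSpace ℝ (Fin (n + 1)) →L[ℝ] EuclideanSpace ℝ (Fin (n + 1)) →L[ℝ] ℝ)
      (E := fun x : M =>
        TangentSpace (𝓡∂ (n + 1)) x →L[ℝ] TangentSpace (𝓡∂ (n + 1)) x →L[ℝ] ℝ) x (h x)) s

variable (n M) in
/-- A smooth pseudo-Riemannian metric (of any signature) on the interior of `M`. The values
`val x` at boundary points are arbitrary, and are never used. -/
structure InteriorMetric [IsManifold (𝓡∂ (n + 1)) ∞ M] where
  /-- the bilinear form on each tangent space -/
  val : ∀ x : M, TangentSpace (𝓡∂ (n + 1)) x →L[ℝ] TangentSpace (𝓡∂ (n + 1)) x →L[ℝ] ℝ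
  smooth : SmoothFormOn val ((𝓡∂ (n + 1)).interior M)
  symm : ∀ x ∈ (𝓡∂ (n + 1)).interior M, ∀ u v : TangentSpace (𝓡∂ (n + 1)) x,
    val x u v = val x v u
  nondegenerate : ∀ x ∈ (𝓡∂ (n + 1)).interior M, ∀ u : TangentSpace (𝓡∂ (n + 1)) x,
    (∀ v : TangentSpace (𝓡∂ (n + 1)) x, val x u v = 0) → u = 0

/-- The coordinate expression of the metric `g` in the chart `e`: its pullback along the inverse
of the chart, a field of bilinear forms on the coordinate space. -/
def chartMetric [IsManifold (𝓡∂ (n + 1)) ∞ M] (g : InteriorMetric n M)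
    (e : OpenPartialHomeomorph M (EuclideanHalfSpace (n + 1)))
    (y : EuclideanSpace ℝ (Fin (n + 1))) :
    EuclideanSpace ℝ (Fin (n + 1)) →L[ℝ] EuclideanSpace ℝ (Fin (n + 1)) →L[ℝ] ℝ :=
  let b : EuclideanSpace ℝ (Fin (n + 1)) →L[ℝ] EuclideanSpace ℝ (Fin (n + 1)) →L[ℝ] ℝ :=
    g.val ((e.extend (𝓡∂ (n + 1))).symm y)
  let A : EuclideanSpace ℝ (Fin (n + 1)) →L[ℝ] EuclideanSpace ℝ (Fin (n + 1)) :=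
    mfderivWithin 𝓘(ℝ, EuclideanSpace ℝ (Fin (n + 1))) (𝓡∂ (n + 1))
      (e.extend (𝓡∂ (n + 1))).symm (range (𝓡∂ (n + 1))) y
  b.bilinearComp A A

/-- The scalar curvature of `g` at a point `x` of the interior, computed in the chart at `x`
(it does not depend on the chart). -/
def scalarCurvature [IsManifold (𝓡∂ (n + 1)) ∞ M] (g : InteriorMetric n M) (x : M) : ℝ :=
  coordScalarCurvature (chartMetric g (chartAt (EuclideanHalfSpace (n + 1)) x))
    (extChartAt (𝓡∂ (n + 1)) x x)

/-- `ρ` is a local defining function for the boundary of `M`, defined on the open set `U`: a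
smooth function `U → [0, ∞)` whose zero set is the boundary part of `U`, with non-zero
differential there. (The values of `ρ` outside `U` are irrelevant.) -/
structure IsLocalDefiningFunction (ρ : M → ℝ) (U : Set M) : Prop where
  isOpen : IsOpen U
  smooth : ContMDiffOn (𝓡∂ (n + 1)) 𝓘(ℝ, ℝ) ∞ ρ U
  nonneg : ∀ y ∈ U, 0 ≤ ρ y
  eq_zero_iff : ∀ y ∈ U, ρ y = 0 ↔ y ∈ (𝓡∂ (n + 1)).boundary M
  mvfderiv_ne_zero : ∀ y ∈ U, y ∈ (𝓡∂ (n + 1)).boundary M → mvfderiv (𝓡∂ (n + 1)) ρ y ≠ 0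

/-- The metric `g` on the interior of `M` is projectively compact of order `α`: for every boundary
point `x` there is a local defining function `ρ` for the boundary on a neighbourhood `U` of `x`
such that the projective modification `∇ + dρ / (α ρ)` of the Levi-Civita connection `∇` of `g`,
`(ξ, η) ↦ ∇_ξ η + dρ(ξ) / (α ρ) η + dρ(η) / (α ρ) ξ`,
extends smoothly from the interior to the boundary near `x`, i.e. its Christoffel symbols in some
chart `e` around `x` extend to smooth functions `Γ` up to the boundary. -/
def IsProjectivelyCompact [IsManifold (𝓡∂ (n + 1)) ∞ M] (α : ℝ) (g : InteriorMetric n M) : Prop :=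
  ∀ x ∈ (𝓡∂ (n + 1)).boundary M, ∃ (U : Set M) (ρ : M → ℝ),
    x ∈ U ∧ IsLocalDefiningFunction (n := n) ρ U ∧
    ∃ e ∈ IsManifold.maximalAtlas (𝓡∂ (n + 1)) ∞ M, x ∈ e.source ∧
    ∃ Γ : EuclideanSpace ℝ (Fin (n + 1)) →
        EuclideanSpace ℝ (Fin (n + 1)) →L[ℝ] EuclideanSpace ℝ (Fin (n + 1)) →L[ℝ]
          EuclideanSpace ℝ (Fin (n + 1)),
      ContDiffOn ℝ ∞ Γ (e.extend (𝓡∂ (n + 1)) '' (U ∩ e.source)) ∧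
      ∀ y ∈ e.extend (𝓡∂ (n + 1)) '' (U ∩ e.source ∩ (𝓡∂ (n + 1)).interior M), ∀ u v,
        Γ y u v = christoffel (chartMetric g e) y u v
          + (1 / (α * ρ ((e.extend (𝓡∂ (n + 1))).symm y))) •
            (fderiv ℝ (ρ ∘ (e.extend (𝓡∂ (n + 1))).symm) y u • v
              + fderiv ℝ (ρ ∘ (e.extend (𝓡∂ (n + 1))).symm) y v • u)

/-- The tangent space `T_y ∂M ⊆ T_y M` of the boundary at a boundary point `y`: the kernel of the
differential at `y` of the coordinate `z ↦ z 0` of the chart at `y`, which takes values in the half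
space `{z | 0 ≤ z 0}`, so that this coordinate vanishes exactly on the boundary. -/
def boundaryTangent (y : M) : Set (TangentSpace (𝓡∂ (n + 1)) y) :=
  {v | mvfderiv (𝓡∂ (n + 1)) (fun z => extChartAt (𝓡∂ (n + 1)) y z 0) y v = 0}

end Manifold

end ProjCompact

end

/-! Work in the chart at a boundary point, with boundary coordinate y⁰. If ρ = y⁰ f with f ≠ 0, then
dρ/ρ = dy⁰/y⁰ + df/f, and df/f is smooth up to the boundary, so the modified connection (with
symbols Γ) may be formed with y⁰ in place of ρ (`exists_isCompactCoord`).

Smooth extension. As g⁻¹ is parallel for g, the tensor s = g⁻¹ / y⁰ solves the metrisability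
equation of the modified connection: the trace-free part of its covariant derivative vanishes, and
the trace part is μⁱ = gⁱ⁰ / (2 (y⁰)²) (`pd_scaled_inverse`). Commuting partial derivatives closes
this equation to a first-order linear system for s, μ and one further function, with coefficients
smooth up to the boundary (`exists_extension_of_metrisability`). Grönwall's inequality bounds a
solution in the interior, so it is Lipschitz, extends continuously, and is smooth by bootstrapping
(`exists_extension_of_family`). The density v = (y⁰)ⁿ⁺² det g and its reciprocal solve similar
equations, so v extends without zeros, and t = (y⁰)² g is v times the adjugate of s.

Asymptotic form. The equation satisfied by t degenerates at y⁰ = 0 and forces t = C dy⁰ ⊗ dy⁰ there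
(`scaled_metric_eq_zero`); its next order forces C to be constant along the boundary
(`scaled_metric_const`). By Hadamard's lemma H = (t - C dy⁰ ⊗ dy⁰) / y⁰ is smooth. The determinant
with column 0 taken from t and the other columns from H equals v, whence C ≠ 0 and H is
non-degenerate on boundary directions (`exists_asymptotic_form`).

Scalar curvature. The Ricci tensor of g is that of the modified connection minus n/(4 (y⁰)²) dy⁰ ⊗
dy⁰ and n/(2y⁰) Γ⁰. Contraction with g⁻¹ = y⁰ s removes every pole, because s⁰⁰ = 2y⁰ μ⁰. On the
boundary, the trace of the metrisability equation gives Γ⁰ₖₗ sᵏˡ = n μ⁰, and g g⁻¹ = 1 gives 2C μ⁰ =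
1, so the boundary value is -n(n+1)/(4C) (`exists_scalar_extension`).

Globally, scalar curvature is invariant under coordinate changes, the extensions are limits from the
dense interior, and for ρ = y⁰ f the form of the theorem equals f H - C (dy⁰ ⊗ df + df ⊗ dy⁰) - C y⁰
f⁻¹ df ⊗ df, which restricts to f H on the boundary (`exists_scaledForm_extension`). -/

noncomputable section

namespace ProjCompact

/-! ### Half balls and extension of solutions of linear total differential equations -/

section HalfBall

variable {n : ℕ}

/-- The part of a ball that lies in the closed upper half space. -/
def halfBall (p : EuclideanSpace ℝ (Fin (n + 1))) (r : ℝ) : Set (EuclideanSpace ℝ (Fin (n + 1))) :=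
  Metric.ball p r ∩ {y | 0 ≤ y 0}

/-- The part of a ball that lies in the open upper half space. -/
def openHalfBall (p : EuclideanSpace ℝ (Fin (n + 1))) (r : ℝ) :
    Set (EuclideanSpace ℝ (Fin (n + 1))) :=
  Metric.ball p r ∩ {y | 0 < y 0}

variable {p : EuclideanSpace ℝ (Fin (n + 1))} {r : ℝ}

lemma mem_halfBall {y : EuclideanSpace ℝ (Fin (n + 1))} :
    y ∈ halfBall p r ↔ y ∈ Metric.ball p r ∧ 0 ≤ y 0 := Iff.rfl

lemma mem_openHalfBall {y : EuclideanSpace ℝ (Fin (n + 1))} :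
    y ∈ openHalfBall p r ↔ y ∈ Metric.ball p r ∧ 0 < y 0 := Iff.rfl

lemma openHalfBall_subset_halfBall : openHalfBall p r ⊆ halfBall p r :=
  fun _ hy => mem_halfBall.2 ⟨hy.1, le_of_lt (mem_openHalfBall.1 hy).2⟩

lemma eq_sum_smul_single (u : EuclideanSpace ℝ (Fin (n + 1))) :
    u = ∑ k, u k • EuclideanSpace.single k (1 : ℝ) := by
  ext l
  simp [Pi.single_apply]

lemma halfBall_mono {r' : ℝ} (h : r' ≤ r) : halfBall p r' ⊆ halfBall p r :=
  inter_subset_inter_left _ (Metric.ball_subset_ball h)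

lemma openHalfBall_mono {r' : ℝ} (h : r' ≤ r) : openHalfBall p r' ⊆ openHalfBall p r :=
  inter_subset_inter_left _ (Metric.ball_subset_ball h)

lemma isOpen_openHalfBall : IsOpen (openHalfBall p r) :=
  Metric.isOpen_ball.inter (isOpen_lt continuous_const (by fun_prop))

lemma convex_openHalfBall : Convex ℝ (openHalfBall p r) :=
  (convex_ball p r).inter
    (convex_halfSpace_gt (EuclideanSpace.proj (𝕜 := ℝ) (0 : Fin (n + 1))).isLinear 0)

lemma isClosed_halfSpace : IsClosed {y : EuclideanSpace ℝ (Fin (n + 1)) | 0 ≤ y 0} :=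
  isClosed_le continuous_const (by fun_prop)

/-- Moving a point slightly in the direction of the 0-th basis vector makes its 0-th coordinate
positive and keeps it in the ball. -/
lemma mem_closure_openHalfBall {y : EuclideanSpace ℝ (Fin (n + 1))} (hy : y ∈ halfBall p r) :
    y ∈ closure (openHalfBall p r) := by
  have hc : Continuous fun s : ℝ => y + s • EuclideanSpace.single (0 : Fin (n + 1)) (1 : ℝ) := by
    fun_prop
  have ht : Tendsto (fun s : ℝ => y + s • EuclideanSpace.single (0 : Fin (n + 1)) (1 : ℝ))
      (𝓝[>] 0) (𝓝 y) := by
    have := (hc.tendsto 0).mono_left (nhdsWithin_le_nhds (s := Ioi (0 : ℝ)))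
    simpa using this
  refine mem_closure_of_tendsto ht ?_
  filter_upwards [ht (Metric.isOpen_ball.mem_nhds hy.1), self_mem_nhdsWithin] with s hs hs0
  refine ⟨hs, ?_⟩
  have h1 : (0 : ℝ) ≤ y 0 := hy.2
  have h2 : (0 : ℝ) < s := hs0
  simp only [mem_ofPred_eq, PiLp.add_apply, PiLp.smul_apply, PiLp.single_apply, if_true,
    smul_eq_mul, mul_one]
  linarith

lemma halfBall_subset_closure : halfBall p r ⊆ closure (openHalfBall p r) :=
  fun _ hy => mem_closure_openHalfBall hy

lemma uniqueDiffOn_halfBall : UniqueDiffOn ℝ (halfBall p r) := by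
  have h : UniqueDiffOn ℝ {y : EuclideanSpace ℝ (Fin (n + 1)) | 0 ≤ y 0} := by
    have := (𝓡∂ (n + 1)).uniqueDiffOn
    rwa [range_modelWithCornersEuclideanHalfSpace] at this
  unfold halfBall
  rw [inter_comm]
  exact h.inter Metric.isOpen_ball

/-- Density principle by which identities derived in the interior, where one may divide by y⁰, are
carried to the boundary. -/
lemma eqOn_halfBall_of_eqOn {X : Type*} [TopologicalSpace X] [T2Space X]
    {f g : EuclideanSpace ℝ (Fin (n + 1)) → X}
    (hf : ContinuousOn f (halfBall p r)) (hg : ContinuousOn g (halfBall p r))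
    (h : EqOn f g (openHalfBall p r)) : EqOn f g (halfBall p r) :=
  h.of_subset_closure hf hg openHalfBall_subset_halfBall halfBall_subset_closure

lemma halfBall_mem_nhdsWithin {y : EuclideanSpace ℝ (Fin (n + 1))} (hy : y ∈ halfBall p r) :
    halfBall p r ∈ 𝓝[{y : EuclideanSpace ℝ (Fin (n + 1)) | 0 ≤ y 0}] y := by
  unfold halfBall
  rw [inter_comm]
  exact inter_mem_nhdsWithin _ (Metric.isOpen_ball.mem_nhds hy.1)

/-- A function which is differentiable in the open half ball, and is continuous together with its
derivative up to the boundary, is differentiable up to the boundary. -/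
lemma hasFDerivWithinAt_halfBall {F : Type*} [NormedAddCommGroup F] [NormedSpace ℝ F]
    {f : EuclideanSpace ℝ (Fin (n + 1)) → F}
    {f' : EuclideanSpace ℝ (Fin (n + 1)) → EuclideanSpace ℝ (Fin (n + 1)) →L[ℝ] F}
    (hf : ContinuousOn f (halfBall p r)) (hf' : ContinuousOn f' (halfBall p r))
    (hd : ∀ y ∈ openHalfBall p r, HasFDerivAt f (f' y) y) {y : EuclideanSpace ℝ (Fin (n + 1))}
    (hy : y ∈ halfBall p r) : HasFDerivWithinAt f (f' y) (halfBall p r) y := by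
  -- The closure of the smaller open half ball stays inside `halfBall p r`, so the extension theorem
  -- for derivatives on closures of convex open sets applies there.
  obtain ⟨ε, hε, hsub⟩ : ∃ ε > 0, Metric.closedBall y ε ⊆ Metric.ball p r :=
    Metric.nhds_basis_closedBall.mem_iff.1 (Metric.isOpen_ball.mem_nhds hy.1)
  have hsub' : openHalfBall y ε ⊆ openHalfBall p r :=
    inter_subset_inter_left _ (Metric.ball_subset_closedBall.trans hsub)
  have hcl : closure (openHalfBall y ε) ⊆ halfBall p r := by
    refine fun z hz => ⟨hsub (closure_minimal (fun w hw => Metric.ball_subset_closedBall hw.1)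
      Metric.isClosed_closedBall hz), ?_⟩
    exact closure_minimal (fun w hw => le_of_lt (mem_openHalfBall.1 hw).2) isClosed_halfSpace hz
  have hyy : y ∈ halfBall y ε := ⟨Metric.mem_ball_self hε, hy.2⟩
  have key : HasFDerivWithinAt f (f' y) (closure (openHalfBall y ε)) y := by
    refine hasFDerivWithinAt_closure_of_tendsto_fderiv
      (fun z hz => (hd z (hsub' hz)).differentiableAt.differentiableWithinAt)
      convex_openHalfBall isOpen_openHalfBall
      (fun z hz => (hf z (hcl hz)).mono (subset_closure.trans hcl)) ?_
    have := (hf' y hy).mono (subset_closure.trans hcl)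
    refine Tendsto.congr' ?_ this
    filter_upwards [self_mem_nhdsWithin] with z hz
    exact (hd z (hsub' hz)).fderiv.symm
  refine key.mono_of_mem_nhdsWithin ?_
  refine mem_of_superset (inter_mem_nhdsWithin (halfBall p r) (Metric.ball_mem_nhds y hε)) ?_
  exact fun z hz => mem_closure_openHalfBall ⟨hz.2, hz.1.2⟩

/-- The closed version of a half ball is compact. -/
lemma isCompact_closedHalfBall :
    IsCompact (Metric.closedBall p r ∩ {y : EuclideanSpace ℝ (Fin (n + 1)) | 0 ≤ y 0}) :=
  (isCompact_closedBall p r).inter_right isClosed_halfSpace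

/-- Solutions in the open half ball of a linear total differential equation with coefficients that
are smooth up to the boundary extend smoothly up to the boundary. -/
lemma exists_extension_of_family {ι : Type*} [Fintype ι]
    {F : ι → EuclideanSpace ℝ (Fin (n + 1)) → ℝ}
    {a : ι → Fin (n + 1) → ι → EuclideanSpace ℝ (Fin (n + 1)) → ℝ}
    (ha : ∀ i k j, ContDiffOn ℝ ∞ (a i k j) (halfBall p r))
    (hd : ∀ i, DifferentiableOn ℝ (F i) (openHalfBall p r))
    (hF : ∀ i k, ∀ y ∈ openHalfBall p r,
      fderiv ℝ (F i) y (EuclideanSpace.single k 1) = ∑ j, a i k j y * F j y) (hp : 0 ≤ p 0)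
    {r' : ℝ} (hr' : 0 < r') (hr : r' < r) :
    ∃ F' : ι → EuclideanSpace ℝ (Fin (n + 1)) → ℝ,
      ∀ i, ContDiffOn ℝ ∞ (F' i) (halfBall p r') ∧ EqOn (F' i) (F i) (openHalfBall p r') := by
  have hsub : openHalfBall p r' ⊆ openHalfBall p r := openHalfBall_mono hr.le
  have hsubh : halfBall p r' ⊆ halfBall p r := halfBall_mono hr.le
  let P : Fin (n + 1) → EuclideanSpace ℝ (Fin (n + 1)) →L[ℝ] ℝ := fun k => EuclideanSpace.proj k
  -- the derivative prescribed by the equation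
  let D : (ι → EuclideanSpace ℝ (Fin (n + 1)) → ℝ) → ι → EuclideanSpace ℝ (Fin (n + 1)) →
      EuclideanSpace ℝ (Fin (n + 1)) →L[ℝ] ℝ := fun G i y => ∑ k, (∑ j, a i k j y * G j y) • P k
  have hFD : ∀ i, ∀ y ∈ openHalfBall p r, HasFDerivAt (F i) (D F i y) y := by
    intro i y hy
    refine ((hd i).differentiableAt (isOpen_openHalfBall.mem_nhds hy)).hasFDerivAt.congr_fderiv ?_
    ext u
    conv_lhs => rw [eq_sum_smul_single u]
    simp [D, P, map_sum, hF i _ y hy, mul_comm]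
  -- Here r' < r is needed: the closed half ball of radius r' is compact and lies in the domain of
  -- the coefficients.
  obtain ⟨B, hB0, hB⟩ : ∃ B : ℝ, 0 ≤ B ∧ ∀ y ∈ halfBall p r', ∀ i k j, |a i k j y| ≤ B := by
    have h : ∀ i k j, ∃ B : ℝ, ∀ y ∈ halfBall p r', |a i k j y| ≤ B := fun i k j => by
      obtain ⟨B, hB⟩ := (isCompact_closedHalfBall (p := p) (r := r')).exists_bound_of_continuousOn
        ((ha i k j).continuousOn.mono (inter_subset_inter_left _ (Metric.closedBall_subset_ball hr)))
      exact ⟨B, fun y hy => hB y ⟨Metric.ball_subset_closedBall hy.1, hy.2⟩⟩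
    choose b hb using h
    refine ⟨∑ i, ∑ k, ∑ j, |b i k j|, by positivity, fun y hy i k j => ?_⟩
    refine ((hb i k j y hy).trans (le_abs_self _)).trans ?_
    calc |b i k j| ≤ ∑ j, |b i k j| :=
          Finset.single_le_sum (f := fun j => |b i k j|) (fun _ _ => abs_nonneg _)
            (Finset.mem_univ j)
      _ ≤ ∑ k, ∑ j, |b i k j| :=
          Finset.single_le_sum (f := fun k => ∑ j, |b i k j|) (fun _ _ => by positivity)
            (Finset.mem_univ k)
      _ ≤ _ := Finset.single_le_sum (f := fun i => ∑ k, ∑ j, |b i k j|)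
            (fun _ _ => by positivity) (Finset.mem_univ i)
  let c : ℝ := ∑ k, ‖P k‖
  have hc : 0 ≤ c := by positivity
  have hDle : ∀ (G : ι → EuclideanSpace ℝ (Fin (n + 1)) → ℝ) i, ∀ y ∈ halfBall p r',
      ‖D G i y‖ ≤ (Fintype.card ι * B * c) * ‖fun j => G j y‖ := by
    intro G i y hy
    have h1 : ∀ k, ‖(∑ j, a i k j y * G j y) • P k‖ ≤
        (Fintype.card ι * (B * ‖fun j => G j y‖)) * ‖P k‖ := fun k => by
      rw [norm_smul]
      refine mul_le_mul_of_nonneg_right ?_ (norm_nonneg _)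
      refine (norm_sum_le _ _).trans ((Finset.sum_le_card_nsmul _ _ _ fun j _ => ?_).trans_eq
        (nsmul_eq_mul _ _))
      rw [norm_mul]
      exact mul_le_mul (hB y hy i k j) (norm_le_pi_norm (fun j => G j y) j) (norm_nonneg _) hB0
    calc ‖D G i y‖ ≤ ∑ k, (Fintype.card ι * (B * ‖fun j => G j y‖)) * ‖P k‖ :=
          (norm_sum_le _ _).trans (Finset.sum_le_sum fun k _ => h1 k)
      _ = _ := by rw [← Finset.mul_sum]; ring
  set K : ℝ := Fintype.card ι * B * c with hK
  have hK0 : 0 ≤ K := by positivity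
  obtain ⟨q, hq⟩ : (openHalfBall p r').Nonempty := by
    have : p ∈ closure (openHalfBall p r') :=
      mem_closure_openHalfBall ⟨Metric.mem_ball_self hr', hp⟩
    exact closure_nonempty_iff.1 ⟨p, this⟩
  -- Grönwall along the segment from the fixed point q to y, which has length at most 2 r' and stays
  -- in the convex open half ball.
  have hbound : ∀ y ∈ openHalfBall p r',
      ‖fun i => F i y‖ ≤ ‖fun i => F i q‖ * Real.exp (K * (2 * r')) := by
    intro y hy
    have hγ : ∀ t ∈ Icc (0 : ℝ) 1, AffineMap.lineMap q y t ∈ openHalfBall p r' :=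
      fun t ht => convex_openHalfBall.lineMap_mem hq hy ht
    have hder : ∀ t ∈ Icc (0 : ℝ) 1,
        HasDerivAt (fun (t : ℝ) (i : ι) => F i (AffineMap.lineMap q y t))
          (fun i => D F i (AffineMap.lineMap q y t) (y - q)) t := fun t ht =>
      hasDerivAt_pi.2 fun i =>
        (hFD i _ (hsub (hγ t ht))).comp_hasDerivAt t AffineMap.hasDerivAt_lineMap
    have hyq : ‖y - q‖ ≤ 2 * r' := by
      have h1 := Metric.mem_ball.1 hy.1
      have h2 := Metric.mem_ball.1 hq.1
      rw [← dist_eq_norm]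
      linarith [dist_triangle_right y q p]
    have := norm_le_gronwallBound_of_norm_deriv_right_le (δ := ‖fun i => F i q‖)
      (K := K * (2 * r')) (ε := 0)
      (f := fun (t : ℝ) (i : ι) => F i (AffineMap.lineMap q y t)) (a := 0) (b := 1)
      (fun t ht => (hder t ht).continuousAt.continuousWithinAt)
      (fun t ht => (hder t (Ico_subset_Icc_self ht)).hasDerivWithinAt) (by simp)
      (fun t ht => by
        have ht' := hγ t (Ico_subset_Icc_self ht)
        rw [add_zero]
        refine (pi_norm_le_iff_of_nonneg (by positivity)).2 fun i => ?_
        have := hDle F i _ (openHalfBall_subset_halfBall ht')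
        refine ((D F i (AffineMap.lineMap q y t)).le_opNorm _).trans ?_
        calc _ ≤ (K * ‖fun i => F i (AffineMap.lineMap q y t)‖) * (2 * r') := by gcongr
          _ = _ := by ring) 1 (by simp)
    simpa [gronwallBound_ε0] using this
  set C : ℝ := ‖fun i => F i q‖ * Real.exp (K * (2 * r'))
  have hC : 0 ≤ K * C := by positivity
  have hlip : ∀ i, LipschitzOnWith (K * C).toNNReal (F i) (openHalfBall p r') := by
    refine fun i => convex_openHalfBall.lipschitzOnWith_of_nnnorm_hasFDerivWithin_le
      (fun y hy => (hFD i y (hsub hy)).hasFDerivWithinAt) (fun y hy => ?_)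
    refine NNReal.le_toNNReal_of_coe_le ?_
    refine (hDle F i y (openHalfBall_subset_halfBall hy)).trans ?_
    have := hbound y hy
    gcongr
  -- A bounded derivative on a convex set makes each F i Lipschitz, so it has a Lipschitz extension
  -- to the whole space, which supplies the boundary values.
  choose F' hF'l hF' using fun i => (hlip i).extend_finite_dimension
  have hcont : ∀ i, Continuous (F' i) := fun i => (hF'l i).continuous
  have hDs : ∀ (k : WithTop ℕ∞), k ≤ ∞ → (∀ i, ContDiffOn ℝ k (F' i) (halfBall p r')) →
      ∀ i, ContDiffOn ℝ k (D F' i) (halfBall p r') := fun k hk h i =>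
    ContDiffOn.sum fun l _ => ContDiffOn.smul (ContDiffOn.sum fun j _ =>
      (((ha i l j).mono hsubh).of_le hk).mul (h j)) contDiffOn_const
  have hderiv : ∀ i, ∀ y ∈ halfBall p r',
      HasFDerivWithinAt (F' i) (D F' i y) (halfBall p r') y := by
    intro i y hy
    refine hasFDerivWithinAt_halfBall (hcont i).continuousOn
      (hDs 0 (by simp) (fun i => contDiffOn_zero.2 (hcont i).continuousOn) i).continuousOn
      (fun z hz => ?_) hy
    have h1 := hFD i z (hsub hz)
    have h2 : D F i z = D F' i z := by simp only [D, hF' _ hz]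
    rw [h2] at h1
    exact h1.congr_of_eventuallyEq
      (Filter.eventuallyEq_of_mem (isOpen_openHalfBall.mem_nhds hz) fun w hw => (hF' i hw).symm)
  -- Bootstrap: the prescribed derivative `D F' i` is as smooth as F' itself, so F' gains one
  -- derivative at each stage.
  have hsmooth : ∀ (k : ℕ) i, ContDiffOn ℝ k (F' i) (halfBall p r') := by
    intro k
    induction k with
    | zero => exact fun i => contDiffOn_zero.2 (hcont i).continuousOn
    | succ k ih =>
      intro i
      push_cast
      exact (contDiffOn_succ_iff_hasFDerivWithinAt_of_uniqueDiffOn uniqueDiffOn_halfBall).2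
        ⟨fun h => absurd h (by simp), D F' i, hDs k (mod_cast le_top) ih i, hderiv i⟩
  exact ⟨F', fun i => ⟨contDiffOn_infty.2 fun k => hsmooth k i, fun y hy => (hF' i hy).symm⟩⟩

end HalfBall

/-! ### Division by the boundary coordinate (Hadamard's lemma) -/

section Division

variable {n : ℕ} {p : EuclideanSpace ℝ (Fin (n + 1))} {r : ℝ}

/-- The partial derivative of a function on a half ball, taken within the half ball. -/
def pdWithin (K : Set (EuclideanSpace ℝ (Fin (n + 1)))) (k : Fin (n + 1))
    (f : EuclideanSpace ℝ (Fin (n + 1)) → ℝ) (y : EuclideanSpace ℝ (Fin (n + 1))) : ℝ :=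
  fderivWithin ℝ f K y (EuclideanSpace.single k 1)

lemma contDiffOn_pdWithin {f : EuclideanSpace ℝ (Fin (n + 1)) → ℝ}
    (hf : ContDiffOn ℝ ∞ f (halfBall p r)) (k : Fin (n + 1)) :
    ContDiffOn ℝ ∞ (pdWithin (halfBall p r) k f) (halfBall p r) :=
  (hf.fderivWithin uniqueDiffOn_halfBall (by simp)).clm_apply contDiffOn_const

lemma halfBall_mem_nhds {y : EuclideanSpace ℝ (Fin (n + 1))} (hy : y ∈ openHalfBall p r) :
    halfBall p r ∈ 𝓝 y :=
  mem_of_superset (isOpen_openHalfBall.mem_nhds hy) openHalfBall_subset_halfBall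

lemma pdWithin_eq {f : EuclideanSpace ℝ (Fin (n + 1)) → ℝ} {y : EuclideanSpace ℝ (Fin (n + 1))}
    (hy : y ∈ openHalfBall p r) (k : Fin (n + 1)) :
    pdWithin (halfBall p r) k f y = fderiv ℝ f y (EuclideanSpace.single k 1) := by
  rw [pdWithin, fderivWithin_of_mem_nhds (halfBall_mem_nhds hy)]

/-- Scale the `0`-th coordinate by `t`. -/
def squeeze (t : ℝ) (y : EuclideanSpace ℝ (Fin (n + 1))) : EuclideanSpace ℝ (Fin (n + 1)) :=
  y - ((1 - t) * y 0) • EuclideanSpace.single 0 1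

lemma squeeze_apply_zero (t : ℝ) (y : EuclideanSpace ℝ (Fin (n + 1))) :
    squeeze t y 0 = t * y 0 := by
  simp [squeeze]
  ring

lemma squeeze_one (y : EuclideanSpace ℝ (Fin (n + 1))) : squeeze 1 y = y := by
  simp [squeeze]

lemma continuous_squeeze :
    Continuous fun q : ℝ × EuclideanSpace ℝ (Fin (n + 1)) => squeeze q.1 q.2 := by
  unfold squeeze
  fun_prop

/-- As the centre lies on the boundary hyperplane, shrinking the 0-th coordinate does not increase
the distance to it. -/
lemma squeeze_mem_ball (hp : p 0 = 0) {y : EuclideanSpace ℝ (Fin (n + 1))}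
    (hy : y ∈ Metric.ball p r) {t : ℝ} (ht : t ∈ Icc (0 : ℝ) 1) : squeeze t y ∈ Metric.ball p r := by
  rw [Metric.mem_ball] at hy ⊢
  refine lt_of_le_of_lt ?_ hy
  rw [EuclideanSpace.dist_eq, EuclideanSpace.dist_eq]
  refine Real.sqrt_le_sqrt (Finset.sum_le_sum fun i _ => ?_)
  rw [sq_le_sq, Real.dist_eq, Real.dist_eq, abs_abs, abs_abs]
  by_cases hi : i = 0
  · subst hi
    rw [squeeze_apply_zero, hp, sub_zero, sub_zero, abs_mul, abs_of_nonneg ht.1]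
    exact mul_le_of_le_one_left (abs_nonneg _) ht.2
  · simp [squeeze, hi]

lemma squeeze_mem_halfBall (hp : p 0 = 0) {y : EuclideanSpace ℝ (Fin (n + 1))}
    (hy : y ∈ halfBall p r) {t : ℝ} (ht : t ∈ Icc (0 : ℝ) 1) : squeeze t y ∈ halfBall p r := by
  refine mem_halfBall.2 ⟨squeeze_mem_ball hp hy.1 ht, ?_⟩
  rw [squeeze_apply_zero]
  exact mul_nonneg ht.1 (mem_halfBall.1 hy).2

lemma squeeze_mem_openHalfBall (hp : p 0 = 0) {y : EuclideanSpace ℝ (Fin (n + 1))}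
    (hy : y ∈ openHalfBall p r) {t : ℝ} (ht : t ∈ Ioc (0 : ℝ) 1) :
    squeeze t y ∈ openHalfBall p r := by
  refine mem_openHalfBall.2 ⟨squeeze_mem_ball hp hy.1 (Ioc_subset_Icc_self ht), ?_⟩
  rw [squeeze_apply_zero]
  exact mul_pos ht.1 (mem_openHalfBall.1 hy).2

/-- The weighted average of a function over the segments orthogonal to the boundary. -/
def segmentAverage (j : ℕ) (f : EuclideanSpace ℝ (Fin (n + 1)) → ℝ)
    (y : EuclideanSpace ℝ (Fin (n + 1))) : ℝ :=
  ∫ t in (0 : ℝ)..1, t ^ j * f (squeeze t y)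

lemma continuousOn_segment (hp : p 0 = 0) {f : EuclideanSpace ℝ (Fin (n + 1)) → ℝ}
    (hf : ContinuousOn f (halfBall p r)) {y : EuclideanSpace ℝ (Fin (n + 1))}
    (hy : y ∈ halfBall p r) (j : ℕ) :
    ContinuousOn (fun t : ℝ => t ^ j * f (squeeze t y)) (Icc 0 1) :=
  (by fun_prop : Continuous fun t : ℝ => t ^ j).continuousOn.mul
    (hf.comp (continuous_squeeze.comp (by fun_prop : Continuous fun t : ℝ => (t, y))).continuousOn
      fun _ ht => squeeze_mem_halfBall hp hy ht)

lemma continuousOn_segmentAverage (hp : p 0 = 0) {f : EuclideanSpace ℝ (Fin (n + 1)) → ℝ}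
    (hf : ContinuousOn f (halfBall p r)) (j : ℕ) :
    ContinuousOn (segmentAverage j f) (halfBall p r) := by
  rw [continuousOn_iff_continuous_domRestrict]
  have h1 : Continuous (Function.uncurry fun (y : halfBall p r) (t : ℝ) =>
      ((projIcc (0 : ℝ) 1 zero_le_one t : ℝ)) ^ j *
        f (squeeze (projIcc (0 : ℝ) 1 zero_le_one t : ℝ) y)) := by
    have hP : Continuous fun q : halfBall p r × ℝ => (projIcc (0 : ℝ) 1 zero_le_one q.2 : ℝ) :=
      continuous_subtype_val.comp (continuous_projIcc.comp continuous_snd)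
    refine (hP.pow j).mul ?_
    refine hf.comp_continuous (continuous_squeeze.comp
      (hP.prodMk (continuous_subtype_val.comp continuous_fst))) fun q => ?_
    exact squeeze_mem_halfBall hp q.1.2 (projIcc (0 : ℝ) 1 zero_le_one q.2).2
  have h2 := intervalIntegral.continuous_parametric_intervalIntegral_of_continuous'
    (μ := MeasureTheory.volume) h1 0 1
  refine h2.congr fun y => intervalIntegral.integral_congr fun t ht => ?_
  rw [uIcc_of_le zero_le_one] at ht
  simp only [projIcc_of_mem zero_le_one ht]

/-- The map `squeeze t` as a continuous linear map. -/
def squeezeCLM (t : ℝ) : EuclideanSpace ℝ (Fin (n + 1)) →L[ℝ] EuclideanSpace ℝ (Fin (n + 1)) :=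
  ContinuousLinearMap.id ℝ (EuclideanSpace ℝ (Fin (n + 1))) -
    ((1 - t) • (EuclideanSpace.proj (𝕜 := ℝ) (0 : Fin (n + 1)))).smulRight
      (EuclideanSpace.single 0 1)

lemma hasFDerivAt_squeeze (t : ℝ) (y : EuclideanSpace ℝ (Fin (n + 1))) :
    HasFDerivAt (squeeze t) (squeezeCLM t) y := by
  have h0 : HasFDerivAt (fun y : EuclideanSpace ℝ (Fin (n + 1)) => y 0)
      (EuclideanSpace.proj (𝕜 := ℝ) (0 : Fin (n + 1))) y :=
    (EuclideanSpace.proj (𝕜 := ℝ) (0 : Fin (n + 1))).hasFDerivAt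
  exact (hasFDerivAt_id y).sub ((h0.const_mul (1 - t)).smul_const _)

/-- The derivative of `segmentAverage j f`. -/
def segmentAverageDeriv (p : EuclideanSpace ℝ (Fin (n + 1))) (r : ℝ) (j : ℕ)
    (f : EuclideanSpace ℝ (Fin (n + 1)) → ℝ) (y : EuclideanSpace ℝ (Fin (n + 1))) :
    EuclideanSpace ℝ (Fin (n + 1)) →L[ℝ] ℝ :=
  ∑ k, segmentAverage (if k = 0 then j + 1 else j) (pdWithin (halfBall p r) k f) y •
    EuclideanSpace.proj (𝕜 := ℝ) k

/-- Differentiation under the integral sign. Only the 0-th coordinate is scaled by t, so the partial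
derivative in that direction acquires one more factor t; this explains the exponent j + 1. -/
lemma hasFDerivAt_segmentAverage (hp : p 0 = 0) {f : EuclideanSpace ℝ (Fin (n + 1)) → ℝ}
    (hf : ContDiffOn ℝ ∞ f (halfBall p r)) (j : ℕ) {y : EuclideanSpace ℝ (Fin (n + 1))}
    (hy : y ∈ openHalfBall p r) :
    HasFDerivAt (segmentAverage j f) (segmentAverageDeriv p r j f y) y := by
  let P : Fin (n + 1) → EuclideanSpace ℝ (Fin (n + 1)) →L[ℝ] ℝ := fun k => EuclideanSpace.proj k
  let g : Fin (n + 1) → EuclideanSpace ℝ (Fin (n + 1)) → ℝ → ℝ := fun k z t =>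
    t ^ (if k = 0 then j + 1 else j) * pdWithin (halfBall p r) k f (squeeze t z)
  have hpd := fun k => (contDiffOn_pdWithin hf k).continuousOn
  obtain ⟨ε, hε, hball⟩ : ∃ ε > 0, Metric.closedBall y ε ⊆ openHalfBall p r :=
    Metric.nhds_basis_closedBall.mem_iff.1 (isOpen_openHalfBall.mem_nhds hy)
  have hbd : ∀ k, ∃ B : ℝ, ∀ z ∈ Metric.closedBall y ε, ∀ t ∈ Icc (0 : ℝ) 1, ‖g k z t‖ ≤ B := by
    intro k
    have hc : ContinuousOn (fun q : ℝ × EuclideanSpace ℝ (Fin (n + 1)) => g k q.2 q.1)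
        (Icc 0 1 ×ˢ Metric.closedBall y ε) := by
      refine ((continuous_fst.pow _).continuousOn).mul ?_
      refine (hpd k).comp continuous_squeeze.continuousOn fun q hq => ?_
      exact squeeze_mem_halfBall hp (openHalfBall_subset_halfBall (hball hq.2)) hq.1
    obtain ⟨B, hB⟩ := (isCompact_Icc.prod (isCompact_closedBall y ε)).exists_bound_of_continuousOn hc
    exact ⟨B, fun z hz t ht => hB (t, z) ⟨ht, hz⟩⟩
  choose B hB using hbd
  have hcont : ∀ k, ContinuousOn (g k y) (Icc 0 1) := fun k =>
    continuousOn_segment hp (hpd k) (openHalfBall_subset_halfBall hy) _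
  have hII : ∀ k, IntervalIntegrable (g k y) MeasureTheory.volume 0 1 := fun k =>
    ContinuousOn.intervalIntegrable_of_Icc zero_le_one (hcont k)
  have hsum : IntervalIntegrable (fun t => ∑ k, g k y t • P k) MeasureTheory.volume 0 1 := by
    refine ContinuousOn.intervalIntegrable_of_Icc zero_le_one ?_
    exact continuousOn_finsetSum _ fun k _ => (hcont k).smul continuousOn_const
  have key := intervalIntegral.hasFDerivAt_integral_of_dominated_of_fderiv_le (𝕜 := ℝ)
    (μ := MeasureTheory.volume) (s := Metric.ball y ε) (a := 0) (b := 1)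
    (bound := fun _ => ∑ k, B k * ‖P k‖)
    (F := fun z t => t ^ j * f (squeeze t z)) (F' := fun z t => ∑ k, g k z t • P k) (x₀ := y)
    (Metric.ball_mem_nhds y hε) (by
      filter_upwards [Metric.ball_mem_nhds y hε] with z hz
      have := ContinuousOn.intervalIntegrable_of_Icc (μ := MeasureTheory.volume) zero_le_one
        (continuousOn_segment hp hf.continuousOn
          (openHalfBall_subset_halfBall (hball (Metric.ball_subset_closedBall hz))) j)
      rw [uIoc_of_le zero_le_one]
      exact this.1.aestronglyMeasurable)
    (ContinuousOn.intervalIntegrable_of_Icc zero_le_one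
      (continuousOn_segment hp hf.continuousOn (openHalfBall_subset_halfBall hy) j))
    (by rw [uIoc_of_le zero_le_one]; exact hsum.1.aestronglyMeasurable)
    (Eventually.of_forall fun t ht z hz => by
      rw [uIoc_of_le zero_le_one] at ht
      refine (norm_sum_le _ _).trans (Finset.sum_le_sum fun k _ => ?_)
      rw [norm_smul]
      exact mul_le_mul_of_nonneg_right
        (hB k z (Metric.ball_subset_closedBall hz) t (Ioc_subset_Icc_self ht)) (norm_nonneg _))
    intervalIntegrable_const
    (Eventually.of_forall fun t ht z hz => by
      rw [uIoc_of_le zero_le_one] at ht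
      have hz' := hball (Metric.ball_subset_closedBall hz)
      -- The range of integration omits t = 0, the only parameter whose squeezed point lies on the
      -- boundary, where f need not have a two-sided derivative.
      have hsz := squeeze_mem_openHalfBall hp hz' ht
      have hfd : HasFDerivAt f (fderiv ℝ f (squeeze t z)) (squeeze t z) :=
        (((hf.contDiffAt (halfBall_mem_nhds hsz)).differentiableAt (by simp))).hasFDerivAt
      refine ((hfd.comp z (hasFDerivAt_squeeze t z)).const_mul (t ^ j)).congr_fderiv ?_
      ext u
      have hu : u - ((1 - t) * u 0) • EuclideanSpace.single 0 (1 : ℝ) =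
          ∑ k, ((if k = 0 then t else 1) * u k) • EuclideanSpace.single k (1 : ℝ) := by
        conv_lhs => rw [eq_sum_smul_single u]
        rw [Fin.sum_univ_succ, Fin.sum_univ_succ]
        simp only [if_true, Fin.succ_ne_zero, if_false, one_mul]
        simp only [PiLp.add_apply, PiLp.smul_apply, PiLp.single_apply]
        simp
        module
      have h1 : squeezeCLM t u = u - ((1 - t) * u 0) • EuclideanSpace.single 0 (1 : ℝ) := by
        simp [squeezeCLM]
      simp only [smul_apply, ContinuousLinearMap.comp_apply, sum_apply, smul_eq_mul]
      rw [h1, hu, map_sum, Finset.mul_sum]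
      refine Finset.sum_congr rfl fun k _ => ?_
      simp only [g, P, map_smul, smul_eq_mul, pdWithin_eq hsz, PiLp.proj_apply]
      split_ifs
      · ring
      · ring)
  refine key.congr_fderiv ?_
  rw [intervalIntegral.integral_finsetSum]
  · refine Finset.sum_congr rfl fun k _ => ?_
    rw [intervalIntegral.integral_smul_const]
    rfl
  · intro k _
    exact ContinuousOn.intervalIntegrable_of_Icc zero_le_one ((hcont k).smul continuousOn_const)

/-- Induction on the order of differentiability. The weight tʲ and the function f vary in the
induction hypothesis because the derivative involves averages of the partial derivatives of f with
weights j and j + 1. -/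
lemma contDiffOn_segmentAverage (hp : p 0 = 0) (m : ℕ) :
    ∀ (j : ℕ) {f : EuclideanSpace ℝ (Fin (n + 1)) → ℝ}, ContDiffOn ℝ ∞ f (halfBall p r) →
      ContDiffOn ℝ m (segmentAverage j f) (halfBall p r) := by
  induction m with
  | zero => exact fun j f hf => contDiffOn_zero.2 (continuousOn_segmentAverage hp hf.continuousOn j)
  | succ m ih =>
    intro j f hf
    push_cast
    have hD : ∀ k : ℕ, (∀ (j : ℕ) {f : EuclideanSpace ℝ (Fin (n + 1)) → ℝ},
        ContDiffOn ℝ ∞ f (halfBall p r) → ContDiffOn ℝ k (segmentAverage j f) (halfBall p r)) →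
        ContDiffOn ℝ k (segmentAverageDeriv p r j f) (halfBall p r) := fun k hk =>
      ContDiffOn.sum fun l _ => (hk _ (contDiffOn_pdWithin hf l)).smul contDiffOn_const
    refine (contDiffOn_succ_iff_hasFDerivWithinAt_of_uniqueDiffOn uniqueDiffOn_halfBall).2
      ⟨fun h => absurd h (by simp), segmentAverageDeriv p r j f, hD m ih, fun y hy => ?_⟩
    exact hasFDerivWithinAt_halfBall (continuousOn_segmentAverage hp hf.continuousOn j)
      (hD m ih).continuousOn (fun z hz => hasFDerivAt_segmentAverage hp hf j hz) hy

/-- **Hadamard's lemma** for half balls: a smooth function that vanishes on the boundary is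
divisible by the coordinate that defines the boundary. -/
lemma exists_eq_mul_of_eq_zero (hp : p 0 = 0) {f : EuclideanSpace ℝ (Fin (n + 1)) → ℝ}
    (hf : ContDiffOn ℝ ∞ f (halfBall p r)) (h0 : ∀ y ∈ halfBall p r, y 0 = 0 → f y = 0) :
    ∃ g : EuclideanSpace ℝ (Fin (n + 1)) → ℝ, ContDiffOn ℝ ∞ g (halfBall p r) ∧
      ∀ y ∈ halfBall p r, f y = y 0 * g y := by
  refine ⟨segmentAverage 0 (pdWithin (halfBall p r) 0 f), contDiffOn_infty.2 fun m =>
    contDiffOn_segmentAverage hp m 0 (contDiffOn_pdWithin hf 0), fun y hy => ?_⟩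
  rcases (mem_halfBall.1 hy).2.eq_or_lt with h | h
  · rw [h0 y hy h.symm, ← h, zero_mul]
  have hy' : y ∈ openHalfBall p r := ⟨hy.1, h⟩
  have hc := continuousOn_segment hp (contDiffOn_pdWithin hf 0).continuousOn hy 0
  -- Fundamental theorem of calculus along t ↦ `squeeze t y`, which runs from the boundary point
  -- below y, where f vanishes, to y.
  have hI := intervalIntegral.integral_eq_sub_of_hasDerivAt_of_le (a := 0) (b := 1)
    (f := fun t => f (squeeze t y))
    (f' := fun t => y 0 * (t ^ 0 * pdWithin (halfBall p r) 0 f (squeeze t y))) zero_le_one (by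
      simpa using continuousOn_segment hp hf.continuousOn hy 0) (fun t ht => by
      have hsz := squeeze_mem_openHalfBall hp hy' (Ioo_subset_Ioc_self ht)
      have hfd : HasFDerivAt f (fderiv ℝ f (squeeze t y)) (squeeze t y) :=
        ((hf.contDiffAt (halfBall_mem_nhds hsz)).differentiableAt (by simp)).hasFDerivAt
      have hsq : HasDerivAt (fun t => squeeze t y) (y 0 • EuclideanSpace.single 0 (1 : ℝ)) t := by
        have h1 : HasDerivAt (fun t : ℝ => (1 - t) * y 0) (-y 0) t := by
          simpa using ((hasDerivAt_id t).const_sub 1).mul_const (y 0)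
        have h2 := (h1.smul_const (EuclideanSpace.single (0 : Fin (n + 1)) (1 : ℝ))).const_sub y
        simpa [squeeze] using h2
      have := hfd.comp_hasDerivAt t hsq
      simpa [pdWithin_eq hsz, Function.comp_def] using this)
    ((ContinuousOn.intervalIntegrable_of_Icc zero_le_one hc).const_mul (y 0))
  rw [intervalIntegral.integral_const_mul] at hI
  rw [segmentAverage, hI, squeeze_one,
    h0 _ (squeeze_mem_halfBall hp hy (by simp)) (by simp [squeeze_apply_zero]), sub_zero]

end Division

/-! ### Partial derivatives and prolongation of the metrisability equation -/

section Prolongation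

variable {n : ℕ} {p : EuclideanSpace ℝ (Fin (n + 1))} {r : ℝ}

/-- The partial derivative of a function. -/
def pd (k : Fin (n + 1)) (f : EuclideanSpace ℝ (Fin (n + 1)) → ℝ)
    (y : EuclideanSpace ℝ (Fin (n + 1))) : ℝ :=
  fderiv ℝ f y (EuclideanSpace.single k 1)

section pd

variable {Ω : Set (EuclideanSpace ℝ (Fin (n + 1)))} {f g : EuclideanSpace ℝ (Fin (n + 1)) → ℝ}
  {y : EuclideanSpace ℝ (Fin (n + 1))} {k l : Fin (n + 1)}

lemma contDiffOn_pd (hΩ : IsOpen Ω) (hf : ContDiffOn ℝ ∞ f Ω) : ContDiffOn ℝ ∞ (pd k f) Ω :=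
  (hf.fderiv_of_isOpen hΩ (by simp)).clm_apply contDiffOn_const

lemma differentiableAt_of_contDiffOn {X : Type*} [NormedAddCommGroup X] [NormedSpace ℝ X]
    {f : EuclideanSpace ℝ (Fin (n + 1)) → X} (hΩ : IsOpen Ω) (hf : ContDiffOn ℝ ∞ f Ω)
    (hy : y ∈ Ω) : DifferentiableAt ℝ f y :=
  (hf.contDiffAt (hΩ.mem_nhds hy)).differentiableAt (by simp)

lemma pd_congr (hΩ : IsOpen Ω) (h : EqOn f g Ω) (hy : y ∈ Ω) : pd k f y = pd k g y := by
  rw [pd, pd, (Filter.eventuallyEq_of_mem (hΩ.mem_nhds hy) h).fderiv_eq]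

lemma pd_add (hf : DifferentiableAt ℝ f y) (hg : DifferentiableAt ℝ g y) :
    pd k (fun z => f z + g z) y = pd k f y + pd k g y := by
  simp [pd, fderiv_fun_add hf hg]

lemma pd_sub (hf : DifferentiableAt ℝ f y) (hg : DifferentiableAt ℝ g y) :
    pd k (fun z => f z - g z) y = pd k f y - pd k g y := by
  simp [pd, fderiv_fun_sub hf hg]

lemma pd_mul (hf : DifferentiableAt ℝ f y) (hg : DifferentiableAt ℝ g y) :
    pd k (fun z => f z * g z) y = pd k f y * g y + f y * pd k g y := by
  simp [pd, fderiv_fun_mul hf hg]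
  ring

lemma pd_const_mul (hf : DifferentiableAt ℝ f y) (c : ℝ) :
    pd k (fun z => c * f z) y = c * pd k f y := by
  simp [pd, fderiv_const_mul hf]

lemma pd_const (c : ℝ) : pd k (fun _ => c) y = 0 := by
  simp [pd]

lemma pd_sum {ι : Type*} {s : Finset ι} {F : ι → EuclideanSpace ℝ (Fin (n + 1)) → ℝ}
    (hF : ∀ i ∈ s, DifferentiableAt ℝ (F i) y) :
    pd k (fun z => ∑ i ∈ s, F i z) y = ∑ i ∈ s, pd k (F i) y := by
  simp [pd, fderiv_fun_sum hF]

lemma pd_coord (i : Fin (n + 1)) : pd k (fun z => z i) y = if k = i then 1 else 0 := by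
  have : HasFDerivAt (fun z : EuclideanSpace ℝ (Fin (n + 1)) => z i)
      (EuclideanSpace.proj (𝕜 := ℝ) i) y := (EuclideanSpace.proj (𝕜 := ℝ) i).hasFDerivAt
  rw [pd, this.fderiv]
  simp [eq_comm]

lemma pd_comm (hΩ : IsOpen Ω) (hf : ContDiffOn ℝ ∞ f Ω) (hy : y ∈ Ω) :
    pd k (pd l f) y = pd l (pd k f) y := by
  have hfy : ContDiffAt ℝ 2 f y := contDiffAt_infty.1 (hf.contDiffAt (hΩ.mem_nhds hy)) 2
  have h1 : DifferentiableAt ℝ (fderiv ℝ f) y :=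
    (hfy.fderiv_right (m := 1) (by norm_num)).differentiableAt (by simp)
  have h2 : IsSymmSndFDerivAt ℝ f y :=
    hfy.isSymmSndFDerivAt (by simp)
  have h3 : ∀ a b : Fin (n + 1), pd a (pd b f) y =
      fderiv ℝ (fderiv ℝ f) y (EuclideanSpace.single a 1) (EuclideanSpace.single b 1) := by
    intro a b
    have := h1.hasFDerivAt.clm_apply
      (hasFDerivAt_const (EuclideanSpace.single b (1 : ℝ)) y)
    have h4 : HasFDerivAt (pd b f) _ y := this
    rw [pd, h4.fderiv]
    simp
  rw [h3, h3, h2.eq]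

end pd

/-- The module spanned by a set of functions over the functions which are smooth up to the
boundary; functions are only considered on the open half ball. -/
inductive SmoothSpan (p : EuclideanSpace ℝ (Fin (n + 1))) (r : ℝ)
    (S : Set (EuclideanSpace ℝ (Fin (n + 1)) → ℝ)) : (EuclideanSpace ℝ (Fin (n + 1)) → ℝ) → Prop
  | of {f} : f ∈ S → SmoothSpan p r S f
  | zero : SmoothSpan p r S fun _ => 0
  | add {f g} : SmoothSpan p r S f → SmoothSpan p r S g → SmoothSpan p r S fun y => f y + g y
  | mul {a f} : ContDiffOn ℝ ∞ a (halfBall p r) → SmoothSpan p r S f →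
      SmoothSpan p r S fun y => a y * f y
  | congr {f g} : SmoothSpan p r S f → EqOn g f (openHalfBall p r) → SmoothSpan p r S g

namespace SmoothSpan

variable {S T : Set (EuclideanSpace ℝ (Fin (n + 1)) → ℝ)}
  {f g : EuclideanSpace ℝ (Fin (n + 1)) → ℝ}

lemma const_mul (c : ℝ) (hf : SmoothSpan p r S f) : SmoothSpan p r S fun y => c * f y :=
  hf.mul contDiffOn_const

lemma sub (hf : SmoothSpan p r S f) (hg : SmoothSpan p r S g) :
    SmoothSpan p r S fun y => f y - g y :=
  (hf.add (hg.const_mul (-1))).congr fun y _ => by ring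

lemma sum {ι : Type*} (s : Finset ι) {F : ι → EuclideanSpace ℝ (Fin (n + 1)) → ℝ}
    (hF : ∀ i ∈ s, SmoothSpan p r S (F i)) : SmoothSpan p r S fun y => ∑ i ∈ s, F i y := by
  classical
  induction s using Finset.induction_on with
  | empty => simpa using zero
  | insert a s ha ih =>
    simp only [Finset.sum_insert ha]
    exact (hF a (Finset.mem_insert_self a s)).add
      (ih fun i hi => hF i (Finset.mem_insert_of_mem hi))

lemma mono (hST : S ⊆ T) (hf : SmoothSpan p r S f) : SmoothSpan p r T f := by
  induction hf with
  | of h => exact of (hST h)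
  | zero => exact zero
  | add _ _ h1 h2 => exact h1.add h2
  | mul ha _ h => exact h.mul ha
  | congr _ e h => exact h.congr e

lemma contDiffOn (hS : ∀ f ∈ S, ContDiffOn ℝ ∞ f (openHalfBall p r)) (hf : SmoothSpan p r S f) :
    ContDiffOn ℝ ∞ f (openHalfBall p r) := by
  induction hf with
  | of h => exact hS _ h
  | zero => exact contDiffOn_const
  | add _ _ h1 h2 => exact h1.add h2
  | mul ha _ h => exact (ha.mono openHalfBall_subset_halfBall).mul h
  | congr _ e h => exact h.congr e

/-- Leibniz rule: a differentiated coefficient leaves a generator of S in place, hence S ⊆ T, while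
a differentiated generator lies in the span of T by assumption. -/
lemma pd (hS : ∀ f ∈ S, ContDiffOn ℝ ∞ f (openHalfBall p r)) (hST : S ⊆ T) {k : Fin (n + 1)}
    (hT : ∀ f ∈ S, SmoothSpan p r T (ProjCompact.pd k f)) (hf : SmoothSpan p r S f) :
    SmoothSpan p r T (ProjCompact.pd k f) := by
  induction hf with
  | of h => exact hT _ h
  | zero => exact zero.congr fun y _ => pd_const 0
  | add hf hg h1 h2 =>
    exact (h1.add h2).congr fun y hy =>
      pd_add (differentiableAt_of_contDiffOn isOpen_openHalfBall (hf.contDiffOn hS) hy)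
        (differentiableAt_of_contDiffOn isOpen_openHalfBall (hg.contDiffOn hS) hy)
  | mul ha hf h =>
    refine (((hf.mono hST).mul (contDiffOn_pdWithin ha k)).add (h.mul ha)).congr fun y hy => ?_
    rw [pd_mul (differentiableAt_of_contDiffOn isOpen_openHalfBall
      (ha.mono openHalfBall_subset_halfBall) hy)
      (differentiableAt_of_contDiffOn isOpen_openHalfBall (hf.contDiffOn hS) hy)]
    simp only [pdWithin_eq hy]
    rfl
  | congr _ e h => exact h.congr fun y hy => pd_congr isOpen_openHalfBall e hy

/-- Provides the coefficients of the linear system required by `exists_extension_of_family`. -/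
lemma exists_coeff {ι : Type*} [Fintype ι] {F : ι → EuclideanSpace ℝ (Fin (n + 1)) → ℝ}
    (hf : SmoothSpan p r (range F) f) :
    ∃ a : ι → EuclideanSpace ℝ (Fin (n + 1)) → ℝ, (∀ i, ContDiffOn ℝ ∞ (a i) (halfBall p r)) ∧
      ∀ y ∈ openHalfBall p r, f y = ∑ i, a i y * F i y := by
  classical
  induction hf with
  | of h =>
    obtain ⟨i, rfl⟩ := h
    exact ⟨fun j _ => if j = i then 1 else 0, fun j => contDiffOn_const, fun y _ => by simp⟩
  | zero => exact ⟨fun _ _ => 0, fun _ => contDiffOn_const, fun y _ => by simp⟩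
  | add _ _ h1 h2 =>
    obtain ⟨a, ha, hfa⟩ := h1
    obtain ⟨b, hb, hfb⟩ := h2
    refine ⟨fun i y => a i y + b i y, fun i => (ha i).add (hb i), fun y hy => ?_⟩
    simp only [hfa y hy, hfb y hy, add_mul, Finset.sum_add_distrib]
  | mul hc _ h =>
    obtain ⟨a, ha, hfa⟩ := h
    refine ⟨fun i y => _ * a i y, fun i => hc.mul (ha i), fun y hy => ?_⟩
    simp only [hfa y hy, mul_assoc, Finset.mul_sum]
  | congr _ e h =>
    obtain ⟨a, ha, hfa⟩ := h
    exact ⟨a, ha, fun y hy => (e hy).trans (hfa y hy)⟩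

end SmoothSpan

/-- **Prolongation of the metrisability equation.** If the trace-free part of the covariant
derivative of a symmetric two-tensor `s` vanishes, for a connection which is smooth up to the
boundary, then `s` and the divergence part `μ` of its derivative extend smoothly up to the
boundary. -/
lemma exists_extension_of_metrisability (hn : 1 ≤ n)
    {s : Fin (n + 1) → Fin (n + 1) → EuclideanSpace ℝ (Fin (n + 1)) → ℝ}
    {μ : Fin (n + 1) → EuclideanSpace ℝ (Fin (n + 1)) → ℝ}
    {Γ : Fin (n + 1) → Fin (n + 1) → Fin (n + 1) → EuclideanSpace ℝ (Fin (n + 1)) → ℝ}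
    (hs : ∀ i j, ContDiffOn ℝ ∞ (s i j) (openHalfBall p r))
    (hμ : ∀ i, ContDiffOn ℝ ∞ (μ i) (openHalfBall p r))
    (hΓ : ∀ i j k, ContDiffOn ℝ ∞ (Γ i j k) (halfBall p r))
    (heq : ∀ k i j, ∀ y ∈ openHalfBall p r, pd k (s i j) y =
      (if k = i then μ j y else 0) + (if k = j then μ i y else 0)
        - ∑ l, (Γ i k l y * s l j y + Γ j k l y * s i l y)) (hp : 0 ≤ p 0)
    {r' : ℝ} (hr' : 0 < r') (hr : r' < r) :
    ∃ (s' : Fin (n + 1) → Fin (n + 1) → EuclideanSpace ℝ (Fin (n + 1)) → ℝ)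
      (μ' : Fin (n + 1) → EuclideanSpace ℝ (Fin (n + 1)) → ℝ),
      (∀ i j, ContDiffOn ℝ ∞ (s' i j) (halfBall p r') ∧ EqOn (s' i j) (s i j) (openHalfBall p r')) ∧
      (∀ i, ContDiffOn ℝ ∞ (μ' i) (halfBall p r') ∧ EqOn (μ' i) (μ i) (openHalfBall p r')) := by
  have hO := isOpen_openHalfBall (p := p) (r := r)
  -- The only additional unknown: modulo the span of s and μ, every first derivative of μ is zero or
  -- equal to this one.
  let Lam : EuclideanSpace ℝ (Fin (n + 1)) → ℝ := pd 0 (μ 0)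
  let F : (Fin (n + 1) × Fin (n + 1)) ⊕ Fin (n + 1) ⊕ Unit → EuclideanSpace ℝ (Fin (n + 1)) → ℝ :=
    Sum.elim (fun q => s q.1 q.2) (Sum.elim μ fun _ => Lam)
  let S₀ : Set (EuclideanSpace ℝ (Fin (n + 1)) → ℝ) := range fun q : Fin (n + 1) × Fin (n + 1) =>
    s q.1 q.2
  let S₁ : Set (EuclideanSpace ℝ (Fin (n + 1)) → ℝ) := S₀ ∪ range μ
  have hS₁F : S₁ ⊆ range F := by
    rintro f (⟨q, rfl⟩ | ⟨i, rfl⟩)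
    · exact ⟨Sum.inl q, rfl⟩
    · exact ⟨Sum.inr (Sum.inl i), rfl⟩
  have hFs : ∀ f ∈ range F, ContDiffOn ℝ ∞ f (openHalfBall p r) := by
    rintro f ⟨q | i | _, rfl⟩
    · exact hs _ _
    · exact hμ _
    · exact contDiffOn_pd hO (hμ 0)
  have hS₁s : ∀ f ∈ S₁, ContDiffOn ℝ ∞ f (openHalfBall p r) := fun f hf => hFs f (hS₁F hf)
  have hS₀S₁ : S₀ ⊆ S₁ := subset_union_left
  have hsS : ∀ i j, SmoothSpan p r S₀ (s i j) := fun i j => .of ⟨(i, j), rfl⟩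
  have hμS : ∀ i, SmoothSpan p r S₁ (μ i) := fun i => .of (Or.inr ⟨i, rfl⟩)
  -- the connection terms in the equation
  let R : Fin (n + 1) → Fin (n + 1) → Fin (n + 1) → EuclideanSpace ℝ (Fin (n + 1)) → ℝ :=
    fun k i j y => ∑ l, (Γ i k l y * s l j y + Γ j k l y * s i l y)
  have hR : ∀ k i j, SmoothSpan p r S₀ (R k i j) := fun k i j => SmoothSpan.sum _ fun l _ =>
    ((hsS l j).mul (hΓ i k l)).add ((hsS i l).mul (hΓ j k l))
  have hRs : ∀ k i j, ContDiffOn ℝ ∞ (R k i j) (openHalfBall p r) := fun k i j =>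
    (hR k i j).contDiffOn fun f hf => hS₁s f (hS₀S₁ hf)
  have hds : ∀ k, ∀ f ∈ S₀, SmoothSpan p r S₁ (pd k f) := by
    rintro k f ⟨⟨i, j⟩, rfl⟩
    have h1 : SmoothSpan p r S₁ fun y => (if k = i then (1 : ℝ) else 0) * μ j y +
        (if k = j then (1 : ℝ) else 0) * μ i y - R k i j y :=
      (((hμS j).const_mul _).add ((hμS i).const_mul _)).sub ((hR k i j).mono hS₀S₁)
    refine h1.congr fun y hy => ?_
    simp only [heq k i j y hy, ite_mul, one_mul, zero_mul, R]
  have hdR : ∀ l k i j, SmoothSpan p r S₁ (pd l (R k i j)) := fun l k i j =>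
    (hR k i j).pd (fun f hf => hS₁s f (hS₀S₁ hf)) hS₀S₁ (hds l)
  have hdd : ∀ l k i j, ∀ y ∈ openHalfBall p r, pd l (pd k (s i j)) y =
      (if k = i then (1 : ℝ) else 0) * pd l (μ j) y + (if k = j then (1 : ℝ) else 0) * pd l (μ i) y
        - pd l (R k i j) y := by
    intro l k i j y hy
    have h1 : EqOn (pd k (s i j)) (fun y => ((if k = i then (1 : ℝ) else 0) * μ j y +
        (if k = j then (1 : ℝ) else 0) * μ i y) - R k i j y) (openHalfBall p r) := fun z hz => by
      simp only [heq k i j z hz, ite_mul, one_mul, zero_mul, R]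
    have hμd := fun i => differentiableAt_of_contDiffOn hO (hμ i) hy
    have hμc : ∀ (c : ℝ) i, DifferentiableAt ℝ (fun z => c * μ i z) y := fun c i =>
      (hμd i).const_mul c
    rw [pd_congr hO h1 hy, pd_sub (DifferentiableAt.fun_add (hμc _ j) (hμc _ i))
      (differentiableAt_of_contDiffOn hO (hRs k i j) hy), pd_add (hμc _ j) (hμc _ i),
      pd_const_mul (hμd j), pd_const_mul (hμd i)]
  -- Integrability condition from the symmetry of the second derivatives of s i j. Its right-hand
  -- side lies in the span of s and μ.
  have hcomm : ∀ l k i j, ∀ y ∈ openHalfBall p r,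
      (if k = i then (1 : ℝ) else 0) * pd l (μ j) y + (if k = j then (1 : ℝ) else 0) * pd l (μ i) y
        - (if l = i then (1 : ℝ) else 0) * pd k (μ j) y
        - (if l = j then (1 : ℝ) else 0) * pd k (μ i) y
        = pd l (R k i j) y - pd k (R l i j) y := by
    intro l k i j y hy
    have := pd_comm (k := k) (l := l) hO (hs i j) hy
    rw [hdd k l i j y hy, hdd l k i j y hy] at this
    linarith
  -- With i = j = k the integrability condition isolates 2 ∂ₗ μₖ.
  have hoff : ∀ l k, l ≠ k → SmoothSpan p r S₁ (pd l (μ k)) := by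
    intro l k hlk
    refine (((hdR l k k k).sub (hdR k l k k)).const_mul (1 / 2)).congr fun y hy => ?_
    have := hcomm l k k k y hy
    simp only [if_true, hlk, if_false] at this
    simp only
    linarith
  -- With i = k and j = l it isolates the difference of two diagonal derivatives.
  have hdiag : ∀ k l, SmoothSpan p r S₁ fun y => pd l (μ l) y - pd k (μ k) y := by
    intro k l
    by_cases hkl : k = l
    · subst hkl
      exact SmoothSpan.zero.congr fun y _ => sub_self _
    refine ((hdR l k k l).sub (hdR k l k l)).congr fun y hy => ?_
    have := hcomm l k k l y hy
    simp only [if_true, hkl, Ne.symm hkl, if_false] at this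
    simp only
    linarith
  have hLam : SmoothSpan p r (range F) Lam := .of ⟨Sum.inr (Sum.inr ()), rfl⟩
  have hdμ : ∀ l k, SmoothSpan p r (range F) (pd l (μ k)) := by
    intro l k
    by_cases hlk : l = k
    · subst hlk
      exact (((hdiag 0 l).mono hS₁F).add hLam).congr fun y _ => by simp [Lam]
    · exact (hoff l k hlk).mono hS₁F
  have hdS₁ : ∀ l, ∀ f ∈ S₁, SmoothSpan p r (range F) (pd l f) := by
    rintro l f (hf | ⟨i, rfl⟩)
    · exact (hds l f hf).mono hS₁F
    · exact hdμ l i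
  -- A second coordinate direction, available because n ≥ 1, is needed to express ∂₀∂₀μ₀.
  obtain ⟨one, hone⟩ : ∃ one : Fin (n + 1), one ≠ 0 := ⟨⟨1, by omega⟩, by simp [Fin.ext_iff]⟩
  have hdLam : ∀ l, SmoothSpan p r (range F) (pd l Lam) := by
    intro l
    by_cases hl : l = 0
    · subst hl
      -- Write ∂₀∂₀μ₀ = ∂₁∂₀μ₁ + ∂₀(∂₀μ₀ - ∂₁μ₁), with 1 standing for `one`: both terms are
      -- derivatives of functions already in the span of s and μ.
      have h1 : SmoothSpan p r (range F) (pd one (pd 0 (μ one))) :=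
        (hoff 0 one hone.symm).pd hS₁s hS₁F (hdS₁ one)
      have h2 : SmoothSpan p r (range F) (pd 0 fun y => pd 0 (μ 0) y - pd one (μ one) y) :=
        (hdiag one 0).pd hS₁s hS₁F (hdS₁ 0)
      refine (h1.add h2).congr fun y hy => ?_
      have hd := fun i l =>
        differentiableAt_of_contDiffOn hO (contDiffOn_pd (k := l) hO (hμ i)) hy
      simp only [pd_sub (hd 0 0) (hd one one), pd_comm (k := one) hO (hμ one) hy, Lam]
      ring
    · have h1 : SmoothSpan p r (range F) (pd 0 (pd l (μ 0))) :=
        (hoff l 0 hl).pd hS₁s hS₁F (hdS₁ 0)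
      exact h1.congr fun y hy => pd_comm hO (hμ 0) hy
  have hdF : ∀ q k, SmoothSpan p r (range F) (pd k (F q)) := by
    rintro (q | i | _) k
    · exact hdS₁ k _ (Or.inl ⟨q, rfl⟩)
    · exact hdμ k i
    · exact hdLam k
  choose a ha hFa using fun q k => (hdF q k).exists_coeff
  obtain ⟨F', hF'⟩ := exists_extension_of_family (F := F) (a := a) ha
    (fun q => (hFs _ ⟨q, rfl⟩).differentiableOn (by simp)) hFa hp hr' hr
  exact ⟨fun i j => F' (Sum.inl (i, j)), fun i => F' (Sum.inr (Sum.inl i)),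
    fun i j => hF' (Sum.inl (i, j)), fun i => hF' (Sum.inr (Sum.inl i))⟩

end Prolongation

/-! ### Smoothness of determinants and inverses, Jacobi's formula -/

section MatrixCalculus

variable {n : ℕ} {ι : Type*} [Fintype ι] [DecidableEq ι]
  {Ω : Set (EuclideanSpace ℝ (Fin (n + 1)))}

lemma contDiffOn_det {M : EuclideanSpace ℝ (Fin (n + 1)) → Matrix ι ι ℝ}
    (hM : ∀ i j, ContDiffOn ℝ ∞ (fun y => M y i j) Ω) : ContDiffOn ℝ ∞ (fun y => (M y).det) Ω := by
  simp only [Matrix.det_apply']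
  exact ContDiffOn.sum fun σ _ => contDiffOn_const.mul (contDiffOn_prod fun i _ => hM _ _)

lemma contDiffOn_adjugate {M : EuclideanSpace ℝ (Fin (n + 1)) → Matrix ι ι ℝ}
    (hM : ∀ i j, ContDiffOn ℝ ∞ (fun y => M y i j) Ω) (i j : ι) :
    ContDiffOn ℝ ∞ (fun y => (M y).adjugate i j) Ω := by
  simp only [Matrix.adjugate_apply]
  refine contDiffOn_det fun k l => ?_
  simp only [Matrix.updateRow_apply]
  split_ifs
  · exact contDiffOn_const
  · exact hM k l

lemma contDiffOn_inv_matrix {M : EuclideanSpace ℝ (Fin (n + 1)) → Matrix ι ι ℝ}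
    (hM : ∀ i j, ContDiffOn ℝ ∞ (fun y => M y i j) Ω) (hdet : ∀ y ∈ Ω, (M y).det ≠ 0) (i j : ι) :
    ContDiffOn ℝ ∞ (fun y => (M y)⁻¹ i j) Ω := by
  have : ContDiffOn ℝ ∞ (fun y => ((M y).det)⁻¹ * (M y).adjugate i j) Ω :=
    ((contDiffOn_det hM).inv hdet).mul (contDiffOn_adjugate hM i j)
  refine this.congr fun y _ => ?_
  rw [Matrix.inv_def, Ring.inverse_eq_inv', Matrix.smul_apply, smul_eq_mul]

/-- **Jacobi's formula** for the derivative of a determinant. -/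
lemma pd_det {M : EuclideanSpace ℝ (Fin (n + 1)) → Matrix ι ι ℝ}
    {y : EuclideanSpace ℝ (Fin (n + 1))} (k : Fin (n + 1))
    (hM : ∀ i j, DifferentiableAt ℝ (fun y => M y i j) y) :
    pd k (fun y => (M y).det) y =
      ∑ i, ∑ j, (M y).adjugate j i * pd k (fun y => M y i j) y := by
  have hprod : ∀ σ : Equiv.Perm ι, HasFDerivAt (fun y => ∏ j, M y (σ j) j)
      (∑ j, (∏ l ∈ Finset.univ.erase j, M y (σ l) l) • fderiv ℝ (fun y => M y (σ j) j) y) y :=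
    fun σ => HasFDerivAt.finsetProd fun j _ => (hM (σ j) j).hasFDerivAt
  have hdet : HasFDerivAt (fun y => (M y).det) (∑ σ : Equiv.Perm ι, (Equiv.Perm.sign σ : ℝ) •
      ∑ j, (∏ l ∈ Finset.univ.erase j, M y (σ l) l) • fderiv ℝ (fun y => M y (σ j) j) y) y := by
    simp only [Matrix.det_apply']
    exact HasFDerivAt.fun_sum fun σ _ => by simpa using (hprod σ).const_mul _
  have hcol : ∀ j, ∑ i, (M y).adjugate j i * pd k (fun y => M y i j) y =
      ∑ σ : Equiv.Perm ι, (Equiv.Perm.sign σ : ℝ) *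
        ((∏ l ∈ Finset.univ.erase j, M y (σ l) l) * pd k (fun y => M y (σ j) j) y) := by
    intro j
    -- By Cramer's rule this is the determinant with column j replaced by its derivative.
    have h1 : ∑ i, (M y).adjugate j i * pd k (fun y => M y i j) y =
        ((M y).updateCol j fun i => pd k (fun y => M y i j) y).det := by
      rw [← Matrix.cramer_apply, Matrix.cramer_eq_adjugate_mulVec]
      rfl
    rw [h1, Matrix.det_apply']
    refine Finset.sum_congr rfl fun σ _ => ?_
    rw [← Finset.mul_prod_erase Finset.univ _ (Finset.mem_univ j), Matrix.updateCol_self, mul_comm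
      (pd k _ y)]
    congr 2
    refine Finset.prod_congr rfl fun l hl => ?_
    rw [Matrix.updateCol_ne (Finset.ne_of_mem_erase hl)]
  rw [Finset.sum_comm]
  simp only [hcol]
  rw [pd, hdet.fderiv, Finset.sum_comm]
  simp [pd, Finset.mul_sum]

end MatrixCalculus

/-! ### Metrics in components: derivatives of the inverse and of the determinant -/

section Components

variable {n : ℕ}

/-- The components `g i j` and the Christoffel symbols `c l i j` (with upper index `l`) of a
pseudo-Riemannian metric on an open set. -/
structure IsCoordMetric (Ω : Set (EuclideanSpace ℝ (Fin (n + 1))))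
    (g : Fin (n + 1) → Fin (n + 1) → EuclideanSpace ℝ (Fin (n + 1)) → ℝ)
    (c : Fin (n + 1) → Fin (n + 1) → Fin (n + 1) → EuclideanSpace ℝ (Fin (n + 1)) → ℝ) : Prop where
  smooth : ∀ i j, ContDiffOn ℝ ∞ (g i j) Ω
  symm : ∀ i j, ∀ y ∈ Ω, g i j y = g j i y
  det_ne_zero : ∀ y ∈ Ω, (Matrix.of fun i j => g i j y).det ≠ 0
  symm_christoffel : ∀ l i j, ∀ y ∈ Ω, c l i j y = c l j i y
  compatible : ∀ k i j, ∀ y ∈ Ω, pd k (g i j) y = ∑ l, (c l k i y * g l j y + c l k j y * g i l y)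

/-- The components of the inverse of a matrix of functions. -/
def inverseComponents (g : Fin (n + 1) → Fin (n + 1) → EuclideanSpace ℝ (Fin (n + 1)) → ℝ)
    (i j : Fin (n + 1)) (y : EuclideanSpace ℝ (Fin (n + 1))) : ℝ :=
  (Matrix.of fun i j => g i j y)⁻¹ i j

variable {Ω : Set (EuclideanSpace ℝ (Fin (n + 1)))}
  {g : Fin (n + 1) → Fin (n + 1) → EuclideanSpace ℝ (Fin (n + 1)) → ℝ}
  {c : Fin (n + 1) → Fin (n + 1) → Fin (n + 1) → EuclideanSpace ℝ (Fin (n + 1)) → ℝ}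

namespace IsCoordMetric

lemma mono {Ω' : Set (EuclideanSpace ℝ (Fin (n + 1)))} (h : IsCoordMetric Ω g c) (hΩ : Ω' ⊆ Ω) :
    IsCoordMetric Ω' g c where
  smooth i j := (h.smooth i j).mono hΩ
  symm i j y hy := h.symm i j y (hΩ hy)
  det_ne_zero y hy := h.det_ne_zero y (hΩ hy)
  symm_christoffel l i j y hy := h.symm_christoffel l i j y (hΩ hy)
  compatible k i j y hy := h.compatible k i j y (hΩ hy)

lemma contDiffOn_inverse (h : IsCoordMetric Ω g c) (i j : Fin (n + 1)) :
    ContDiffOn ℝ ∞ (inverseComponents g i j) Ω :=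
  contDiffOn_inv_matrix (M := fun y => Matrix.of fun i j => g i j y) h.smooth h.det_ne_zero i j

lemma inverse_mul (h : IsCoordMetric Ω g c) {y : EuclideanSpace ℝ (Fin (n + 1))} (hy : y ∈ Ω)
    (i j : Fin (n + 1)) :
    ∑ l, inverseComponents g i l y * g l j y = if i = j then 1 else 0 := by
  have := congrFun (congrFun
    (Matrix.nonsing_inv_mul _ (isUnit_iff_ne_zero.2 (h.det_ne_zero y hy))) i) j
  simpa [Matrix.mul_apply, Matrix.one_apply, inverseComponents] using this

lemma mul_inverse (h : IsCoordMetric Ω g c) {y : EuclideanSpace ℝ (Fin (n + 1))} (hy : y ∈ Ω)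
    (i j : Fin (n + 1)) :
    ∑ l, g i l y * inverseComponents g l j y = if i = j then 1 else 0 := by
  have := congrFun (congrFun
    (Matrix.mul_nonsing_inv _ (isUnit_iff_ne_zero.2 (h.det_ne_zero y hy))) i) j
  simpa [Matrix.mul_apply, Matrix.one_apply, inverseComponents] using this

lemma inverse_symm (h : IsCoordMetric Ω g c) {y : EuclideanSpace ℝ (Fin (n + 1))} (hy : y ∈ Ω)
    (i j : Fin (n + 1)) : inverseComponents g i j y = inverseComponents g j i y := by
  have hT : (Matrix.of fun i j => g i j y).transpose = Matrix.of fun i j => g i j y := by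
    ext a b
    exact h.symm b a y hy
  have := congrFun (congrFun (Matrix.transpose_nonsing_inv (Matrix.of fun i j => g i j y)) j) i
  rw [hT] at this
  exact this

/-- The inverse of the metric is parallel. -/
lemma pd_inverse (hΩ : IsOpen Ω) (h : IsCoordMetric Ω g c) {y : EuclideanSpace ℝ (Fin (n + 1))}
    (hy : y ∈ Ω) (k i j : Fin (n + 1)) :
    pd k (inverseComponents g i j) y =
      -∑ l, (c i k l y * inverseComponents g l j y + c j k l y * inverseComponents g i l y) := by
  let P : Matrix (Fin (n + 1)) (Fin (n + 1)) ℝ := Matrix.of fun i j => g i j y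
  let C : Matrix (Fin (n + 1)) (Fin (n + 1)) ℝ := Matrix.of fun l j => c l k j y
  let D : Matrix (Fin (n + 1)) (Fin (n + 1)) ℝ := Matrix.of fun i j =>
    pd k (inverseComponents g i j) y
  have hPQ : P * P⁻¹ = 1 := Matrix.mul_nonsing_inv _ (isUnit_iff_ne_zero.2 (h.det_ne_zero y hy))
  have hQP : P⁻¹ * P = 1 := Matrix.nonsing_inv_mul _ (isUnit_iff_ne_zero.2 (h.det_ne_zero y hy))
  have hd := fun i j => differentiableAt_of_contDiffOn hΩ (h.smooth i j) hy
  have hdQ := fun i j => differentiableAt_of_contDiffOn hΩ (h.contDiffOn_inverse i j) hy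
  -- Derivative of P⁻¹ P = 1, with metric compatibility in the matrix form ∂P = Cᵀ P + P C.
  have hD : D * P + P⁻¹ * (C.transpose * P + P * C) = 0 := by
    ext a b
    have h1 : pd k (fun z => ∑ l, inverseComponents g a l z * g l b z) y = 0 := by
      rw [pd_congr hΩ (fun z hz => h.inverse_mul hz a b) hy, pd_const]
    rw [pd_sum fun l _ => (hdQ a l).fun_mul (hd l b)] at h1
    simp only [pd_mul (hdQ _ _) (hd _ _), Finset.sum_add_distrib] at h1
    rw [Matrix.add_apply, Matrix.mul_apply, Matrix.mul_apply, Matrix.zero_apply, ← h1]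
    congr 1
    refine Finset.sum_congr rfl fun l _ => ?_
    rw [h.compatible k l b y hy, Finset.sum_add_distrib, Matrix.add_apply, Matrix.mul_apply,
      Matrix.mul_apply]
    congr 2
    exact Finset.sum_congr rfl fun m _ => mul_comm _ _
  have hD' : D = -(C * P⁻¹ + P⁻¹ * C.transpose) := by
    have h1 : D * P * P⁻¹ = -(P⁻¹ * (C.transpose * P + P * C)) * P⁻¹ := by
      rw [eq_neg_of_add_eq_zero_left hD]
    rw [Matrix.mul_assoc, hPQ, Matrix.mul_one] at h1
    rw [h1, Matrix.mul_add, neg_mul, add_mul, ← Matrix.mul_assoc P⁻¹ P C, hQP, Matrix.one_mul,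
      ← Matrix.mul_assoc, Matrix.mul_assoc _ P P⁻¹, hPQ, Matrix.mul_one, add_comm (P⁻¹ * C.transpose)]
  have := congrFun (congrFun hD' i) j
  simp only [Matrix.neg_apply, Matrix.add_apply, Matrix.mul_apply, Matrix.transpose_apply] at this
  rw [Finset.sum_add_distrib]
  refine this.trans ?_
  congr 2
  exact Finset.sum_congr rfl fun m _ => mul_comm _ _

/-- Jacobi's formula with ∂P = Cᵀ P + P C: the trace of adj(P) ∂P is 2 tr(C) det P. -/
lemma pd_det (hΩ : IsOpen Ω) (h : IsCoordMetric Ω g c) {y : EuclideanSpace ℝ (Fin (n + 1))}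
    (hy : y ∈ Ω) (k : Fin (n + 1)) :
    pd k (fun y => (Matrix.of fun i j => g i j y).det) y =
      2 * (∑ l, c l k l y) * (Matrix.of fun i j => g i j y).det := by
  let P : Matrix (Fin (n + 1)) (Fin (n + 1)) ℝ := Matrix.of fun i j => g i j y
  let C : Matrix (Fin (n + 1)) (Fin (n + 1)) ℝ := Matrix.of fun l j => c l k j y
  have h1 := ProjCompact.pd_det (M := fun y => Matrix.of fun i j => g i j y) (y := y) k
    (fun i j => differentiableAt_of_contDiffOn hΩ (h.smooth i j) hy)
  have h2 : (P.adjugate * (C.transpose * P + P * C)).trace = 2 * C.trace * P.det := by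
    rw [Matrix.mul_add, Matrix.trace_add, ← Matrix.mul_assoc, Matrix.trace_mul_comm,
      ← Matrix.mul_assoc, ← Matrix.mul_assoc, Matrix.mul_adjugate, Matrix.adjugate_mul,
      Matrix.smul_mul, Matrix.one_mul, Matrix.smul_mul, Matrix.one_mul, Matrix.trace_smul,
      Matrix.trace_smul, Matrix.trace_transpose, smul_eq_mul]
    ring
  refine h1.trans (Eq.trans ?_ h2)
  rw [Finset.sum_comm, Matrix.trace]
  refine Finset.sum_congr rfl fun j _ => ?_
  rw [Matrix.diag_apply, Matrix.mul_apply]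
  refine Finset.sum_congr rfl fun i _ => ?_
  congr 1
  rw [Matrix.add_apply, Matrix.mul_apply, Matrix.mul_apply]
  refine (h.compatible k i j y hy).trans ?_
  rw [Finset.sum_add_distrib]
  congr 1
  exact Finset.sum_congr rfl fun m _ => mul_comm _ _

end IsCoordMetric

end Components

/-! ### Projectively compact metrics in coordinates adapted to the boundary -/

section CompactCoordinates

variable {n : ℕ} {p : EuclideanSpace ℝ (Fin (n + 1))} {r : ℝ}
  {g : Fin (n + 1) → Fin (n + 1) → EuclideanSpace ℝ (Fin (n + 1)) → ℝ}
  {c Γ : Fin (n + 1) → Fin (n + 1) → Fin (n + 1) → EuclideanSpace ℝ (Fin (n + 1)) → ℝ}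

/-- A metric on the open half ball whose Levi-Civita connection becomes smooth up to the boundary
after the projective modification by half the logarithmic derivative of the coordinate `y 0`. -/
structure IsCompactCoord (p : EuclideanSpace ℝ (Fin (n + 1))) (r : ℝ)
    (g : Fin (n + 1) → Fin (n + 1) → EuclideanSpace ℝ (Fin (n + 1)) → ℝ)
    (c Γ : Fin (n + 1) → Fin (n + 1) → Fin (n + 1) → EuclideanSpace ℝ (Fin (n + 1)) → ℝ) : Prop
    extends IsCoordMetric (openHalfBall p r) g c where
  smooth_modified : ∀ l i j, ContDiffOn ℝ ∞ (Γ l i j) (halfBall p r)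
  modified_eq : ∀ l i j, ∀ y ∈ openHalfBall p r, Γ l i j y = c l i j y +
    1 / (2 * y 0) * ((if i = 0 then (if l = j then 1 else 0) else 0) +
      (if j = 0 then (if l = i then 1 else 0) else 0))

lemma contDiffOn_coord {s : Set (EuclideanSpace ℝ (Fin (n + 1)))} (i : Fin (n + 1)) :
    ContDiffOn ℝ ∞ (fun y : EuclideanSpace ℝ (Fin (n + 1)) => y i) s :=
  (EuclideanSpace.proj (𝕜 := ℝ) i).contDiff.contDiffOn

lemma differentiableAt_coord {y : EuclideanSpace ℝ (Fin (n + 1))} (i : Fin (n + 1)) :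
    DifferentiableAt ℝ (fun y : EuclideanSpace ℝ (Fin (n + 1)) => y i) y :=
  (EuclideanSpace.proj (𝕜 := ℝ) i).differentiableAt

/-- The truncated exponent m - 1 is harmless for m = 0, as the factor m vanishes. -/
lemma pd_coord_pow {y : EuclideanSpace ℝ (Fin (n + 1))} (k : Fin (n + 1)) (m : ℕ) :
    pd k (fun z => z 0 ^ m) y = m * y 0 ^ (m - 1) * (if k = 0 then 1 else 0) := by
  have h : HasFDerivAt (fun z : EuclideanSpace ℝ (Fin (n + 1)) => z 0)
      (EuclideanSpace.proj (𝕜 := ℝ) (0 : Fin (n + 1))) y :=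
    (EuclideanSpace.proj (𝕜 := ℝ) (0 : Fin (n + 1))).hasFDerivAt
  rw [pd, (h.pow m).fderiv]
  simp [eq_comm]

namespace IsCompactCoord

lemma mono {r' : ℝ} (h : IsCompactCoord p r g c Γ) (hr : r' ≤ r) : IsCompactCoord p r' g c Γ where
  toIsCoordMetric := h.toIsCoordMetric.mono (openHalfBall_mono hr)
  smooth_modified l i j := (h.smooth_modified l i j).mono (halfBall_mono hr)
  modified_eq l i j y hy := h.modified_eq l i j y (openHalfBall_mono hr hy)

lemma christoffel_eq (h : IsCompactCoord p r g c Γ) {y : EuclideanSpace ℝ (Fin (n + 1))}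
    (hy : y ∈ openHalfBall p r) (l i j : Fin (n + 1)) : c l i j y = Γ l i j y -
    1 / (2 * y 0) * ((if i = 0 then (if l = j then 1 else 0) else 0) +
      (if j = 0 then (if l = i then 1 else 0) else 0)) := by
  rw [h.modified_eq l i j y hy]
  ring

/-- Both the Levi-Civita connection and the modification are symmetric in the interior; continuity
gives the boundary. -/
lemma modified_symm (h : IsCompactCoord p r g c Γ) (l i j : Fin (n + 1))
    {y : EuclideanSpace ℝ (Fin (n + 1))} (hy : y ∈ halfBall p r) : Γ l i j y = Γ l j i y := by
  refine eqOn_halfBall_of_eqOn (h.smooth_modified l i j).continuousOn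
    (h.smooth_modified l j i).continuousOn (fun z hz => ?_) hy
  rw [h.modified_eq l i j z hz, h.modified_eq l j i z hz, h.symm_christoffel l i j z hz]
  ring

/-- The inverse metric, rescaled by the defining function, satisfies the metrisability equation. -/
lemma pd_scaled_inverse (h : IsCompactCoord p r g c Γ) {y : EuclideanSpace ℝ (Fin (n + 1))}
    (hy : y ∈ openHalfBall p r) (k i j : Fin (n + 1)) :
    pd k (fun z => inverseComponents g i j z / z 0) y =
      (if k = i then inverseComponents g j 0 y / (2 * y 0 ^ 2) else 0) +
      (if k = j then inverseComponents g i 0 y / (2 * y 0 ^ 2) else 0) -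
      ∑ l, (Γ i k l y * (inverseComponents g l j y / y 0) +
        Γ j k l y * (inverseComponents g i l y / y 0)) := by
  have hy0 : y 0 ≠ 0 := (mem_openHalfBall.1 hy).2.ne'
  have hQ := h.contDiffOn_inverse
  have hd := fun i j => differentiableAt_of_contDiffOn isOpen_openHalfBall (hQ i j) hy
  have h1 : pd k (fun z => inverseComponents g i j z / z 0) y =
      pd k (inverseComponents g i j) y / y 0 -
        (if k = 0 then 1 else 0) * inverseComponents g i j y / y 0 ^ 2 := by
    have hz : DifferentiableAt ℝ (fun z => inverseComponents g i j z / z 0) y :=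
      differentiableAt_of_contDiffOn isOpen_openHalfBall ((hQ i j).div (contDiffOn_coord 0)
        fun z hz => (mem_openHalfBall.1 hz).2.ne') hy
    have h2 : EqOn (fun z => inverseComponents g i j z / z 0 * z 0) (inverseComponents g i j)
        (openHalfBall p r) := fun z hz => div_mul_cancel₀ _ (mem_openHalfBall.1 hz).2.ne'
    have h3 := pd_congr (k := k) isOpen_openHalfBall h2 hy
    rw [pd_mul hz (differentiableAt_coord 0), pd_coord] at h3
    rw [← h3]
    field_simp
    ring
  -- Passing from c to Γ produces, for the two indices together, δₖ₀ gⁱʲ / y⁰, which cancels the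
  -- derivative of the factor 1 / y⁰. The remaining pure-trace terms form μ.
  have hc : ∀ a b : Fin (n + 1), ∑ l, c a k l y * inverseComponents g l b y =
      ∑ l, Γ a k l y * inverseComponents g l b y - 1 / (2 * y 0) *
        ((if k = 0 then 1 else 0) * inverseComponents g a b y +
          (if k = a then 1 else 0) * inverseComponents g 0 b y) := by
    intro a b
    simp only [h.christoffel_eq hy, sub_mul, Finset.sum_sub_distrib, mul_assoc, add_mul,
      Finset.sum_add_distrib, ← Finset.mul_sum]
    congr 2
    congr 1
    · split_ifs <;> simp
    · simp [eq_comm]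
  have hsym : ∀ a b : Fin (n + 1), ∑ l, c b k l y * inverseComponents g a l y =
      ∑ l, c b k l y * inverseComponents g l a y := fun a b =>
    Finset.sum_congr rfl fun l _ => by rw [h.inverse_symm hy a l]
  have hsymΓ : ∀ a b : Fin (n + 1), ∑ l, Γ b k l y * inverseComponents g a l y =
      ∑ l, Γ b k l y * inverseComponents g l a y := fun a b =>
    Finset.sum_congr rfl fun l _ => by rw [h.inverse_symm hy a l]
  have hΓ0 : ∑ l, (Γ i k l y * (inverseComponents g l j y / y 0) +
        Γ j k l y * (inverseComponents g i l y / y 0)) =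
      (∑ l, Γ i k l y * inverseComponents g l j y + ∑ l, Γ j k l y * inverseComponents g l i y)
        / y 0 := by
    rw [← hsymΓ i j, add_div, Finset.sum_div, Finset.sum_div, ← Finset.sum_add_distrib]
    exact Finset.sum_congr rfl fun l _ => by ring
  rw [h1, h.pd_inverse isOpen_openHalfBall hy, Finset.sum_add_distrib, hsym, hc, hc, hΓ0,
    h.inverse_symm hy j i, h.inverse_symm hy 0 j, h.inverse_symm hy 0 i]
  split_ifs <;> field_simp <;> ring

/-- In dimension n + 1 the trace of the modification is (n + 2) dy⁰ / (2 y⁰). Since det g scales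
with twice the trace, the power (y⁰)ⁿ⁺² absorbs exactly this pole. -/
lemma pd_scaled_det (h : IsCompactCoord p r g c Γ) {y : EuclideanSpace ℝ (Fin (n + 1))}
    (hy : y ∈ openHalfBall p r) (k : Fin (n + 1)) :
    pd k (fun z => z 0 ^ (n + 2) * (Matrix.of fun i j => g i j z).det) y =
      2 * (∑ l, Γ l k l y) * (y 0 ^ (n + 2) * (Matrix.of fun i j => g i j y).det) := by
  have hy0 : y 0 ≠ 0 := (mem_openHalfBall.1 hy).2.ne'
  have hdet : ContDiffOn ℝ ∞ (fun z => (Matrix.of fun i j => g i j z).det) (openHalfBall p r) :=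
    contDiffOn_det (M := fun z => Matrix.of fun i j => g i j z) h.smooth
  rw [pd_mul ((differentiableAt_coord 0).fun_pow _)
    (differentiableAt_of_contDiffOn isOpen_openHalfBall hdet hy), pd_coord_pow,
    h.pd_det isOpen_openHalfBall hy]
  have hc : ∑ l, c l k l y = ∑ l, Γ l k l y - 1 / (2 * y 0) * ((n + 2) *
      (if k = 0 then 1 else 0)) := by
    simp only [h.christoffel_eq hy, Finset.sum_sub_distrib, ← Finset.mul_sum,
      Finset.sum_add_distrib]
    congr 2
    by_cases hk : k = 0
    · simp [hk]
      ring
    · simp [hk, Ne.symm hk]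
  rw [hc, show n + 2 - 1 = n + 1 from rfl, pow_succ (y 0) (n + 1)]
  push_cast
  field_simp
  ring

/-- The rescaled inverse metric, its divergence, the rescaled metric and the rescaled volume
density extend smoothly to the boundary. -/
lemma exists_extension (hn : 1 ≤ n) (h : IsCompactCoord p r g c Γ) (hp : 0 ≤ p 0) {r' : ℝ}
    (hr' : 0 < r') (hr : r' < r) :
    ∃ (s t : Fin (n + 1) → Fin (n + 1) → EuclideanSpace ℝ (Fin (n + 1)) → ℝ)
      (μ : Fin (n + 1) → EuclideanSpace ℝ (Fin (n + 1)) → ℝ)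
      (v : EuclideanSpace ℝ (Fin (n + 1)) → ℝ),
      (∀ i j, ContDiffOn ℝ ∞ (s i j) (halfBall p r')) ∧
      (∀ i j, ContDiffOn ℝ ∞ (t i j) (halfBall p r')) ∧
      (∀ i, ContDiffOn ℝ ∞ (μ i) (halfBall p r')) ∧
      ContDiffOn ℝ ∞ v (halfBall p r') ∧
      (∀ i j, ∀ y ∈ openHalfBall p r', s i j y = inverseComponents g i j y / y 0) ∧
      (∀ i j, ∀ y ∈ openHalfBall p r', t i j y = y 0 ^ 2 * g i j y) ∧
      (∀ i, ∀ y ∈ openHalfBall p r', μ i y = inverseComponents g i 0 y / (2 * y 0 ^ 2)) ∧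
      (∀ y ∈ openHalfBall p r', v y = y 0 ^ (n + 2) * (Matrix.of fun i j => g i j y).det) ∧
      ∀ y ∈ halfBall p r', v y ≠ 0 := by
  have hO := isOpen_openHalfBall (p := p) (r := r)
  have hy0 : ∀ y ∈ openHalfBall p r, y 0 ≠ 0 := fun y hy => (mem_openHalfBall.1 hy).2.ne'
  obtain ⟨s, μ, hs, hμ⟩ := exists_extension_of_metrisability hn
    (s := fun i j y => inverseComponents g i j y / y 0)
    (μ := fun i y => inverseComponents g i 0 y / (2 * y 0 ^ 2)) (Γ := Γ)
    (fun i j => (h.contDiffOn_inverse i j).div (contDiffOn_coord 0) hy0)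
    (fun i => (h.contDiffOn_inverse i 0).div (contDiffOn_const.mul ((contDiffOn_coord 0).pow 2))
      fun y hy => mul_ne_zero two_ne_zero (pow_ne_zero 2 (hy0 y hy)))
    h.smooth_modified (fun k i j y hy => h.pd_scaled_inverse hy k i j) hp hr' hr
  let w : EuclideanSpace ℝ (Fin (n + 1)) → ℝ := fun z =>
    z 0 ^ (n + 2) * (Matrix.of fun i j => g i j z).det
  have hw0 : ∀ y ∈ openHalfBall p r, w y ≠ 0 := fun y hy =>
    mul_ne_zero (pow_ne_zero _ (hy0 y hy)) (h.det_ne_zero y hy)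
  have hw : ContDiffOn ℝ ∞ w (openHalfBall p r) := ((contDiffOn_coord 0).pow _).mul
    (contDiffOn_det (M := fun z => Matrix.of fun i j => g i j z) h.smooth)
  have hwd : ∀ y ∈ openHalfBall p r, DifferentiableAt ℝ w y := fun y hy =>
    differentiableAt_of_contDiffOn hO hw hy
  have htr : ∀ k, ContDiffOn ℝ ∞ (fun y => 2 * ∑ l, Γ l k l y) (halfBall p r) := fun k =>
    contDiffOn_const.mul (ContDiffOn.sum fun l _ => h.smooth_modified l k l)
  obtain ⟨v, hv⟩ := exists_extension_of_family (ι := Unit) (F := fun _ => w)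
    (a := fun _ k _ y => 2 * ∑ l, Γ l k l y) (fun _ k _ => htr k)
    (fun _ => hw.differentiableOn (by simp)) (fun _ k y hy => by
      exact (h.pd_scaled_det hy k).trans (by simp [w])) hp hr' hr
  -- The reciprocal density solves the equation with the opposite sign, so it extends too; the
  -- product of the two extensions is 1, so neither vanishes on the boundary.
  obtain ⟨v', hv'⟩ := exists_extension_of_family (ι := Unit) (F := fun _ y => (w y)⁻¹)
    (a := fun _ k _ y => -(2 * ∑ l, Γ l k l y)) (fun _ k _ => (htr k).neg)
    (fun _ => (hw.inv hw0).differentiableOn (by simp)) (fun _ k y hy => by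
      have h1 : HasFDerivAt (fun y => (w y)⁻¹) _ y :=
        (hasDerivAt_inv (hw0 y hy)).comp_hasFDerivAt y (hwd y hy).hasFDerivAt
      have h2 : fderiv ℝ w y (EuclideanSpace.single k 1) = 2 * (∑ l, Γ l k l y) * w y :=
        h.pd_scaled_det hy k
      have := hw0 y hy
      rw [h1.fderiv]
      simp only [smul_apply, h2, smul_eq_mul, Finset.univ_unique, Finset.sum_const,
        Finset.card_singleton, one_smul]
      field_simp) hp hr' hr
  have hvv : EqOn (fun y => v () y * v' () y) (fun _ => 1) (halfBall p r') := by
    refine eqOn_halfBall_of_eqOn ((hv ()).1.continuousOn.mul (hv' ()).1.continuousOn)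
      continuousOn_const fun y hy => ?_
    simp only [(hv ()).2 hy, (hv' ()).2 hy]
    exact mul_inv_cancel₀ (hw0 y (openHalfBall_mono hr.le hy))
  -- Count of powers: the adjugate of g⁻¹ / y⁰ is (y⁰)⁻ⁿ (det g)⁻¹ g, and multiplication by (y⁰)ⁿ⁺²
  -- det g leaves (y⁰)² g.
  refine ⟨s, fun i j y => v () y * (Matrix.of fun i j => s i j y).adjugate i j, μ, v (),
    fun i j => (hs i j).1, fun i j => (hv ()).1.mul (contDiffOn_adjugate
      (M := fun y => Matrix.of fun i j => s i j y) (fun i j => (hs i j).1) i j),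
    fun i => (hμ i).1, (hv ()).1, fun i j y hy => (hs i j).2 hy, ?_, fun i y hy => (hμ i).2 hy,
    fun y hy => (hv ()).2 hy, fun y hy h0 => ?_⟩
  · intro i j y hy
    have hyr := openHalfBall_mono hr.le hy
    have hy0' := hy0 y hyr
    let P : Matrix (Fin (n + 1)) (Fin (n + 1)) ℝ := Matrix.of fun i j => g i j y
    have hPd : P.det ≠ 0 := h.det_ne_zero y hyr
    have hsP : (Matrix.of fun i j => s i j y) = (y 0)⁻¹ • P⁻¹ := by
      ext a b
      simp only [Matrix.of_apply, (hs a b).2 hy, Matrix.smul_apply, smul_eq_mul]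
      rw [div_eq_inv_mul]
      rfl
    have hadj : (Matrix.of fun i j => s i j y).adjugate =
        ((y 0)⁻¹ ^ n * P.det⁻¹) • P := by
      have h1 : P⁻¹.adjugate = P.det⁻¹ • P := by
        have h2 : P⁻¹.adjugate * P⁻¹ * P = P.det⁻¹ • P := by
          rw [Matrix.adjugate_mul, Matrix.det_nonsing_inv, Ring.inverse_eq_inv', Matrix.smul_mul,
            Matrix.one_mul]
        rwa [Matrix.mul_assoc, Matrix.nonsing_inv_mul _ (isUnit_iff_ne_zero.2 hPd),
          Matrix.mul_one] at h2
      rw [hsP, Matrix.adjugate_smul, h1, Fintype.card_fin, smul_smul, Nat.add_sub_cancel]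
    have hvw : v () y = y 0 ^ (n + 2) * P.det := (hv ()).2 hy
    simp only
    rw [hadj, hvw, Matrix.smul_apply, smul_eq_mul, inv_pow, pow_add]
    have : P i j = g i j y := rfl
    rw [this]
    field_simp
  · have := hvv hy
    simp [h0] at this

end IsCompactCoord

end CompactCoordinates

/-! ### Boundary values of the rescaled metric -/

section BoundaryBehaviour

variable {n : ℕ} {p : EuclideanSpace ℝ (Fin (n + 1))} {r : ℝ}
  {g : Fin (n + 1) → Fin (n + 1) → EuclideanSpace ℝ (Fin (n + 1)) → ℝ}
  {c Γ : Fin (n + 1) → Fin (n + 1) → Fin (n + 1) → EuclideanSpace ℝ (Fin (n + 1)) → ℝ}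
  {t : Fin (n + 1) → Fin (n + 1) → EuclideanSpace ℝ (Fin (n + 1)) → ℝ}

lemma pd_coord_mul {f : EuclideanSpace ℝ (Fin (n + 1)) → ℝ} {y : EuclideanSpace ℝ (Fin (n + 1))}
    (hf : DifferentiableAt ℝ f y) (k : Fin (n + 1)) :
    pd k (fun z => z 0 * f z) y = (if k = 0 then 1 else 0) * f y + y 0 * pd k f y := by
  rw [pd_mul (differentiableAt_coord 0) hf, pd_coord]

/-- A function on a half ball whose tangential derivatives vanish on the boundary is constant on
the boundary. -/
lemma eq_of_pdWithin_eq_zero (hp : p 0 = 0) {f : EuclideanSpace ℝ (Fin (n + 1)) → ℝ}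
    (hf : ContDiffOn ℝ ∞ f (halfBall p r))
    (h0 : ∀ k ≠ 0, ∀ y ∈ halfBall p r, y 0 = 0 → pdWithin (halfBall p r) k f y = 0)
    {x y : EuclideanSpace ℝ (Fin (n + 1))} (hx : x ∈ halfBall p r) (hx0 : x 0 = 0)
    (hy : y ∈ halfBall p r) (hy0 : y 0 = 0) : f x = f y := by
  have hsq : ∀ z : EuclideanSpace ℝ (Fin (n + 1)), z 0 = 0 → squeeze 0 z = z := fun z hz => by
    simp [squeeze, hz]
  have hmem : ∀ z ∈ Metric.ball p r, squeeze 0 z ∈ halfBall p r := fun z hz =>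
    mem_halfBall.2 ⟨squeeze_mem_ball hp hz (by simp), by simp [squeeze_apply_zero]⟩
  -- Composition with the projection `squeeze 0` onto the boundary gives a function on the whole
  -- convex ball whose derivative only sees tangential partial derivatives.
  have hd : ∀ z ∈ Metric.ball p r, HasFDerivWithinAt (fun z => f (squeeze 0 z))
      (0 : EuclideanSpace ℝ (Fin (n + 1)) →L[ℝ] ℝ) (Metric.ball p r) z := by
    intro z hz
    have h1 := ((hf.differentiableOn (by simp)) _ (hmem z hz)).hasFDerivWithinAt
    refine (h1.comp z (hasFDerivAt_squeeze 0 z).hasFDerivWithinAt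
      (fun w hw => hmem w hw)).congr_fderiv ?_
    ext u
    have hu : squeezeCLM 0 u = ∑ k : Fin n, u k.succ • EuclideanSpace.single k.succ (1 : ℝ) := by
      have : squeezeCLM 0 u = u - u 0 • EuclideanSpace.single 0 (1 : ℝ) := by simp [squeezeCLM]
      rw [this]
      nth_rewrite 1 [eq_sum_smul_single u]
      rw [Fin.sum_univ_succ, add_sub_cancel_left]
    rw [ContinuousLinearMap.comp_apply, hu, map_sum]
    refine (Finset.sum_eq_zero fun k _ => ?_)
    rw [map_smul]
    have := h0 k.succ (Fin.succ_ne_zero k) _ (hmem z hz) (by simp [squeeze_apply_zero])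
    rw [pdWithin] at this
    rw [this, smul_zero]
  have := (convex_ball p r).norm_image_sub_le_of_norm_hasFDerivWithin_le (C := 0) hd
    (fun _ _ => by simp) hx.1 hy.1
  rw [zero_mul, norm_le_zero_iff, sub_eq_zero, hsq x hx0, hsq y hy0] at this
  exact this.symm

namespace IsCompactCoord

/-- Since g is parallel for c, the modified covariant derivative of t comes only from
differentiating (y⁰)² and from the modification. Both have a simple pole in y⁰ when written in t,
hence the factor y⁰. -/
lemma pd_scaled_metric (h : IsCompactCoord p r g c Γ)
    (ht : ∀ i j, ∀ y ∈ openHalfBall p r, t i j y = y 0 ^ 2 * g i j y) (k i j : Fin (n + 1))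
    {y : EuclideanSpace ℝ (Fin (n + 1))} (hy : y ∈ openHalfBall p r) :
    y 0 * (pd k (t i j) y - ∑ l, (Γ l k i y * t l j y + Γ l k j y * t i l y)) =
      (if k = 0 then t i j y else 0) - 1 / 2 * ((if i = 0 then t k j y else 0) +
        (if j = 0 then t i k y else 0)) := by
  have hy0 : y 0 ≠ 0 := (mem_openHalfBall.1 hy).2.ne'
  have hg := differentiableAt_of_contDiffOn isOpen_openHalfBall (h.smooth i j) hy
  have h1 : pd k (t i j) y = 2 * y 0 * (if k = 0 then 1 else 0) * g i j y + y 0 ^ 2 *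
      ∑ l, (c l k i y * g l j y + c l k j y * g i l y) := by
    rw [pd_congr isOpen_openHalfBall (fun z hz => ht i j z hz) hy,
      pd_mul ((differentiableAt_coord 0).fun_pow 2) hg, pd_coord_pow, h.compatible k i j y hy]
    norm_num
  have hc : ∑ l, (c l k i y * g l j y + c l k j y * g i l y) =
      ∑ l, (Γ l k i y * g l j y + Γ l k j y * g i l y) - 1 / (2 * y 0) *
        (2 * (if k = 0 then g i j y else 0) + (if i = 0 then g k j y else 0) +
          (if j = 0 then g i k y else 0)) := by
    simp only [h.christoffel_eq hy, sub_mul, mul_assoc, add_mul, Finset.sum_add_distrib,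
      Finset.sum_sub_distrib, ← Finset.mul_sum]
    have e1 : ∀ (a b : Fin (n + 1)) (f : Fin (n + 1) → ℝ),
        ∑ l, (if a = 0 then (if l = b then (1 : ℝ) else 0) else 0) * f l =
          if a = 0 then f b else 0 := by
      intro a b f
      split_ifs <;> simp
    rw [e1, e1, e1, e1]
    split_ifs <;> ring
  rw [h1, hc]
  simp only [ht _ _ y hy]
  have h2 : ∑ l, (Γ l k i y * (y 0 ^ 2 * g l j y) + Γ l k j y * (y 0 ^ 2 * g i l y)) =
      y 0 ^ 2 * ∑ l, (Γ l k i y * g l j y + Γ l k j y * g i l y) := by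
    rw [Finset.mul_sum]
    exact Finset.sum_congr rfl fun l _ => by ring
  rw [h2]
  split_ifs <;> field_simp <;> ring

/-- The equation of `pd_scaled_metric` holds up to the boundary. -/
lemma pdWithin_scaled_metric (h : IsCompactCoord p r g c Γ)
    (hts : ∀ i j, ContDiffOn ℝ ∞ (t i j) (halfBall p r))
    (ht : ∀ i j, ∀ y ∈ openHalfBall p r, t i j y = y 0 ^ 2 * g i j y) (k i j : Fin (n + 1))
    {y : EuclideanSpace ℝ (Fin (n + 1))} (hy : y ∈ halfBall p r) :
    y 0 * (pdWithin (halfBall p r) k (t i j) y -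
        ∑ l, (Γ l k i y * t l j y + Γ l k j y * t i l y)) =
      (if k = 0 then (1 : ℝ) else 0) * t i j y - 1 / 2 * ((if i = 0 then (1 : ℝ) else 0) * t k j y +
        (if j = 0 then (1 : ℝ) else 0) * t i k y) := by
  have hΓ := h.smooth_modified
  refine eqOn_halfBall_of_eqOn (f := fun y => y 0 * (pdWithin (halfBall p r) k (t i j) y -
        ∑ l, (Γ l k i y * t l j y + Γ l k j y * t i l y)))
      (g := fun y => (if k = 0 then (1 : ℝ) else 0) * t i j y -
        1 / 2 * ((if i = 0 then (1 : ℝ) else 0) * t k j y + (if j = 0 then (1 : ℝ) else 0) * t i k y))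
      ((contDiffOn_coord 0).mul ((contDiffOn_pdWithin (hts i j) k).sub (ContDiffOn.sum fun l _ =>
        ((hΓ l k i).mul (hts l j)).add ((hΓ l k j).mul (hts i l))))).continuousOn
      ((contDiffOn_const.mul (hts i j)).sub (contDiffOn_const.mul ((contDiffOn_const.mul
        (hts k j)).add (contDiffOn_const.mul (hts i k))))).continuousOn (fun z hz => ?_) hy
  have := h.pd_scaled_metric ht k i j hz
  simp only [pdWithin_eq hz, ite_mul, one_mul, zero_mul]
  exact this

/-- The boundary value of the rescaled metric is a multiple of the square of the conormal. -/
lemma scaled_metric_eq_zero (h : IsCompactCoord p r g c Γ)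
    (hts : ∀ i j, ContDiffOn ℝ ∞ (t i j) (halfBall p r))
    (ht : ∀ i j, ∀ y ∈ openHalfBall p r, t i j y = y 0 ^ 2 * g i j y) {i j : Fin (n + 1)}
    (hij : ¬ (i = 0 ∧ j = 0)) {y : EuclideanSpace ℝ (Fin (n + 1))} (hy : y ∈ halfBall p r)
    (hy0 : y 0 = 0) : t i j y = 0 := by
  -- In the normal direction k = 0 the left side vanishes on the boundary, and the right side is a
  -- positive multiple of t i j unless i = j = 0, where its two contributions cancel.
  have := h.pdWithin_scaled_metric hts ht 0 i j hy
  rw [hy0, zero_mul] at this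
  by_cases hi : i = 0
  · have hj : j ≠ 0 := fun hj => hij ⟨hi, hj⟩
    subst hi
    simp [hj] at this
    linarith
  · by_cases hj : j = 0
    · subst hj
      simp [hi] at this
      linarith
    · simpa [hi, hj] using this.symm

/-- For k ≠ 0 write t₀ₖ = y⁰ τ. Dividing two components of the equation for t by y⁰ gives, on the
boundary, ∂ₖ t₀₀ = 2 Γ⁰ₖ₀ t₀₀ - τ (`hA`) and τ = 2 Γ⁰₀ₖ t₀₀ (`hB`). As Γ is symmetric, the
tangential derivatives of t₀₀ vanish. -/
lemma scaled_metric_const (h : IsCompactCoord p r g c Γ) (hp : p 0 = 0)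
    (hts : ∀ i j, ContDiffOn ℝ ∞ (t i j) (halfBall p r))
    (ht : ∀ i j, ∀ y ∈ openHalfBall p r, t i j y = y 0 ^ 2 * g i j y)
    {x y : EuclideanSpace ℝ (Fin (n + 1))} (hx : x ∈ halfBall p r) (hx0 : x 0 = 0)
    (hy : y ∈ halfBall p r) (hy0 : y 0 = 0) : t 0 0 x = t 0 0 y := by
  refine eq_of_pdWithin_eq_zero hp (hts 0 0) (fun k hk z hz hz0 => ?_) hx hx0 hy hy0
  have hΓ := h.smooth_modified
  obtain ⟨τ, hτ, hτt⟩ := exists_eq_mul_of_eq_zero hp (hts 0 k) fun w hw hw0 =>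
    h.scaled_metric_eq_zero hts ht (fun hh => hk hh.2) hw hw0
  have hsymm : ∀ w ∈ openHalfBall p r, t k 0 w = t 0 k w := fun w hw => by
    rw [ht k 0 w hw, ht 0 k w hw, h.symm k 0 w hw]
  have hτd : ∀ w ∈ openHalfBall p r, DifferentiableAt ℝ τ w := fun w hw =>
    differentiableAt_of_contDiffOn isOpen_openHalfBall (hτ.mono openHalfBall_subset_halfBall) hw
  have hA : EqOn (fun w => pdWithin (halfBall p r) k (t 0 0) w -
        ∑ l, (Γ l k 0 w * t l 0 w + Γ l k 0 w * t 0 l w)) (fun w => -τ w) (halfBall p r) := by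
    refine eqOn_halfBall_of_eqOn ((contDiffOn_pdWithin (hts 0 0) k).sub (ContDiffOn.sum fun l _ =>
      ((hΓ l k 0).mul (hts l 0)).add ((hΓ l k 0).mul (hts 0 l)))).continuousOn
      hτ.neg.continuousOn fun w hw => ?_
    have h1 := h.pd_scaled_metric ht k 0 0 hw
    simp only [hk, if_false, if_true, hsymm w hw, hτt w (openHalfBall_subset_halfBall hw)] at h1
    have h0 : w 0 ≠ 0 := (mem_openHalfBall.1 hw).2.ne'
    simp only [pdWithin_eq hw]
    refine mul_left_cancel₀ h0 (h1.trans ?_)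
    ring
  have hB : EqOn (fun w => τ w + w 0 * pdWithin (halfBall p r) 0 τ w -
        ∑ l, (Γ l 0 0 w * t l k w + Γ l 0 k w * t 0 l w)) (fun w => 1 / 2 * τ w)
        (halfBall p r) := by
    refine eqOn_halfBall_of_eqOn ((hτ.add ((contDiffOn_coord 0).mul
      (contDiffOn_pdWithin hτ 0))).sub (ContDiffOn.sum fun l _ =>
      ((hΓ l 0 0).mul (hts l k)).add ((hΓ l 0 k).mul (hts 0 l)))).continuousOn
      (contDiffOn_const.mul hτ).continuousOn fun w hw => ?_
    have h1 := h.pd_scaled_metric ht 0 0 k hw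
    have h2 : pd 0 (t 0 k) w = τ w + w 0 * pd 0 τ w := by
      rw [pd_congr isOpen_openHalfBall (fun z hz => hτt z (openHalfBall_subset_halfBall hz)) hw,
        pd_coord_mul (hτd w hw), if_pos rfl, one_mul]
    simp only [h2, hk, if_false, if_true, hτt w (openHalfBall_subset_halfBall hw)] at h1
    have h0 : w 0 ≠ 0 := (mem_openHalfBall.1 hw).2.ne'
    simp only [pdWithin_eq hw]
    refine mul_left_cancel₀ h0 (Eq.trans ?_ (h1.trans ?_))
    · rfl
    · ring
  have hAz := hA hz
  have hBz := hB hz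
  have e0 : ∀ i j : Fin (n + 1), ¬ (i = 0 ∧ j = 0) → t i j z = 0 := fun i j hij =>
    h.scaled_metric_eq_zero hts ht hij hz hz0
  have s1 : ∑ l, (Γ l k 0 z * t l 0 z + Γ l k 0 z * t 0 l z) = 2 * Γ 0 k 0 z * t 0 0 z := by
    rw [Finset.sum_eq_single 0 (fun l _ hl => by
      rw [e0 l 0 (fun hh => hl hh.1), e0 0 l (fun hh => hl hh.2)]; ring) (by simp)]
    ring
  have s2 : ∑ l, (Γ l 0 0 z * t l k z + Γ l 0 k z * t 0 l z) = Γ 0 0 k z * t 0 0 z := by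
    rw [Finset.sum_eq_single 0 (fun l _ hl => by
      rw [e0 l k (fun hh => hl hh.1), e0 0 l (fun hh => hl hh.2)]; ring) (by simp),
      e0 0 k (fun hh => hk hh.2)]
    ring
  simp only [s1] at hAz
  simp only [s2, hz0] at hBz
  rw [h.modified_symm 0 0 k hz] at hBz
  linarith

/-- The asymptotic form of the metric. -/
lemma exists_asymptotic_form (h : IsCompactCoord p r g c Γ) (hp : p 0 = 0) (hr : 0 < r)
    {v : EuclideanSpace ℝ (Fin (n + 1)) → ℝ}
    (hts : ∀ i j, ContDiffOn ℝ ∞ (t i j) (halfBall p r)) (hvs : ContDiffOn ℝ ∞ v (halfBall p r))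
    (ht : ∀ i j, ∀ y ∈ openHalfBall p r, t i j y = y 0 ^ 2 * g i j y)
    (hv : ∀ y ∈ openHalfBall p r, v y = y 0 ^ (n + 2) * (Matrix.of fun i j => g i j y).det)
    (hv0 : ∀ y ∈ halfBall p r, v y ≠ 0) :
    ∃ (C : ℝ) (H : Fin (n + 1) → Fin (n + 1) → EuclideanSpace ℝ (Fin (n + 1)) → ℝ),
      C ≠ 0 ∧ (∀ y ∈ halfBall p r, y 0 = 0 → t 0 0 y = C) ∧
      (∀ i j, ContDiffOn ℝ ∞ (H i j) (halfBall p r)) ∧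
      (∀ i j, ∀ y ∈ openHalfBall p r, H i j y =
        y 0 * g i j y - C / y 0 * ((if i = 0 then 1 else 0) * (if j = 0 then 1 else 0))) ∧
      ∀ y ∈ halfBall p r, y 0 = 0 → ∀ w : Fin (n + 1) → ℝ, w 0 = 0 →
        (∀ j ≠ 0, ∑ i, w i * H i j y = 0) → w = 0 := by
  have hpm : p ∈ halfBall p r := mem_halfBall.2 ⟨Metric.mem_ball_self hr, hp.ge⟩
  have hC : ∀ y ∈ halfBall p r, y 0 = 0 → t 0 0 y = t 0 0 p := fun y hy hy0 =>
    h.scaled_metric_const hp hts ht hy hy0 hpm hp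
  set C : ℝ := t 0 0 p
  have hH : ∀ i j, ∃ f : EuclideanSpace ℝ (Fin (n + 1)) → ℝ, ContDiffOn ℝ ∞ f (halfBall p r) ∧
      ∀ y ∈ halfBall p r,
        t i j y - C * ((if i = 0 then 1 else 0) * (if j = 0 then 1 else 0)) = y 0 * f y := by
    intro i j
    refine exists_eq_mul_of_eq_zero hp ((hts i j).sub contDiffOn_const) fun y hy hy0 => ?_
    by_cases hij : i = 0 ∧ j = 0
    · obtain ⟨rfl, rfl⟩ := hij
      simp [hC y hy hy0]
    · rw [h.scaled_metric_eq_zero hts ht hij hy hy0]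
      by_cases hi : i = 0
      · have hj : j ≠ 0 := fun hj => hij ⟨hi, hj⟩
        simp [hj]
      · simp [hi]
  choose H hHs hHt using hH
  -- Dividing each column of t other than column 0 by y⁰ divides the determinant by (y⁰)ⁿ, which
  -- turns det t = (y⁰)²ⁿ⁺² det g into v; unlike t, the matrix B stays invertible on the boundary.
  let B : EuclideanSpace ℝ (Fin (n + 1)) → Matrix (Fin (n + 1)) (Fin (n + 1)) ℝ := fun y =>
    Matrix.of fun i j => if j = 0 then t i 0 y else H i j y
  have hBs : ContDiffOn ℝ ∞ (fun y => (B y).det) (halfBall p r) := by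
    refine contDiffOn_det fun i j => ?_
    simp only [B, Matrix.of_apply]
    split_ifs
    · exact hts i 0
    · exact hHs i j
  have hBv : EqOn (fun y => (B y).det) v (halfBall p r) := by
    refine eqOn_halfBall_of_eqOn hBs.continuousOn hvs.continuousOn fun y hy => ?_
    have hy0 : y 0 ≠ 0 := (mem_openHalfBall.1 hy).2.ne'
    have hyh := openHalfBall_subset_halfBall hy
    have h1 : (Matrix.of fun i j => t i j y) = Matrix.of fun i j =>
        (if j = 0 then 1 else y 0) * B y i j := by
      ext i j
      simp only [Matrix.of_apply, B]
      split_ifs with hj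
      · rw [hj, one_mul]
      · rw [← hHt i j y hyh]
        simp [hj]
    have h2 : (Matrix.of fun i j => t i j y).det = y 0 ^ n * (B y).det := by
      rw [h1, Matrix.det_mul_row, Fin.prod_univ_succ]
      simp
    have h3 : (Matrix.of fun i j => t i j y) = y 0 ^ 2 • Matrix.of fun i j => g i j y := by
      ext i j
      simp [ht i j y hy]
    rw [h3, Matrix.det_smul, Fintype.card_fin] at h2
    refine mul_left_cancel₀ (pow_ne_zero n hy0) (h2.symm.trans ?_)
    rw [hv y hy]
    ring
  refine ⟨C, H, fun hC0 => ?_, hC, hHs, fun i j y hy => ?_, fun y hy hy0 w hw0 hw => ?_⟩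
  -- If C were 0, column 0 of B would vanish at p.
  · refine hv0 p hpm ?_
    rw [← hBv hpm]
    refine Matrix.det_eq_zero_of_column_eq_zero 0 fun i => ?_
    simp only [B, Matrix.of_apply, if_true]
    by_cases hi : i = 0
    · rw [hi]
      exact hC0
    · exact h.scaled_metric_eq_zero hts ht (fun hh => hi hh.1) hpm hp
  · have hy0 : y 0 ≠ 0 := (mem_openHalfBall.1 hy).2.ne'
    have h1 := hHt i j y (openHalfBall_subset_halfBall hy)
    rw [ht i j y hy] at h1
    refine mul_left_cancel₀ hy0 (h1.symm.trans ?_)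
    field_simp
  -- A vector w in the tangential kernel of H is in the left kernel of B: column 0 of B has only its
  -- 0-th entry on the boundary, and w 0 = 0.
  · have hdet : (B y).det ≠ 0 := by
      have := hBv hy
      simp only at this
      rw [this]
      exact hv0 y hy
    refine Matrix.eq_zero_of_vecMul_eq_zero hdet ?_
    ext j
    rw [Matrix.vecMul, dotProduct, Pi.zero_apply]
    by_cases hj : j = 0
    · refine Finset.sum_eq_zero fun i _ => ?_
      by_cases hi : i = 0
      · rw [hi, hw0, zero_mul]
      · simp [B, hj,
          h.scaled_metric_eq_zero hts ht (fun hh => hi hh.1 : ¬ (i = 0 ∧ (0 : Fin (n + 1)) = 0)) hy hy0]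
    · simpa [B, hj] using hw j hj

end IsCompactCoord

end BoundaryBehaviour

/-! ### Ricci and scalar curvature under the projective modification -/

section ScalarComponents

variable {n : ℕ} {p : EuclideanSpace ℝ (Fin (n + 1))} {r : ℝ}
  {g : Fin (n + 1) → Fin (n + 1) → EuclideanSpace ℝ (Fin (n + 1)) → ℝ}
  {c Γ : Fin (n + 1) → Fin (n + 1) → Fin (n + 1) → EuclideanSpace ℝ (Fin (n + 1)) → ℝ}
  {s t : Fin (n + 1) → Fin (n + 1) → EuclideanSpace ℝ (Fin (n + 1)) → ℝ}
  {μ : Fin (n + 1) → EuclideanSpace ℝ (Fin (n + 1)) → ℝ}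

/-- The Ricci curvature of a torsion-free connection in terms of its Christoffel symbols and of
their partial derivatives. -/
def ricciComponents (Γ : Fin (n + 1) → Fin (n + 1) → Fin (n + 1) → ℝ)
    (dΓ : Fin (n + 1) → Fin (n + 1) → Fin (n + 1) → Fin (n + 1) → ℝ) (j k : Fin (n + 1)) : ℝ :=
  ∑ i, (dΓ i i j k - dΓ j i i k + ∑ l, Γ i i l * Γ l j k - ∑ l, Γ i j l * Γ l i k)

/-- The effect of a projective modification on the quadratic part of the Ricci curvature. -/
lemma ricci_quadratic_modified (Γ C : Fin (n + 1) → Fin (n + 1) → Fin (n + 1) → ℝ) (κ : ℝ)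
    (hΓ : ∀ l i j, Γ l i j = Γ l j i)
    (hC : ∀ l i j, C l i j = Γ l i j - κ * ((if i = 0 then (if l = j then 1 else 0) else 0) +
      (if j = 0 then (if l = i then 1 else 0) else 0))) (j k : Fin (n + 1)) :
    ∑ i, (∑ l, C i i l * C l j k - ∑ l, C i j l * C l i k) =
      ∑ i, (∑ l, Γ i i l * Γ l j k - ∑ l, Γ i j l * Γ l i k) - n * κ * Γ 0 j k +
        n * κ ^ 2 * ((if j = 0 then 1 else 0) * (if k = 0 then 1 else 0)) := by
  let G : Fin (n + 1) → Matrix (Fin (n + 1)) (Fin (n + 1)) ℝ := fun j => Matrix.of fun i l => Γ i j l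
  let e : Fin (n + 1) → Fin (n + 1) → ℝ := fun i => Pi.single i 1
  let D : Fin (n + 1) → ℝ := fun j => if j = 0 then 1 else 0
  let A : Fin (n + 1) → Matrix (Fin (n + 1)) (Fin (n + 1)) ℝ := fun j => Matrix.of fun i l => C i j l
  -- The modification is a scalar matrix plus a rank-one matrix, so both quadratic sums reduce to
  -- traces of such products.
  have hA : ∀ j, A j = G j - κ • (D j • (1 : Matrix _ _ ℝ) + Matrix.vecMulVec (e j) (e 0)) := by
    intro j
    ext i l
    simp only [A, G, D, e, Matrix.of_apply, hC, Matrix.sub_apply, Matrix.smul_apply,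
      Matrix.add_apply, Matrix.one_apply, Matrix.vecMulVec_apply, smul_eq_mul, Pi.single_apply]
    congr 2
    split_ifs <;> simp
  have hCs : ∀ l i j, C l i j = C l j i := fun l i j => by
    rw [hC, hC, hΓ]
    ring
  have q2 : ∀ (X : Fin (n + 1) → Fin (n + 1) → Fin (n + 1) → ℝ), (∀ l i j, X l i j = X l j i) →
      ∑ i, ∑ l, X i j l * X l i k =
        ((Matrix.of fun i l => X i j l) * (Matrix.of fun i l => X i k l)).trace := by
    intro X hX
    rw [Matrix.trace]
    refine Finset.sum_congr rfl fun i _ => ?_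
    rw [Matrix.diag_apply, Matrix.mul_apply]
    exact Finset.sum_congr rfl fun l _ => by rw [hX l i k]; rfl
  have q1 : ∀ (X : Fin (n + 1) → Fin (n + 1) → Fin (n + 1) → ℝ), (∀ l i j, X l i j = X l j i) →
      ∑ i, ∑ l, X i i l * X l j k = ∑ l, (Matrix.of fun i m => X i l m).trace * X l j k := by
    intro X hX
    rw [Finset.sum_comm]
    refine Finset.sum_congr rfl fun l _ => ?_
    rw [Matrix.trace, Finset.sum_mul]
    exact Finset.sum_congr rfl fun i _ => by rw [hX i i l]; rfl
  have tA : ∀ l, (A l).trace = (G l).trace - κ * (n + 2) * D l := by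
    intro l
    rw [hA]
    simp only [Matrix.trace_sub, Matrix.trace_smul, Matrix.trace_add, Matrix.trace_one,
      Matrix.trace_vecMulVec, Fintype.card_fin, smul_eq_mul, e, D, single_dotProduct, one_mul,
      Pi.single_apply]
    push_cast
    split_ifs <;> ring
  have hGm : ∀ j k : Fin (n + 1), e 0 ⬝ᵥ (G j).mulVec (e k) = Γ 0 j k := by
    intro j k
    simp [e, G]
  have hGv : ∀ j k : Fin (n + 1), e j ⬝ᵥ Matrix.vecMul (e 0) (G k) = Γ 0 k j := by
    intro j k
    simp [e, G]
  have hGv' : ∀ j k : Fin (n + 1), (G j).mulVec (e k) ⬝ᵥ e 0 = Γ 0 j k := by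
    intro j k
    rw [dotProduct_comm, hGm]
  have hee : ∀ j : Fin (n + 1), e j ⬝ᵥ e 0 = D j := by
    intro j
    simp [e, D, Pi.single_apply, eq_comm]
  have hee' : ∀ j : Fin (n + 1), e 0 ⬝ᵥ e j = D j := fun j => by rw [dotProduct_comm, hee]
  have tAA : (A j * A k).trace = (G j * G k).trace - κ * (D j * (G k).trace + Γ 0 j k +
      D k * (G j).trace + Γ 0 j k) + κ ^ 2 * ((n + 4) * (D j * D k)) := by
    rw [hA, hA]
    simp only [Matrix.sub_mul, Matrix.mul_sub, Matrix.smul_mul, Matrix.mul_smul, Matrix.add_mul,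
      Matrix.mul_add, Matrix.one_mul, Matrix.mul_one, Matrix.trace_sub, Matrix.trace_add,
      Matrix.trace_smul]
    simp only [Matrix.vecMulVec_mul, Matrix.vecMul_vecMulVec, Matrix.mul_vecMulVec (G j),
      Matrix.trace_vecMulVec, Matrix.trace_one, Fintype.card_fin, smul_eq_mul, hGv, hGv', hee,
      hΓ 0 k j, dotProduct_smul, hee']
    push_cast
    ring
  have hlin : ∑ l, (A l).trace * C l j k = ∑ l, (G l).trace * Γ l j k -
      κ * (D j * (G k).trace + D k * (G j).trace) - κ * (n + 2) * Γ 0 j k +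
        κ ^ 2 * (n + 2) * (2 * (D j * D k)) := by
    have h1 : ∀ l, (A l).trace * C l j k = (G l).trace * Γ l j k -
        κ * (D j * ((if l = k then 1 else 0) * (G l).trace) +
          D k * ((if l = j then 1 else 0) * (G l).trace)) -
        κ * (n + 2) * ((if l = 0 then 1 else 0) * Γ l j k) +
        κ ^ 2 * (n + 2) * (D j * ((if l = k then 1 else 0) * D l) +
          D k * ((if l = j then 1 else 0) * D l)) := by
      intro l
      have : C l j k = Γ l j k - κ * (D j * (if l = k then 1 else 0) +
          D k * (if l = j then 1 else 0)) := by
        rw [hC]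
        simp only [D, ite_mul, one_mul, zero_mul]
      rw [tA, this]
      simp only [D]
      ring
    simp only [h1, Finset.sum_add_distrib, Finset.sum_sub_distrib, ← Finset.mul_sum, ite_mul,
      one_mul, zero_mul, Finset.sum_ite_eq', Finset.mem_univ, if_true]
    ring
  rw [Finset.sum_sub_distrib, Finset.sum_sub_distrib, q1 C hCs, q2 C hCs, q1 Γ hΓ, q2 Γ hΓ]
  change ∑ l, (A l).trace * C l j k - (A j * A k).trace =
    ∑ l, (G l).trace * Γ l j k - (G j * G k).trace - n * κ * Γ 0 j k + n * κ ^ 2 * (D j * D k)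
  rw [hlin, tAA]
  ring

namespace IsCompactCoord

lemma pd_christoffel (h : IsCompactCoord p r g c Γ) {y : EuclideanSpace ℝ (Fin (n + 1))}
    (hy : y ∈ openHalfBall p r) (k l i j : Fin (n + 1)) :
    pd k (c l i j) y = pd k (Γ l i j) y + 1 / (2 * y 0 ^ 2) * (if k = 0 then 1 else 0) *
      ((if i = 0 then (if l = j then 1 else 0) else 0) +
      (if j = 0 then (if l = i then 1 else 0) else 0)) := by
  set a : ℝ := (if i = 0 then (if l = j then 1 else 0) else 0) +
      (if j = 0 then (if l = i then 1 else 0) else 0) with ha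
  have hy0 : y 0 ≠ 0 := (mem_openHalfBall.1 hy).2.ne'
  have hΓd : DifferentiableAt ℝ (Γ l i j) y := differentiableAt_of_contDiffOn isOpen_openHalfBall
    ((h.smooth_modified l i j).mono openHalfBall_subset_halfBall) hy
  have h0 : HasFDerivAt (fun z : EuclideanSpace ℝ (Fin (n + 1)) => z 0)
      (EuclideanSpace.proj (𝕜 := ℝ) (0 : Fin (n + 1))) y :=
    (EuclideanSpace.proj (𝕜 := ℝ) (0 : Fin (n + 1))).hasFDerivAt
  have h1 : HasFDerivAt (fun z : EuclideanSpace ℝ (Fin (n + 1)) => (z 0)⁻¹) _ y :=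
    (hasDerivAt_inv hy0).comp_hasFDerivAt y h0
  have h2 : pd k (fun z => (a / 2) * (z 0)⁻¹) y =
      -(1 / (2 * y 0 ^ 2) * (if k = 0 then 1 else 0) * a) := by
    rw [pd_const_mul h1.differentiableAt, pd, h1.fderiv]
    by_cases hk : k = 0
    · subst hk
      simp
      field_simp
    · simp [hk, Ne.symm hk]
  rw [pd_congr isOpen_openHalfBall (g := fun z => Γ l i j z - (a / 2) * (z 0)⁻¹) (fun z hz => by
    rw [h.christoffel_eq hz, ← ha]
    have hz0 : z 0 ≠ 0 := (mem_openHalfBall.1 hz).2.ne'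
    field_simp) hy, pd_sub hΓd (h1.differentiableAt.const_mul _), h2]
  ring

/-- The Ricci curvature in terms of the modified connection. -/
lemma ricci_eq (h : IsCompactCoord p r g c Γ) {y : EuclideanSpace ℝ (Fin (n + 1))}
    (hy : y ∈ openHalfBall p r) (j k : Fin (n + 1)) :
    ricciComponents (fun l i j => c l i j y) (fun m l i j => pd m (c l i j) y) j k =
      ricciComponents (fun l i j => Γ l i j y) (fun m l i j => pd m (Γ l i j) y) j k
        - n / (4 * y 0 ^ 2) * ((if j = 0 then 1 else 0) * (if k = 0 then 1 else 0))
        - n / (2 * y 0) * Γ 0 j k y := by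
  have hy0 : y 0 ≠ 0 := (mem_openHalfBall.1 hy).2.ne'
  have hq := ricci_quadratic_modified (fun l i j => Γ l i j y) (fun l i j => c l i j y)
    (1 / (2 * y 0)) (fun l i j => h.modified_symm l i j (openHalfBall_subset_halfBall hy))
    (fun l i j => h.christoffel_eq hy l i j) j k
  -- The derivative terms contribute -n / (2 (y⁰)²); the quadratic terms, with κ = 1 / (2 y⁰),
  -- contribute +n / (4 (y⁰)²). The sum is the coefficient -n / (4 (y⁰)²).
  have hd : ∑ i, (pd i (c i j k) y - pd j (c i i k) y) =
      ∑ i, (pd i (Γ i j k) y - pd j (Γ i i k) y) - n / (2 * y 0 ^ 2) *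
        ((if j = 0 then 1 else 0) * (if k = 0 then 1 else 0)) := by
    simp only [h.pd_christoffel hy, Finset.sum_sub_distrib, Finset.sum_add_distrib, if_true]
    have e1 : ∑ i, 1 / (2 * y 0 ^ 2) * (if i = 0 then 1 else 0) *
        ((if j = 0 then (if i = k then 1 else 0) else 0) +
          (if k = 0 then (if i = j then 1 else 0) else 0)) =
        1 / (y 0 ^ 2) * ((if j = 0 then 1 else 0) * (if k = 0 then 1 else 0)) := by
      simp only [mul_assoc, ← Finset.mul_sum, ite_mul, one_mul, zero_mul, Finset.sum_ite_eq',
        Finset.mem_univ, if_true, eq_comm (a := (0 : Fin (n + 1)))]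
      split_ifs <;> field_simp <;> norm_num
    have e2 : ∑ i : Fin (n + 1), 1 / (2 * y 0 ^ 2) * (if j = 0 then 1 else 0) *
        ((if i = 0 then (if i = k then 1 else 0) else 0) +
          (if k = 0 then 1 else 0)) =
        (n + 2) / (2 * y 0 ^ 2) * ((if j = 0 then 1 else 0) * (if k = 0 then 1 else 0)) := by
      by_cases hk : k = 0
      · simp [hk, ← Finset.mul_sum, Finset.sum_add_distrib]
        split_ifs
        · field_simp
          ring
        · rfl
      · simp [hk, Ne.symm hk]
    rw [e1, e2]
    field_simp
    ring
  simp only [ricciComponents]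
  have hsplit : ∀ (X : Fin (n + 1) → Fin (n + 1) → Fin (n + 1) → ℝ)
      (Y : Fin (n + 1) → Fin (n + 1) → Fin (n + 1) → Fin (n + 1) → ℝ),
      ∑ i, (Y i i j k - Y j i i k + ∑ l, X i i l * X l j k - ∑ l, X i j l * X l i k) =
        ∑ i, (Y i i j k - Y j i i k) + ∑ i, (∑ l, X i i l * X l j k - ∑ l, X i j l * X l i k) := by
    intro X Y
    rw [← Finset.sum_add_distrib]
    exact Finset.sum_congr rfl fun i _ => by ring
  rw [hsplit (fun l i j => c l i j y) (fun m l i j => pd m (c l i j) y),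
    hsplit (fun l i j => Γ l i j y) (fun m l i j => pd m (Γ l i j) y), hd, hq]
  field_simp
  ring

/-- The scalar curvature extends smoothly to the boundary, with boundary value determined by the
leading coefficient of the metric. -/
lemma exists_scalar_extension (h : IsCompactCoord p r g c Γ) {C : ℝ}
    (hss : ∀ i j, ContDiffOn ℝ ∞ (s i j) (halfBall p r))
    (hts : ∀ i j, ContDiffOn ℝ ∞ (t i j) (halfBall p r))
    (hμs : ∀ i, ContDiffOn ℝ ∞ (μ i) (halfBall p r))
    (hs : ∀ i j, ∀ y ∈ openHalfBall p r, s i j y = inverseComponents g i j y / y 0)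
    (ht : ∀ i j, ∀ y ∈ openHalfBall p r, t i j y = y 0 ^ 2 * g i j y)
    (hμ : ∀ i, ∀ y ∈ openHalfBall p r, μ i y = inverseComponents g i 0 y / (2 * y 0 ^ 2))
    (hC : ∀ y ∈ halfBall p r, y 0 = 0 → t 0 0 y = C) :
    ∃ S : EuclideanSpace ℝ (Fin (n + 1)) → ℝ, ContDiffOn ℝ ∞ S (halfBall p r) ∧
      (∀ y ∈ openHalfBall p r, S y = ∑ j, ∑ k, inverseComponents g k j y *
        ricciComponents (fun l i j => c l i j y) (fun m l i j => pd m (c l i j) y) j k) ∧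
      ∀ y ∈ halfBall p r, y 0 = 0 → S y = -(n * (n + 1)) / (4 * C) := by
  have hΓ := h.smooth_modified
  have hO := isOpen_openHalfBall (p := p) (r := r)
  have hμd : ∀ i, ∀ y ∈ openHalfBall p r, DifferentiableAt ℝ (μ i) y := fun i y hy =>
    differentiableAt_of_contDiffOn hO ((hμs i).mono openHalfBall_subset_halfBall) hy
  have hsμ : ∀ i, ∀ y ∈ openHalfBall p r, s i 0 y = y 0 * (2 * μ i y) := fun i y hy => by
    have hy0 : y 0 ≠ 0 := (mem_openHalfBall.1 hy).2.ne'
    rw [hs i 0 y hy, hμ i y hy]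
    field_simp
  have hs_symm : ∀ i j, ∀ y ∈ openHalfBall p r, s i j y = s j i y := fun i j y hy => by
    rw [hs i j y hy, hs j i y hy, h.inverse_symm hy]
  -- Two expressions for the divergence ∂ₖ s⁰ᵏ are compared: one from s⁰ᵏ = 2 y⁰ μᵏ, the other from
  -- the metrisability equation.
  have htrace : EqOn (fun y => ∑ k, ∑ l, Γ 0 k l y * s l k y) (fun y => n * μ 0 y -
      y 0 * (2 * ∑ k, (pdWithin (halfBall p r) k (μ k) y + ∑ l, Γ k k l y * μ l y)))
      (halfBall p r) := by
    refine eqOn_halfBall_of_eqOn (ContDiffOn.sum fun k _ => ContDiffOn.sum fun l _ =>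
      (hΓ 0 k l).mul (hss l k)).continuousOn ((contDiffOn_const.mul (hμs 0)).sub
      ((contDiffOn_coord 0).mul (contDiffOn_const.mul (ContDiffOn.sum fun k _ =>
        (contDiffOn_pdWithin (hμs k) k).add (ContDiffOn.sum fun l _ =>
          (hΓ k k l).mul (hμs l)))))).continuousOn fun y hy => ?_
    have h1 : ∀ k, pd k (s 0 k) y = (if k = 0 then 1 else 0) * (2 * μ k y) +
        y 0 * (2 * pd k (μ k) y) := fun k => by
      rw [pd_congr hO (fun z hz => (hs_symm 0 k z hz).trans (hsμ k z hz)) hy,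
        pd_coord_mul ((hμd k y hy).const_mul 2), pd_const_mul (hμd k y hy)]
    have h2 : ∀ k, pd k (s 0 k) y = (if k = 0 then 1 else 0) * μ k y + μ 0 y -
        ∑ l, (Γ 0 k l y * s l k y + y 0 * (2 * (Γ k k l y * μ l y))) := fun k => by
      have := h.pd_scaled_inverse hy k 0 k
      rw [pd_congr hO (fun z hz => hs 0 k z hz) hy, this, ← hμ k y hy, ← hμ 0 y hy, if_pos rfl]
      simp only [ite_mul, one_mul, zero_mul, ← hs _ _ y hy]
      congr 1
      refine Finset.sum_congr rfl fun l _ => ?_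
      rw [hs_symm 0 l y hy, hsμ l y hy]
      ring
    have h3 : ∑ k, ((if k = 0 then 1 else 0) * (2 * μ k y) + y 0 * (2 * pd k (μ k) y)) =
        ∑ k, ((if k = 0 then 1 else 0) * μ k y + μ 0 y -
        ∑ l, (Γ 0 k l y * s l k y + y 0 * (2 * (Γ k k l y * μ l y)))) :=
      Finset.sum_congr rfl fun k _ => (h1 k).symm.trans (h2 k)
    simp only [Finset.sum_add_distrib, Finset.sum_sub_distrib, ← Finset.mul_sum, ite_mul, one_mul,
      zero_mul, Finset.sum_ite_eq', Finset.mem_univ, if_true, Finset.sum_const, Finset.card_univ,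
      Fintype.card_fin, nsmul_eq_mul] at h3
    push_cast at h3
    have hpd : ∀ k f, fderiv ℝ f y (EuclideanSpace.single k 1) = pd k f y := fun _ _ => rfl
    simp only [pdWithin_eq hy, Finset.sum_add_distrib, hpd]
    linarith
  -- The (0, 0) entry of g g⁻¹ = 1 in rescaled form: the powers of y⁰ in t and μ cancel.
  have hnorm : EqOn (fun y => 2 * ∑ j, t 0 j y * μ j y) (fun _ => 1) (halfBall p r) := by
    refine eqOn_halfBall_of_eqOn (contDiffOn_const.mul (ContDiffOn.sum fun j _ =>
      (hts 0 j).mul (hμs j))).continuousOn continuousOn_const fun y hy => ?_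
    have hy0 : y 0 ≠ 0 := (mem_openHalfBall.1 hy).2.ne'
    have h1 := h.mul_inverse hy 0 0
    rw [if_pos rfl] at h1
    rw [← h1, Finset.mul_sum]
    refine Finset.sum_congr rfl fun j _ => ?_
    rw [ht 0 j y hy, hμ j y hy]
    field_simp
  -- Contraction of `ricci_eq` with g⁻¹ = y⁰ s. The double pole meets g⁰⁰ = 2 (y⁰)² μ⁰ and gives the
  -- term n/2 μ⁰.
  refine ⟨fun y => y 0 * (∑ j, ∑ k, s k j y * ricciComponents (fun l i j => Γ l i j y)
    (fun m l i j => pdWithin (halfBall p r) m (Γ l i j) y) j k) - n / 2 * μ 0 y -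
      n / 2 * ∑ j, ∑ k, Γ 0 j k y * s k j y, ?_, fun y hy => ?_, fun y hy hy0 => ?_⟩
  · refine (((contDiffOn_coord 0).mul (ContDiffOn.sum fun j _ => ContDiffOn.sum fun k _ =>
      (hss k j).mul ?_)).sub (contDiffOn_const.mul (hμs 0))).sub (contDiffOn_const.mul
        (ContDiffOn.sum fun j _ => ContDiffOn.sum fun k _ => (hΓ 0 j k).mul (hss k j)))
    refine ContDiffOn.sum fun i _ => ContDiffOn.sub (ContDiffOn.add (ContDiffOn.sub
      (contDiffOn_pdWithin (hΓ i j k) i) (contDiffOn_pdWithin (hΓ i i k) j)) ?_) ?_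
    · exact ContDiffOn.sum fun l _ => (hΓ i i l).mul (hΓ l j k)
    · exact ContDiffOn.sum fun l _ => (hΓ i j l).mul (hΓ l i k)
  · have hy0 : y 0 ≠ 0 := (mem_openHalfBall.1 hy).2.ne'
    have hQ : ∀ j k, inverseComponents g k j y = y 0 * s k j y := fun j k => by
      rw [hs k j y hy]
      field_simp
    simp only [h.ricci_eq hy, pdWithin_eq hy]
    have h1 : ∀ j k, inverseComponents g k j y *
        (ricciComponents (fun l i j => Γ l i j y) (fun m l i j => pd m (Γ l i j) y) j k
        - n / (4 * y 0 ^ 2) * ((if j = 0 then 1 else 0) * (if k = 0 then 1 else 0))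
        - n / (2 * y 0) * Γ 0 j k y) = y 0 * (s k j y * ricciComponents (fun l i j => Γ l i j y)
          (fun m l i j => pd m (Γ l i j) y) j k) - n / (4 * y 0) *
          ((if j = 0 then 1 else 0) * ((if k = 0 then 1 else 0) * s k j y)) -
          n / 2 * (Γ 0 j k y * s k j y) := fun j k => by
      rw [hQ]
      field_simp
    simp only [h1, Finset.sum_sub_distrib, ← Finset.mul_sum]
    congr 2
    simp only [ite_mul, one_mul, zero_mul, Finset.sum_ite_eq', Finset.mem_univ, if_true]
    rw [hsμ 0 y hy]
    field_simp
    ring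
  · have h1 := htrace hy
    have h2 := hnorm hy
    simp only [hy0, zero_mul, sub_zero] at h1
    simp only at h2
    rw [Finset.sum_eq_single 0 (fun j _ hj => by
      rw [h.scaled_metric_eq_zero hts ht (fun hh => hj hh.2) hy hy0, zero_mul]) (by simp),
      hC y hy hy0] at h2
    have hC0 : C ≠ 0 := by
      rintro rfl
      simp at h2
    have hμ0 : μ 0 y = 1 / (2 * C) := by
      field_simp
      linarith
    simp only [hy0, zero_mul, h1, hμ0]
    field_simp
    ring

end IsCompactCoord

/-- The local form of the result, for a metric given in components on a half ball. -/
theorem IsCompactCoord.exists_local_form (hn : 1 ≤ n) (h : IsCompactCoord p r g c Γ) (hp : p 0 = 0)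
    {r' : ℝ} (hr' : 0 < r') (hr : r' < r) :
    ∃ (C : ℝ) (H : Fin (n + 1) → Fin (n + 1) → EuclideanSpace ℝ (Fin (n + 1)) → ℝ)
      (S : EuclideanSpace ℝ (Fin (n + 1)) → ℝ), C ≠ 0 ∧
      (∀ i j, ContDiffOn ℝ ∞ (H i j) (halfBall p r')) ∧ ContDiffOn ℝ ∞ S (halfBall p r') ∧
      (∀ i j, ∀ y ∈ openHalfBall p r', H i j y =
        y 0 * g i j y - C / y 0 * ((if i = 0 then 1 else 0) * (if j = 0 then 1 else 0))) ∧
      (∀ y ∈ halfBall p r', y 0 = 0 → ∀ w : Fin (n + 1) → ℝ, w 0 = 0 →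
        (∀ j ≠ 0, ∑ i, w i * H i j y = 0) → w = 0) ∧
      (∀ y ∈ openHalfBall p r', S y = ∑ j, ∑ k, inverseComponents g k j y *
        ricciComponents (fun l i j => c l i j y) (fun m l i j => pd m (c l i j) y) j k) ∧
      ∀ y ∈ halfBall p r', y 0 = 0 → S y = -(n * (n + 1)) / (4 * C) := by
  obtain ⟨s, t, μ, v, hss, hts, hμs, hvs, hs, ht, hμ, hv, hv0⟩ :=
    h.exists_extension hn hp.ge hr' hr
  have h' := h.mono hr.le
  obtain ⟨C, H, hC0, hC, hHs, hH, hnd⟩ := h'.exists_asymptotic_form hp hr' hts hvs ht hv hv0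
  obtain ⟨S, hSs, hS, hSb⟩ := h'.exists_scalar_extension hss hts hμs hs ht hμ hC
  exact ⟨C, H, S, hC0, hHs, hSs, hH, hnd, hS, hSb⟩

end ScalarComponents

/-! ### The Levi-Civita connection of a metric on an open subset of coordinate space -/

section CoordinateMetric

variable {m : ℕ} {G : EuclideanSpace ℝ (Fin m) →
    EuclideanSpace ℝ (Fin m) →L[ℝ] EuclideanSpace ℝ (Fin m) →L[ℝ] ℝ}
  {Ω : Set (EuclideanSpace ℝ (Fin m))} {y : EuclideanSpace ℝ (Fin m)}

/-- A pseudo-Riemannian metric on an open subset of the coordinate space. -/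
structure IsMetricOn (G : EuclideanSpace ℝ (Fin m) →
    EuclideanSpace ℝ (Fin m) →L[ℝ] EuclideanSpace ℝ (Fin m) →L[ℝ] ℝ)
    (Ω : Set (EuclideanSpace ℝ (Fin m))) : Prop where
  smooth : ContDiffOn ℝ ∞ G Ω
  symm : ∀ y ∈ Ω, ∀ u v, G y u v = G y v u
  nondegenerate : ∀ y ∈ Ω, ∀ u, (∀ v, G y u v = 0) → u = 0

lemma finrank_dual_euclidean :
    Module.finrank ℝ (EuclideanSpace ℝ (Fin m)) =
      Module.finrank ℝ (EuclideanSpace ℝ (Fin m) →L[ℝ] ℝ) :=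
  ((LinearMap.toContinuousLinearMap (𝕜 := ℝ) (E := EuclideanSpace ℝ (Fin m)) (F' := ℝ)).finrank_eq.symm.trans
    (Subspace.dual_finrank_eq (K := ℝ) (V := EuclideanSpace ℝ (Fin m)))).symm

/-- Non-degeneracy is injectivity of the map to the dual, which has the same finite dimension. -/
lemma isInvertible_of_nondegenerate
    {b : EuclideanSpace ℝ (Fin m) →L[ℝ] EuclideanSpace ℝ (Fin m) →L[ℝ] ℝ}
    (hb : ∀ u, (∀ v, b u v = 0) → u = 0) : b.IsInvertible := by
  have hinj : Function.Injective (b : EuclideanSpace ℝ (Fin m) →ₗ[ℝ]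
      EuclideanSpace ℝ (Fin m) →L[ℝ] ℝ) := by
    rw [← LinearMap.ker_eq_bot, LinearMap.ker_eq_bot']
    intro u hu
    exact hb u fun v => DFunLike.congr_fun hu v
  refine ⟨(LinearEquiv.ofInjectiveOfFinrankEq _ hinj finrank_dual_euclidean).toContinuousLinearEquiv,
    ?_⟩
  ext u v
  rfl

/-- The Christoffel symbols of the first kind. -/
def firstKind (G : EuclideanSpace ℝ (Fin m) →
    EuclideanSpace ℝ (Fin m) →L[ℝ] EuclideanSpace ℝ (Fin m) →L[ℝ] ℝ)
    (y u v : EuclideanSpace ℝ (Fin m)) : EuclideanSpace ℝ (Fin m) →L[ℝ] ℝ :=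
  (1 / 2 : ℝ) • (fderiv ℝ G y u v + fderiv ℝ G y v u - ((fderiv ℝ G y).flip u).flip v)

lemma firstKind_apply (u v w : EuclideanSpace ℝ (Fin m)) :
    firstKind G y u v w =
      1 / 2 * (fderiv ℝ G y u v w + fderiv ℝ G y v u w - fderiv ℝ G y w u v) := rfl

lemma christoffel_eq (u v : EuclideanSpace ℝ (Fin m)) :
    christoffel G y u v = (G y).inverse (firstKind G y u v) := rfl

/-- `christoffel` is defined as a plain function of two vectors; this and the following three lemmas
give the bilinearity packaged in `christoffelBilin`. -/
lemma firstKind_add_left (u u' v : EuclideanSpace ℝ (Fin m)) :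
    firstKind G y (u + u') v = firstKind G y u v + firstKind G y u' v := by
  ext1 w
  have h1 : fderiv ℝ G y (u + u') v w = fderiv ℝ G y u v w + fderiv ℝ G y u' v w := by
    rw [(fderiv ℝ G y).map_add]; rfl
  have h2 : fderiv ℝ G y v (u + u') w = fderiv ℝ G y v u w + fderiv ℝ G y v u' w := by
    rw [(fderiv ℝ G y v).map_add]; rfl
  have h3 : fderiv ℝ G y w (u + u') v = fderiv ℝ G y w u v + fderiv ℝ G y w u' v := by
    rw [(fderiv ℝ G y w).map_add]; rfl
  rw [add_apply, firstKind_apply, firstKind_apply, firstKind_apply, h1, h2, h3]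
  ring

lemma firstKind_add_right (u v v' : EuclideanSpace ℝ (Fin m)) :
    firstKind G y u (v + v') = firstKind G y u v + firstKind G y u v' := by
  ext1 w
  have h1 : fderiv ℝ G y (v + v') u w = fderiv ℝ G y v u w + fderiv ℝ G y v' u w := by
    rw [(fderiv ℝ G y).map_add]; rfl
  have h2 : fderiv ℝ G y u (v + v') w = fderiv ℝ G y u v w + fderiv ℝ G y u v' w := by
    rw [(fderiv ℝ G y u).map_add]; rfl
  have h3 : fderiv ℝ G y w u (v + v') = fderiv ℝ G y w u v + fderiv ℝ G y w u v' :=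
    (fderiv ℝ G y w u).map_add _ _
  rw [add_apply, firstKind_apply, firstKind_apply, firstKind_apply, h1, h2, h3]
  ring

lemma firstKind_smul_left (a : ℝ) (u v : EuclideanSpace ℝ (Fin m)) :
    firstKind G y (a • u) v = a • firstKind G y u v := by
  ext1 w
  have h1 : fderiv ℝ G y (a • u) v w = a * fderiv ℝ G y u v w := by
    rw [(fderiv ℝ G y).map_smul]; rfl
  have h2 : fderiv ℝ G y v (a • u) w = a * fderiv ℝ G y v u w := by
    rw [(fderiv ℝ G y v).map_smul]; rfl
  have h3 : fderiv ℝ G y w (a • u) v = a * fderiv ℝ G y w u v := by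
    rw [(fderiv ℝ G y w).map_smul]; rfl
  rw [smul_apply, smul_eq_mul, firstKind_apply, firstKind_apply, h1, h2, h3]
  ring

lemma firstKind_smul_right (a : ℝ) (u v : EuclideanSpace ℝ (Fin m)) :
    firstKind G y u (a • v) = a • firstKind G y u v := by
  ext1 w
  have h1 : fderiv ℝ G y (a • v) u w = a * fderiv ℝ G y v u w := by
    rw [(fderiv ℝ G y).map_smul]; rfl
  have h2 : fderiv ℝ G y u (a • v) w = a * fderiv ℝ G y u v w := by
    rw [(fderiv ℝ G y u).map_smul]; rfl
  have h3 : fderiv ℝ G y w u (a • v) = a * fderiv ℝ G y w u v :=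
    (fderiv ℝ G y w u).map_smul _ _
  rw [smul_apply, smul_eq_mul, firstKind_apply, firstKind_apply, h1, h2, h3]
  ring

/-- The Christoffel symbols as a bilinear map. -/
def christoffelBilin (G : EuclideanSpace ℝ (Fin m) →
    EuclideanSpace ℝ (Fin m) →L[ℝ] EuclideanSpace ℝ (Fin m) →L[ℝ] ℝ) (y : EuclideanSpace ℝ (Fin m)) :
    EuclideanSpace ℝ (Fin m) →ₗ[ℝ] EuclideanSpace ℝ (Fin m) →ₗ[ℝ] EuclideanSpace ℝ (Fin m) :=
  LinearMap.mk₂ ℝ (christoffel G y)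
    (fun u u' v => by simp only [christoffel_eq, firstKind_add_left, map_add])
    (fun a u v => by simp only [christoffel_eq, firstKind_smul_left, map_smul])
    (fun u v v' => by simp only [christoffel_eq, firstKind_add_right, map_add])
    (fun a u v => by simp only [christoffel_eq, firstKind_smul_right, map_smul])

lemma christoffelBilin_apply (u v : EuclideanSpace ℝ (Fin m)) :
    christoffelBilin G y u v = christoffel G y u v := rfl

lemma eq_sum_smul_single' (u : EuclideanSpace ℝ (Fin m)) :
    u = ∑ k, u k • EuclideanSpace.single k (1 : ℝ) := by
  ext l
  simp [Pi.single_apply]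

namespace IsMetricOn

lemma mono {Ω' : Set (EuclideanSpace ℝ (Fin m))} (h : IsMetricOn G Ω) (hΩ : Ω' ⊆ Ω) :
    IsMetricOn G Ω' where
  smooth := h.smooth.mono hΩ
  symm y hy := h.symm y (hΩ hy)
  nondegenerate y hy := h.nondegenerate y (hΩ hy)

lemma isInvertible (h : IsMetricOn G Ω) (hy : y ∈ Ω) : (G y).IsInvertible :=
  isInvertible_of_nondegenerate (h.nondegenerate y hy)

lemma apply_inverse (h : IsMetricOn G Ω) (hy : y ∈ Ω) (α : EuclideanSpace ℝ (Fin m) →L[ℝ] ℝ) :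
    G y ((G y).inverse α) = α := by
  obtain ⟨e, he⟩ := h.isInvertible hy
  rw [← he, ContinuousLinearMap.inverse_equiv]
  exact e.apply_symm_apply α

lemma ext_of_apply (h : IsMetricOn G Ω) (hy : y ∈ Ω) {u v : EuclideanSpace ℝ (Fin m)}
    (huv : ∀ w, G y u w = G y v w) : u = v := by
  rw [← sub_eq_zero]
  exact h.nondegenerate y hy _ fun w => by simp [huv w]

lemma apply_christoffel (h : IsMetricOn G Ω) (hy : y ∈ Ω) (u v w : EuclideanSpace ℝ (Fin m)) :
    G y (christoffel G y u v) w =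
      1 / 2 * (fderiv ℝ G y u v w + fderiv ℝ G y v u w - fderiv ℝ G y w u v) := by
  rw [christoffel_eq, h.apply_inverse hy, firstKind_apply]

lemma differentiableAt (hΩ : IsOpen Ω) (h : IsMetricOn G Ω) (hy : y ∈ Ω) :
    DifferentiableAt ℝ G y :=
  (h.smooth.contDiffAt (hΩ.mem_nhds hy)).differentiableAt (by simp)

lemma hasFDerivAt_apply (hΩ : IsOpen Ω) (h : IsMetricOn G Ω) (hy : y ∈ Ω)
    (u v : EuclideanSpace ℝ (Fin m)) :
    HasFDerivAt (fun z => G z u v) (((fderiv ℝ G y).flip u).flip v) y := by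
  have h1 := (h.differentiableAt hΩ hy).hasFDerivAt.clm_apply (hasFDerivAt_const u y)
  have h2 := h1.clm_apply (hasFDerivAt_const v y)
  refine h2.congr_fderiv ?_
  ext w
  simp

lemma fderiv_symm (hΩ : IsOpen Ω) (h : IsMetricOn G Ω) (hy : y ∈ Ω)
    (w u v : EuclideanSpace ℝ (Fin m)) : fderiv ℝ G y w u v = fderiv ℝ G y w v u := by
  have h1 := h.hasFDerivAt_apply hΩ hy u v
  have h2 := (h.hasFDerivAt_apply hΩ hy v u).congr_of_eventuallyEq
    (Filter.eventuallyEq_of_mem (hΩ.mem_nhds hy) fun z hz => h.symm z hz u v)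
  exact DFunLike.congr_fun (h1.unique h2) w

lemma christoffel_symm (hΩ : IsOpen Ω) (h : IsMetricOn G Ω) (hy : y ∈ Ω)
    (u v : EuclideanSpace ℝ (Fin m)) : christoffel G y u v = christoffel G y v u := by
  refine h.ext_of_apply hy fun w => ?_
  rw [h.apply_christoffel hy, h.apply_christoffel hy, h.fderiv_symm hΩ hy w u v]
  ring

lemma compatible (hΩ : IsOpen Ω) (h : IsMetricOn G Ω) (hy : y ∈ Ω)
    (w u v : EuclideanSpace ℝ (Fin m)) : fderiv ℝ G y w u v =
      G y (christoffel G y w u) v + G y u (christoffel G y w v) := by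
  rw [h.symm y hy u, h.apply_christoffel hy, h.apply_christoffel hy, 
    h.fderiv_symm hΩ hy w v u]
  ring

lemma contDiffOn_inverse (h : IsMetricOn G Ω) : ContDiffOn ℝ ∞ (fun y => (G y).inverse) Ω :=
  fun y hy => (h.isInvertible hy).contDiffAt_map_inverse.comp_contDiffWithinAt y (h.smooth y hy)

lemma contDiffOn_christoffel (hΩ : IsOpen Ω) (h : IsMetricOn G Ω) (u v : EuclideanSpace ℝ (Fin m)) :
    ContDiffOn ℝ ∞ (fun y => christoffel G y u v) Ω := by
  have hf : ∀ a b c : EuclideanSpace ℝ (Fin m), ContDiffOn ℝ ∞ (fun y => fderiv ℝ G y a b c) Ω := by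
    intro a b c
    have h1 : ContDiffOn ℝ ∞ (fun y => G y b c) Ω :=
      (h.smooth.clm_apply contDiffOn_const).clm_apply contDiffOn_const
    refine ((h1.fderiv_of_isOpen (m := ∞) hΩ (by simp)).clm_apply
      (contDiffOn_const (c := a))).congr fun z hz => ?_
    rw [(h.hasFDerivAt_apply hΩ hz b c).fderiv]
    rfl
  -- Expansion in the dual basis reduces smoothness of a covector field to that of its scalar
  -- components.
  have h1 : ∀ y, firstKind G y u v = ∑ k, firstKind G y u v
      (EuclideanSpace.single k 1) • EuclideanSpace.proj (𝕜 := ℝ) k := by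
    intro y
    ext w
    conv_lhs => rw [eq_sum_smul_single' w]
    simp [map_sum, mul_comm]
  simp only [christoffel_eq]
  refine h.contDiffOn_inverse.clm_apply ?_
  have h2 : ∀ k, ContDiffOn ℝ ∞ (fun y => firstKind G y u v (EuclideanSpace.single k 1)) Ω := by
    intro k
    simp only [firstKind_apply]
    exact contDiffOn_const.mul (((hf _ _ _).add (hf _ _ _)).sub (hf _ _ _))
  exact (ContDiffOn.sum fun k _ => (h2 k).smul contDiffOn_const).congr fun y _ => h1 y

end IsMetricOn

end CoordinateMetric

/-! ### From the invariant formulas to components -/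

section ToComponents

variable {n : ℕ} {G : EuclideanSpace ℝ (Fin (n + 1)) →
    EuclideanSpace ℝ (Fin (n + 1)) →L[ℝ] EuclideanSpace ℝ (Fin (n + 1)) →L[ℝ] ℝ}
  {Ω : Set (EuclideanSpace ℝ (Fin (n + 1)))} {y : EuclideanSpace ℝ (Fin (n + 1))}

/-- The components of a field of bilinear forms. -/
def formComponents (G : EuclideanSpace ℝ (Fin (n + 1)) →
    EuclideanSpace ℝ (Fin (n + 1)) →L[ℝ] EuclideanSpace ℝ (Fin (n + 1)) →L[ℝ] ℝ)
    (i j : Fin (n + 1)) (y : EuclideanSpace ℝ (Fin (n + 1))) : ℝ :=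
  G y (EuclideanSpace.single i 1) (EuclideanSpace.single j 1)

/-- The components of the Levi-Civita connection. -/
def christoffelComponents (G : EuclideanSpace ℝ (Fin (n + 1)) →
    EuclideanSpace ℝ (Fin (n + 1)) →L[ℝ] EuclideanSpace ℝ (Fin (n + 1)) →L[ℝ] ℝ)
    (l i j : Fin (n + 1)) (y : EuclideanSpace ℝ (Fin (n + 1))) : ℝ :=
  christoffel G y (EuclideanSpace.single i 1) (EuclideanSpace.single j 1) l

lemma form_apply_eq_sum (b : EuclideanSpace ℝ (Fin (n + 1)) →L[ℝ] EuclideanSpace ℝ (Fin (n + 1)) →L[ℝ] ℝ)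
    (u v : EuclideanSpace ℝ (Fin (n + 1))) : b u v = ∑ i, ∑ j, u i * v j *
      b (EuclideanSpace.single i 1) (EuclideanSpace.single j 1) := by
  conv_lhs => rw [eq_sum_smul_single' u, eq_sum_smul_single' v]
  simp only [map_sum, map_smul, sum_apply, smul_apply, smul_eq_mul, Finset.mul_sum]
  rw [Finset.sum_comm]
  exact Finset.sum_congr rfl fun i _ => Finset.sum_congr rfl fun j _ => by ring

namespace IsMetricOn

lemma isCoordMetric (hΩ : IsOpen Ω) (h : IsMetricOn G Ω) :
    IsCoordMetric Ω (formComponents G) (christoffelComponents G) where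
  smooth i j := (h.smooth.clm_apply contDiffOn_const).clm_apply contDiffOn_const
  symm i j y hy := h.symm y hy _ _
  det_ne_zero y hy hdet := by
    -- A left kernel vector of the component matrix would be a nonzero vector in the kernel of the
    -- form.
    obtain ⟨w, hw, hw0⟩ := Matrix.exists_vecMul_eq_zero_iff.2 hdet
    refine hw ?_
    have := h.nondegenerate y hy (WithLp.toLp 2 w) fun v => by
      rw [form_apply_eq_sum, Finset.sum_comm]
      refine Finset.sum_eq_zero fun j _ => ?_
      have h1 : ∑ i, w i * G y (EuclideanSpace.single i 1) (EuclideanSpace.single j 1) = 0 :=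
        congrFun hw0 j
      have h2 : ∑ i, w i * v j * G y (EuclideanSpace.single i 1) (EuclideanSpace.single j 1) =
          v j * ∑ i, w i * G y (EuclideanSpace.single i 1) (EuclideanSpace.single j 1) := by
        rw [Finset.mul_sum]
        exact Finset.sum_congr rfl fun i _ => by ring
      exact h2.trans (by rw [h1, mul_zero])
    ext i
    simpa using congrArg (fun u : EuclideanSpace ℝ (Fin (n + 1)) => u i) this
  symm_christoffel l i j y hy := by
    rw [christoffelComponents, christoffelComponents, h.christoffel_symm hΩ hy]
  compatible k i j y hy := by
    have h1 : pd k (formComponents G i j) y = fderiv ℝ G y (EuclideanSpace.single k 1)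
        (EuclideanSpace.single i 1) (EuclideanSpace.single j 1) := by
      have h2 : HasFDerivAt (formComponents G i j) _ y := h.hasFDerivAt_apply hΩ hy _ _
      rw [pd, h2.fderiv]
      rfl
    rw [h1, h.compatible hΩ hy, Finset.sum_add_distrib]
    congr 1
    · conv_lhs => rw [eq_sum_smul_single' (christoffel G y _ _)]
      simp [map_sum, christoffelComponents, formComponents]
    · conv_lhs => rw [eq_sum_smul_single' (christoffel G y _ _)]
      simp [map_sum, christoffelComponents, formComponents]

lemma inverse_apply (hΩ : IsOpen Ω) (h : IsMetricOn G Ω) (hy : y ∈ Ω) (j : Fin (n + 1)) :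
    (G y).inverse (EuclideanSpace.proj (𝕜 := ℝ) j) =
      ∑ k, inverseComponents (formComponents G) k j y • EuclideanSpace.single k (1 : ℝ) := by
  refine h.ext_of_apply hy fun w => ?_
  rw [h.apply_inverse hy]
  simp only [map_sum, map_smul, sum_apply, smul_apply, smul_eq_mul]
  have h1 : ∀ k, G y (EuclideanSpace.single k 1) w =
      ∑ l, w l * formComponents G l k y := fun k => by
    conv_lhs => rw [eq_sum_smul_single' w]
    simp only [map_sum, map_smul, smul_eq_mul]
    exact Finset.sum_congr rfl fun l _ => by rw [h.symm y hy]; rfl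
  simp only [h1, Finset.mul_sum]
  rw [Finset.sum_comm]
  have h2 : ∀ l, ∑ k, inverseComponents (formComponents G) k j y * (w l * formComponents G l k y) =
      w l * (if l = j then 1 else 0) := fun l => by
    rw [← (h.isCoordMetric hΩ).mul_inverse hy l j, Finset.mul_sum]
    exact Finset.sum_congr rfl fun k _ => by ring
  simp [h2]

/-- The first argument of `ricci` in the definition is already a basis vector, so it suffices to
expand the second one, using linearity of the curvature in its last argument. -/
lemma coordScalarCurvature_eq (hΩ : IsOpen Ω) (h : IsMetricOn G Ω) (hy : y ∈ Ω) :
    coordScalarCurvature G y = ∑ j, ∑ k, inverseComponents (formComponents G) k j y *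
      ricciComponents (fun l i j => christoffelComponents G l i j y)
        (fun m l i j => pd m (christoffelComponents G l i j) y) j k := by
  have hchr : ∀ u v, DifferentiableAt ℝ (fun z => christoffel G z u v) y := fun u v =>
    ((h.contDiffOn_christoffel hΩ u v).contDiffAt (hΩ.mem_nhds hy)).differentiableAt (by simp)
  -- the Christoffel symbols are linear in their last argument
  have hlin : ∀ (u v : EuclideanSpace ℝ (Fin (n + 1))) z, christoffel G z u v =
      ∑ k, v k • christoffel G z u (EuclideanSpace.single k 1) := by
    intro u v z
    conv_lhs => rw [eq_sum_smul_single' v, ← christoffelBilin_apply, map_sum]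
    simp only [map_smul, christoffelBilin_apply]
  have hdlin : ∀ (u v a : EuclideanSpace ℝ (Fin (n + 1))),
      fderiv ℝ (fun z => christoffel G z u v) y a =
        ∑ k, v k • fderiv ℝ (fun z => christoffel G z u (EuclideanSpace.single k 1)) y a := by
    intro u v a
    have h1 : (fun z => christoffel G z u v) = fun z => ∑ k, v k •
        christoffel G z u (EuclideanSpace.single k 1) := funext fun z => hlin u v z
    have h2 : HasFDerivAt (fun z => ∑ k, v k • christoffel G z u (EuclideanSpace.single k 1)) _ y :=
      HasFDerivAt.fun_sum fun k _ => ((hchr u (EuclideanSpace.single k 1)).hasFDerivAt.const_smul (v k))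
    rw [h1, h2.fderiv]
    simp
  have hriem : ∀ u v w, riemann G y u v w = ∑ k, w k • riemann G y u v (EuclideanSpace.single k 1) := by
    intro u v w
    simp only [riemann, smul_add, smul_sub, Finset.sum_add_distrib, Finset.sum_sub_distrib]
    rw [hdlin, hdlin]
    congr 1
    · congr 1
      rw [hlin v w, ← christoffelBilin_apply, map_sum]
      simp only [map_smul, christoffelBilin_apply]
    · rw [hlin u w, ← christoffelBilin_apply, map_sum]
      simp only [map_smul, christoffelBilin_apply]
  have hric : ∀ v w, ricci G y v w = ∑ k, w k * ricci G y v (EuclideanSpace.single k 1) := by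
    intro v w
    simp only [ricci, Finset.mul_sum]
    rw [Finset.sum_comm]
    refine Finset.sum_congr rfl fun i _ => ?_
    rw [hriem]
    simp
  have hcomp : ∀ u v a (l : Fin (n + 1)), (fderiv ℝ (fun z => christoffel G z u v) y a) l =
      fderiv ℝ (fun z => christoffel G z u v l) y a := by
    intro u v a l
    have h1 : HasFDerivAt (fun z => christoffel G z u v l) _ y :=
      (EuclideanSpace.proj (𝕜 := ℝ) l).hasFDerivAt.comp y (hchr u v).hasFDerivAt
    rw [h1.fderiv]
    rfl
  have hricc : ∀ j k, ricci G y (EuclideanSpace.single j 1) (EuclideanSpace.single k 1) =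
      ricciComponents (fun l i j => christoffelComponents G l i j y)
        (fun m l i j => pd m (christoffelComponents G l i j) y) j k := by
    intro j k
    rw [ricci, ricciComponents]
    refine Finset.sum_congr rfl fun i _ => ?_
    have hq : ∀ a b : Fin (n + 1), (christoffel G y (EuclideanSpace.single a 1)
        (christoffel G y (EuclideanSpace.single b 1) (EuclideanSpace.single k 1))) i =
        ∑ l, christoffelComponents G i a l y * christoffelComponents G l b k y := by
      intro a b
      rw [hlin]
      simp [christoffelComponents, mul_comm]
    simp only [riemann, PiLp.add_apply, PiLp.sub_apply, hcomp, hq]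
    rfl
  rw [coordScalarCurvature]
  refine Finset.sum_congr rfl fun j _ => ?_
  rw [hric]
  refine Finset.sum_congr rfl fun k _ => ?_
  rw [hricc, h.inverse_apply hΩ hy]
  congr 1
  simp [Pi.single_apply]

end IsMetricOn

end ToComponents

set_option maxSynthPendingDepth 3

/-! ### Invariance of connection and curvature under coordinate changes -/

section Naturality

variable {m : ℕ} {G G' : EuclideanSpace ℝ (Fin m) →
    EuclideanSpace ℝ (Fin m) →L[ℝ] EuclideanSpace ℝ (Fin m) →L[ℝ] ℝ}
  {Ω Ω' : Set (EuclideanSpace ℝ (Fin m))} {y z : EuclideanSpace ℝ (Fin m)}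
  {φ : EuclideanSpace ℝ (Fin m) → EuclideanSpace ℝ (Fin m)}

/-- The Christoffel symbols as a field of continuous bilinear maps. -/
def christoffelCLM (G : EuclideanSpace ℝ (Fin m) →
    EuclideanSpace ℝ (Fin m) →L[ℝ] EuclideanSpace ℝ (Fin m) →L[ℝ] ℝ) (y : EuclideanSpace ℝ (Fin m)) :
    EuclideanSpace ℝ (Fin m) →L[ℝ] EuclideanSpace ℝ (Fin m) →L[ℝ] EuclideanSpace ℝ (Fin m) :=
  (christoffelBilin G y).toContinuousBilinearMap

@[simp]
lemma IsMetricOn.contDiffOn_christoffelCLM (hΩ : IsOpen Ω) (h : IsMetricOn G Ω) :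
    ContDiffOn ℝ ∞ (christoffelCLM G) Ω := by
  rw [contDiffOn_clm_apply]
  intro u
  rw [contDiffOn_clm_apply]
  intro v
  exact h.contDiffOn_christoffel hΩ u v

lemma IsMetricOn.hasFDerivAt_christoffelCLM (hΩ : IsOpen Ω) (h : IsMetricOn G Ω) (hy : y ∈ Ω) :
    HasFDerivAt (christoffelCLM G) (fderiv ℝ (christoffelCLM G) y) y :=
  (((h.contDiffOn_christoffelCLM hΩ).contDiffAt (hΩ.mem_nhds hy)).differentiableAt
    (by simp)).hasFDerivAt

/-- Differentiating a bilinear expression `B (f z) (a z) (b z)`. -/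
lemma fderiv_bilin_comp {F : Type*} [NormedAddCommGroup F] [NormedSpace ℝ F]
    {B : EuclideanSpace ℝ (Fin m) →
      EuclideanSpace ℝ (Fin m) →L[ℝ] EuclideanSpace ℝ (Fin m) →L[ℝ] F}
    {a b : EuclideanSpace ℝ (Fin m) → EuclideanSpace ℝ (Fin m)}
    (hB : DifferentiableAt ℝ B (φ z)) (hφ : DifferentiableAt ℝ φ z) (ha : DifferentiableAt ℝ a z)
    (hb : DifferentiableAt ℝ b z) (u : EuclideanSpace ℝ (Fin m)) :
    fderiv ℝ (fun z => B (φ z) (a z) (b z)) z u =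
      fderiv ℝ B (φ z) (fderiv ℝ φ z u) (a z) (b z) + B (φ z) (fderiv ℝ a z u) (b z) +
        B (φ z) (a z) (fderiv ℝ b z u) := by
  have h1 := ((hB.hasFDerivAt.comp z hφ.hasFDerivAt).clm_apply ha.hasFDerivAt).clm_apply
    hb.hasFDerivAt
  have h2 : HasFDerivAt (fun z => B (φ z) (a z) (b z)) _ z := h1
  rw [h2.fderiv]
  simp
  abel

lemma fderiv_bilin_apply {F : Type*} [NormedAddCommGroup F] [NormedSpace ℝ F]
    {B : EuclideanSpace ℝ (Fin m) →
      EuclideanSpace ℝ (Fin m) →L[ℝ] EuclideanSpace ℝ (Fin m) →L[ℝ] F}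
    (hB : DifferentiableAt ℝ B z) (u v w : EuclideanSpace ℝ (Fin m)) :
    fderiv ℝ (fun z => B z v w) z u = fderiv ℝ B z u v w := by
  have h := fderiv_bilin_comp (φ := id) (a := fun _ => v) (b := fun _ => w) hB differentiableAt_id
    (differentiableAt_const v) (differentiableAt_const w) u
  simpa using h

lemma snd_fderiv_symm {F : Type*} [NormedAddCommGroup F] [NormedSpace ℝ F]
    {f : EuclideanSpace ℝ (Fin m) → F} (hf : ContDiffAt ℝ ∞ f z) (u v : EuclideanSpace ℝ (Fin m)) :
    fderiv ℝ (fun z => fderiv ℝ f z v) z u = fderiv ℝ (fun z => fderiv ℝ f z u) z v := by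
  have hd : DifferentiableAt ℝ (fderiv ℝ f) z :=
    (hf.fderiv_right (m := ∞) (by simp)).differentiableAt (by simp)
  have h1 : ∀ a b, fderiv ℝ (fun z => fderiv ℝ f z a) z b = fderiv ℝ (fderiv ℝ f) z b a := by
    intro a b
    rw [fderiv_clm_apply hd (differentiableAt_const a)]
    simp
  rw [h1, h1]
  exact (hf.isSymmSndFDerivAt (by
    rw [minSmoothness_of_isRCLikeNormedField]
    exact (WithTop.coe_le_coe.2 le_top : ((2 : ℕ∞) : WithTop ℕ∞) ≤ ((⊤ : ℕ∞) : WithTop ℕ∞)))) u v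

/-- The derivative of the Jacobian of a coordinate change, i.e. its second derivative. -/
def hessian (φ : EuclideanSpace ℝ (Fin m) → EuclideanSpace ℝ (Fin m))
    (z u v : EuclideanSpace ℝ (Fin m)) : EuclideanSpace ℝ (Fin m) :=
  fderiv ℝ (fun z => fderiv ℝ φ z v) z u

/-- `φ` is a coordinate change on `Ω'` which pulls back the metric `G` on `Ω` to `G'`. -/
structure IsPullbackOn (φ : EuclideanSpace ℝ (Fin m) → EuclideanSpace ℝ (Fin m))
    (G G' : EuclideanSpace ℝ (Fin m) →
      EuclideanSpace ℝ (Fin m) →L[ℝ] EuclideanSpace ℝ (Fin m) →L[ℝ] ℝ)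
    (Ω Ω' : Set (EuclideanSpace ℝ (Fin m))) : Prop where
  isOpen : IsOpen Ω
  isOpen' : IsOpen Ω'
  metric : IsMetricOn G Ω
  metric' : IsMetricOn G' Ω'
  mapsTo : MapsTo φ Ω' Ω
  smooth : ContDiffOn ℝ ∞ φ Ω'
  isInvertible : ∀ z ∈ Ω', (fderiv ℝ φ z).IsInvertible
  apply_eq : ∀ z ∈ Ω', ∀ u v, G' z u v = G (φ z) (fderiv ℝ φ z u) (fderiv ℝ φ z v)

namespace IsPullbackOn

lemma contDiffAt (h : IsPullbackOn φ G G' Ω Ω') (hz : z ∈ Ω') : ContDiffAt ℝ ∞ φ z :=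
  h.smooth.contDiffAt (h.isOpen'.mem_nhds hz)

lemma contDiffAt_fderiv (h : IsPullbackOn φ G G' Ω Ω') (hz : z ∈ Ω')
    (v : EuclideanSpace ℝ (Fin m)) : ContDiffAt ℝ ∞ (fun z => fderiv ℝ φ z v) z :=
  ((h.contDiffAt hz).fderiv_right (m := ∞) (by simp)).clm_apply contDiffAt_const

lemma differentiableAt (h : IsPullbackOn φ G G' Ω Ω') (hz : z ∈ Ω') : DifferentiableAt ℝ φ z :=
  (h.contDiffAt hz).differentiableAt (by simp)

lemma differentiableAt_fderiv (h : IsPullbackOn φ G G' Ω Ω') (hz : z ∈ Ω')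
    (v : EuclideanSpace ℝ (Fin m)) : DifferentiableAt ℝ (fun z => fderiv ℝ φ z v) z :=
  (h.contDiffAt_fderiv hz v).differentiableAt (by simp)

lemma hessian_symm (h : IsPullbackOn φ G G' Ω Ω') (hz : z ∈ Ω') (u v : EuclideanSpace ℝ (Fin m)) :
    hessian φ z u v = hessian φ z v u := snd_fderiv_symm (h.contDiffAt hz) u v

lemma fderiv_metric (h : IsPullbackOn φ G G' Ω Ω') (hz : z ∈ Ω')
    (a u v : EuclideanSpace ℝ (Fin m)) : fderiv ℝ G' z a u v =
      fderiv ℝ G (φ z) (fderiv ℝ φ z a) (fderiv ℝ φ z u) (fderiv ℝ φ z v) +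
        G (φ z) (hessian φ z a u) (fderiv ℝ φ z v) + G (φ z) (fderiv ℝ φ z u) (hessian φ z a v) := by
  rw [← fderiv_bilin_apply (h.metric'.differentiableAt h.isOpen' hz)]
  have h1 : (fun z => G' z u v) =ᶠ[𝓝 z]
      fun z => G (φ z) (fderiv ℝ φ z u) (fderiv ℝ φ z v) :=
    Filter.eventuallyEq_of_mem (h.isOpen'.mem_nhds hz) fun w hw => h.apply_eq w hw u v
  rw [h1.fderiv_eq]
  exact fderiv_bilin_comp (h.metric.differentiableAt h.isOpen (h.mapsTo hz)) (h.differentiableAt hz)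
    (h.differentiableAt_fderiv hz u) (h.differentiableAt_fderiv hz v) a

/-- The transformation law of the Christoffel symbols. -/
lemma fderiv_christoffel (h : IsPullbackOn φ G G' Ω Ω') (hz : z ∈ Ω')
    (u v : EuclideanSpace ℝ (Fin m)) : fderiv ℝ φ z (christoffel G' z u v) =
      christoffel G (φ z) (fderiv ℝ φ z u) (fderiv ℝ φ z v) + hessian φ z u v := by
  refine h.metric.ext_of_apply (h.mapsTo hz) fun w => ?_
  -- Testing against vectors in the image of the derivative lets the Koszul formulas of both metrics
  -- be compared; by symmetry of the Hessian all but one of its terms cancel.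
  obtain ⟨w, rfl⟩ := (h.isInvertible z hz).surjective w
  rw [← h.apply_eq z hz, h.metric'.apply_christoffel hz, map_add, add_apply,
    h.metric.apply_christoffel (h.mapsTo hz), h.fderiv_metric hz, h.fderiv_metric hz,
    h.fderiv_metric hz, h.hessian_symm hz v u, h.hessian_symm hz w u, h.hessian_symm hz w v,
    h.metric.symm _ (h.mapsTo hz) (fderiv ℝ φ z v) (hessian φ z u w)]
  ring

/-- Differentiate the transformation law of the Christoffel symbols and antisymmetrise in u and v:
the third derivatives of φ drop out by symmetry, and the Hessian terms cancel against those produced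
by the quadratic part of the curvature. -/
lemma fderiv_riemann (h : IsPullbackOn φ G G' Ω Ω') (hz : z ∈ Ω')
    (u v w : EuclideanSpace ℝ (Fin m)) : fderiv ℝ φ z (riemann G' z u v w) =
      riemann G (φ z) (fderiv ℝ φ z u) (fderiv ℝ φ z v) (fderiv ℝ φ z w) := by
  have hφz := h.mapsTo hz
  have hG := (h.metric.hasFDerivAt_christoffelCLM h.isOpen hφz).differentiableAt
  have hG' := (h.metric'.hasFDerivAt_christoffelCLM h.isOpen' hz).differentiableAt
  have hA : DifferentiableAt ℝ (fderiv ℝ φ) z :=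
    ((h.contDiffAt hz).fderiv_right (m := ∞) (by simp)).differentiableAt (by simp)
  have hhess : ∀ a b, ContDiffAt ℝ ∞ (fun z => hessian φ z a b) z := fun a b =>
    ((h.contDiffAt_fderiv hz b).fderiv_right (m := ∞) (by simp)).clm_apply contDiffAt_const
  have hchr : ∀ a b, DifferentiableAt ℝ (fun z => christoffel G' z a b) z := fun a b =>
    ((h.metric'.contDiffOn_christoffel h.isOpen' a b).contDiffAt
      (h.isOpen'.mem_nhds hz)).differentiableAt (by simp)
  -- differentiate the transformation law of the Christoffel symbols
  have key : ∀ a b c, hessian φ z a (christoffel G' z b c) +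
      fderiv ℝ φ z (fderiv ℝ (fun z => christoffel G' z b c) z a) =
      fderiv ℝ (fun y => christoffel G y (fderiv ℝ φ z b) (fderiv ℝ φ z c)) (φ z) (fderiv ℝ φ z a) +
        christoffel G (φ z) (hessian φ z a b) (fderiv ℝ φ z c) +
        christoffel G (φ z) (fderiv ℝ φ z b) (hessian φ z a c) +
        fderiv ℝ (fun z => hessian φ z b c) z a := by
    intro a b c
    have h1 : (fun z => fderiv ℝ φ z (christoffel G' z b c)) =ᶠ[𝓝 z]
        fun z => christoffelCLM G (φ z) (fderiv ℝ φ z b) (fderiv ℝ φ z c) + hessian φ z b c :=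
      Filter.eventuallyEq_of_mem (h.isOpen'.mem_nhds hz) fun w hw => h.fderiv_christoffel hw b c
    have h2 := DFunLike.congr_fun (h1.fderiv_eq (𝕜 := ℝ)) a
    have h3 : DifferentiableAt ℝ
        (fun z => christoffelCLM G (φ z) (fderiv ℝ φ z b) (fderiv ℝ φ z c)) z :=
      ((hG.comp z (h.differentiableAt hz)).clm_apply (h.differentiableAt_fderiv hz b)).clm_apply
        (h.differentiableAt_fderiv hz c)
    have h4 : fderiv ℝ (fun z => fderiv ℝ φ z (christoffel G' z b c)) z a =
        hessian φ z a (christoffel G' z b c) +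
          fderiv ℝ φ z (fderiv ℝ (fun z => christoffel G' z b c) z a) := by
      rw [fderiv_clm_apply hA (hchr b c)]
      have h5 : hessian φ z a (christoffel G' z b c) =
          fderiv ℝ (fderiv ℝ φ) z a (christoffel G' z b c) := by
        rw [hessian, fderiv_clm_apply hA (differentiableAt_const _)]
        simp
      rw [h5]
      simp [add_comm]
    rw [← h4]
    refine h2.trans ?_
    rw [fderiv_fun_add h3 ((hhess b c).differentiableAt (by simp)), add_apply,
      fderiv_bilin_comp hG (h.differentiableAt hz) (h.differentiableAt_fderiv hz b)
        (h.differentiableAt_fderiv hz c) a, ← fderiv_bilin_apply hG]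
    rfl
  have key' : ∀ a b c, fderiv ℝ φ z (fderiv ℝ (fun z => christoffel G' z b c) z a) = _ :=
    fun a b c => eq_sub_of_add_eq' (key a b c)
  have hthird : fderiv ℝ (fun z => hessian φ z v w) z u = fderiv ℝ (fun z => hessian φ z u w) z v :=
    snd_fderiv_symm (h.contDiffAt_fderiv hz w) u v
  have hadd : ∀ a b c, christoffel G (φ z) a (b + c) =
      christoffel G (φ z) a b + christoffel G (φ z) a c := fun a b c =>
    (christoffelCLM G (φ z) a).map_add b c
  rw [riemann, map_sub, map_add, map_sub, key', key', h.fderiv_christoffel hz u (christoffel G' z v w),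
    h.fderiv_christoffel hz v (christoffel G' z u w), h.fderiv_christoffel hz v w,
    h.fderiv_christoffel hz u w, hadd, hadd,
    hthird, h.hessian_symm hz v u, riemann]
  abel

end IsPullbackOn

/-- The endomorphism `u ↦ R(u, v) w`, whose trace is the Ricci curvature. -/
def riemannEnd (G : EuclideanSpace ℝ (Fin m) →
    EuclideanSpace ℝ (Fin m) →L[ℝ] EuclideanSpace ℝ (Fin m) →L[ℝ] ℝ)
    (y v w : EuclideanSpace ℝ (Fin m)) : EuclideanSpace ℝ (Fin m) →L[ℝ] EuclideanSpace ℝ (Fin m) :=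
  ((fderiv ℝ (christoffelCLM G) y).flip v).flip w - (fderiv ℝ (christoffelCLM G) y v).flip w +
    (christoffelCLM G y).flip (christoffel G y v w) -
    (christoffelCLM G y v).comp ((christoffelCLM G y).flip w)

namespace IsMetricOn

lemma riemann_eq (hΩ : IsOpen Ω) (h : IsMetricOn G Ω) (hy : y ∈ Ω)
    (u v w : EuclideanSpace ℝ (Fin m)) : riemann G y u v w =
      fderiv ℝ (christoffelCLM G) y u v w - fderiv ℝ (christoffelCLM G) y v u w +
        christoffelCLM G y u (christoffelCLM G y v w) -
        christoffelCLM G y v (christoffelCLM G y u w) := by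
  have hG := (h.hasFDerivAt_christoffelCLM hΩ hy).differentiableAt
  rw [← fderiv_bilin_apply hG, ← fderiv_bilin_apply hG]
  rfl

lemma riemannEnd_apply (hΩ : IsOpen Ω) (h : IsMetricOn G Ω) (hy : y ∈ Ω)
    (u v w : EuclideanSpace ℝ (Fin m)) : riemannEnd G y v w u = riemann G y u v w := by
  rw [h.riemann_eq hΩ hy]
  rfl

/-- A basis-free form of the definition, so that invariance of the trace under conjugation becomes
applicable. -/
lemma ricci_eq_trace (hΩ : IsOpen Ω) (h : IsMetricOn G Ω) (hy : y ∈ Ω)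
    (v w : EuclideanSpace ℝ (Fin m)) :
    ricci G y v w = LinearMap.trace ℝ _ (riemannEnd G y v w : EuclideanSpace ℝ (Fin m) →ₗ[ℝ] _) := by
  rw [LinearMap.trace_eq_sum_inner _ (EuclideanSpace.basisFun (Fin m) ℝ), ricci]
  refine Finset.sum_congr rfl fun i _ => ?_
  rw [ContinuousLinearMap.coe_coe, h.riemannEnd_apply hΩ hy]
  simp [EuclideanSpace.inner_single_left]

lemma ricci_sum_smul_left (hΩ : IsOpen Ω) (h : IsMetricOn G Ω) (hy : y ∈ Ω) {ι : Type*}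
    (s : Finset ι) (a : ι → ℝ) (v : ι → EuclideanSpace ℝ (Fin m)) (w : EuclideanSpace ℝ (Fin m)) :
    ricci G y (∑ i ∈ s, a i • v i) w = ∑ i ∈ s, a i * ricci G y (v i) w := by
  simp only [ricci, Finset.mul_sum]
  rw [Finset.sum_comm]
  refine Finset.sum_congr rfl fun k _ => ?_
  have h1 : ∀ u v, riemann G y u v w = ((fderiv ℝ (christoffelCLM G) y u).flip w -
      ((fderiv ℝ (christoffelCLM G) y).flip u).flip w + (christoffelCLM G y u).comp
        ((christoffelCLM G y).flip w) - (christoffelCLM G y).flip (christoffelCLM G y u w)) v :=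
    fun u v => h.riemann_eq hΩ hy u v w
  rw [h1, map_sum]
  simp only [map_smul]
  simp only [← h1]
  simp

lemma ricci_sum_smul_right (hΩ : IsOpen Ω) (h : IsMetricOn G Ω) (hy : y ∈ Ω) {ι : Type*}
    (s : Finset ι) (a : ι → ℝ) (v : EuclideanSpace ℝ (Fin m)) (w : ι → EuclideanSpace ℝ (Fin m)) :
    ricci G y v (∑ i ∈ s, a i • w i) = ∑ i ∈ s, a i * ricci G y v (w i) := by
  simp only [ricci, Finset.mul_sum]
  rw [Finset.sum_comm]
  refine Finset.sum_congr rfl fun k _ => ?_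
  have h1 : ∀ u w, riemann G y u v w = (fderiv ℝ (christoffelCLM G) y u v -
      fderiv ℝ (christoffelCLM G) y v u + (christoffelCLM G y u).comp (christoffelCLM G y v) -
        (christoffelCLM G y v).comp (christoffelCLM G y u)) w :=
    fun u w => h.riemann_eq hΩ hy u v w
  rw [h1, map_sum]
  simp only [map_smul]
  simp only [← h1]
  simp

end IsMetricOn

namespace IsPullbackOn

/-- By `fderiv_riemann` the derivative of φ conjugates one curvature endomorphism into the other. -/
lemma ricci_eq (h : IsPullbackOn φ G G' Ω Ω') (hz : z ∈ Ω') (v w : EuclideanSpace ℝ (Fin m)) :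
    ricci G' z v w = ricci G (φ z) (fderiv ℝ φ z v) (fderiv ℝ φ z w) := by
  rw [h.metric'.ricci_eq_trace h.isOpen' hz, h.metric.ricci_eq_trace h.isOpen (h.mapsTo hz)]
  obtain ⟨e, he⟩ := h.isInvertible z hz
  rw [← LinearMap.trace_conj' (riemannEnd G' z v w : EuclideanSpace ℝ (Fin m) →ₗ[ℝ] _)
    e.toLinearEquiv]
  congr 1
  ext1 u
  obtain ⟨u, rfl⟩ := e.surjective u
  have he' : ∀ u, e u = fderiv ℝ φ z u := fun u => DFunLike.congr_fun he u
  rw [LinearEquiv.conj_apply_apply]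
  have h1 : e.toLinearEquiv.symm (e u) = u := e.symm_apply_apply u
  rw [h1]
  refine (he' _).trans ?_
  rw [ContinuousLinearMap.coe_coe, ContinuousLinearMap.coe_coe,
    h.metric'.riemannEnd_apply h.isOpen' hz, h.fderiv_riemann hz,
    h.metric.riemannEnd_apply h.isOpen (h.mapsTo hz), he']

/-- The scalar curvature is invariant under coordinate changes. -/
lemma coordScalarCurvature_eq (h : IsPullbackOn φ G G' Ω Ω') (hz : z ∈ Ω') :
    coordScalarCurvature G' z = coordScalarCurvature G (φ z) := by
  have hφz := h.mapsTo hz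
  -- Transformation law of the inverse metric as a contravariant tensor; it matches the expansion of
  -- the images of the basis vectors in `h2`.
  have h1 : ∀ k : Fin m, (G (φ z)).inverse (EuclideanSpace.proj (𝕜 := ℝ) k) =
      ∑ j : Fin m, fderiv ℝ φ z (EuclideanSpace.single j 1) k •
        fderiv ℝ φ z ((G' z).inverse (EuclideanSpace.proj (𝕜 := ℝ) j)) := by
    intro k
    refine h.metric.ext_of_apply hφz fun b => ?_
    obtain ⟨b, rfl⟩ := (h.isInvertible z hz).surjective b
    rw [h.metric.apply_inverse hφz]
    simp only [map_sum, map_smul, sum_apply, smul_apply, ← h.apply_eq z hz,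
      h.metric'.apply_inverse hz]
    conv_lhs => rw [eq_sum_smul_single' b]
    simp [mul_comm]
  rw [coordScalarCurvature, coordScalarCurvature]
  have h2 : ∀ j : Fin m, ricci G' z (EuclideanSpace.single j 1)
      ((G' z).inverse (EuclideanSpace.proj (𝕜 := ℝ) j)) =
      ∑ k, fderiv ℝ φ z (EuclideanSpace.single j 1) k * ricci G (φ z) (EuclideanSpace.single k 1)
        (fderiv ℝ φ z ((G' z).inverse (EuclideanSpace.proj (𝕜 := ℝ) j))) := by
    intro j
    rw [h.ricci_eq hz]
    conv_lhs => rw [eq_sum_smul_single' (fderiv ℝ φ z (EuclideanSpace.single j 1))]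
    rw [h.metric.ricci_sum_smul_left h.isOpen hφz]
  rw [Finset.sum_congr rfl fun j _ => h2 j, Finset.sum_comm]
  refine Finset.sum_congr rfl fun k _ => ?_
  rw [h1, h.metric.ricci_sum_smul_right h.isOpen hφz]

end IsPullbackOn


end Naturality

/-! ### Bilinear forms on the manifold read in charts -/

section Charts

variable {n : ℕ} {M : Type*} [TopologicalSpace M] [ChartedSpace (EuclideanHalfSpace (n + 1)) M]
  {e e' : OpenPartialHomeomorph M (EuclideanHalfSpace (n + 1))}
  {x : M} {w : EuclideanSpace ℝ (Fin (n + 1))}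

lemma mem_range_iff {y : EuclideanSpace ℝ (Fin (n + 1))} :
    y ∈ range (𝓡∂ (n + 1)) ↔ 0 ≤ y 0 := by
  rw [range_modelWithCornersEuclideanHalfSpace]; rfl

lemma mem_interior_range_iff {y : EuclideanSpace ℝ (Fin (n + 1))} :
    y ∈ interior (range (𝓡∂ (n + 1))) ↔ 0 < y 0 := by
  rw [interior_range_modelWithCornersEuclideanHalfSpace]; rfl

lemma mdifferentiableWithinAt_extend_symm
    (he : e ∈ IsManifold.maximalAtlas (𝓡∂ (n + 1)) ∞ M) (hw : w ∈ (e.extend (𝓡∂ (n + 1))).target) :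
    MDifferentiableWithinAt 𝓘(ℝ, EuclideanSpace ℝ (Fin (n + 1))) (𝓡∂ (n + 1))
      (e.extend (𝓡∂ (n + 1))).symm (range (𝓡∂ (n + 1))) w := by
  have h1 : w ∈ (𝓡∂ (n + 1)) '' e.target := by rwa [← e.extend_target']
  have h2 := ((contMDiffOn_extend_symm he) w h1).mdifferentiableWithinAt (by simp)
  refine h2.mono_of_mem_nhdsWithin ?_
  have h3 : (e.extend (𝓡∂ (n + 1))).symm w ∈ e.source := by
    rw [← e.extend_source (I := 𝓡∂ (n + 1))]
    exact (e.extend _).map_target hw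
  have h4 := e.extend_image_target_mem_nhds (I := 𝓡∂ (n + 1)) h3
  rwa [(e.extend _).right_inv hw] at h4

lemma uniqueMDiffWithinAt_range (hw : w ∈ range (𝓡∂ (n + 1))) :
    UniqueMDiffWithinAt 𝓘(ℝ, EuclideanSpace ℝ (Fin (n + 1))) (range (𝓡∂ (n + 1))) w :=
  (𝓡∂ (n + 1)).uniqueMDiffOn w hw

/-- The derivative of the inverse of a chart. -/
def symmDeriv (e : OpenPartialHomeomorph M (EuclideanHalfSpace (n + 1)))
    (w : EuclideanSpace ℝ (Fin (n + 1))) :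
    EuclideanSpace ℝ (Fin (n + 1)) →L[ℝ] EuclideanSpace ℝ (Fin (n + 1)) :=
  mfderivWithin 𝓘(ℝ, EuclideanSpace ℝ (Fin (n + 1))) (𝓡∂ (n + 1))
    (e.extend (𝓡∂ (n + 1))).symm (range (𝓡∂ (n + 1))) w

/-- The coordinate change between two charts. -/
abbrev transition (e e' : OpenPartialHomeomorph M (EuclideanHalfSpace (n + 1))) :
    PartialEquiv (EuclideanSpace ℝ (Fin (n + 1))) (EuclideanSpace ℝ (Fin (n + 1))) :=
  (𝓡∂ (n + 1)).extendCoordChange e e'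

/-- The derivative of a coordinate change. -/
abbrev transitionDeriv (e e' : OpenPartialHomeomorph M (EuclideanHalfSpace (n + 1)))
    (w : EuclideanSpace ℝ (Fin (n + 1))) :
    EuclideanSpace ℝ (Fin (n + 1)) →L[ℝ] EuclideanSpace ℝ (Fin (n + 1)) :=
  fderivWithin ℝ (transition e e') (range (𝓡∂ (n + 1))) w

lemma mem_transition_source : w ∈ (transition e e').source ↔
    w ∈ (e.extend (𝓡∂ (n + 1))).target ∧ (e.extend (𝓡∂ (n + 1))).symm w ∈ e'.source := by
  simp [transition, ModelWithCorners.extendCoordChange, PartialEquiv.trans_source]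

lemma differentiableWithinAt_transition
    (he : e ∈ IsManifold.maximalAtlas (𝓡∂ (n + 1)) ∞ M)
    (he' : e' ∈ IsManifold.maximalAtlas (𝓡∂ (n + 1)) ∞ M) (hw : w ∈ (transition e e').source) :
    DifferentiableWithinAt ℝ (transition e e') (range (𝓡∂ (n + 1))) w :=
  ((𝓡∂ (n + 1)).contDiffWithinAt_extendCoordChange he he' hw).differentiableWithinAt (by simp)

/-- Chain rule: near w the inverse of e is the inverse of e' after the coordinate change. -/
lemma symmDeriv_eq_comp (he : e ∈ IsManifold.maximalAtlas (𝓡∂ (n + 1)) ∞ M)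
    (he' : e' ∈ IsManifold.maximalAtlas (𝓡∂ (n + 1)) ∞ M) (hw : w ∈ (transition e e').source) :
    symmDeriv e w = (symmDeriv e' (transition e e' w)).comp (transitionDeriv e e' w) := by
  have hwt := (mem_transition_source.1 hw).1
  have hwr : w ∈ range (𝓡∂ (n + 1)) := e.extend_target_subset_range hwt
  have hψ : transition e e' w ∈ (e'.extend (𝓡∂ (n + 1))).target :=
    ((transition e e').map_source hw).1
  have h1 : (e.extend (𝓡∂ (n + 1))).symm =ᶠ[𝓝[range (𝓡∂ (n + 1))] w]
      (e'.extend (𝓡∂ (n + 1))).symm ∘ transition e e' := by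
    filter_upwards [(𝓡∂ (n + 1)).extendCoordChange_source_mem_nhdsWithin hw] with z hz
    have hz' := (mem_transition_source.1 hz).2
    exact (e'.extend_left_inv hz').symm
  have hmaps : MapsTo (transition e e') (transition e e').source (range (𝓡∂ (n + 1))) :=
    fun z hz => e'.extend_target_subset_range ((transition e e').map_source hz).1
  have hsub : (transition e e').source ⊆ range (𝓡∂ (n + 1)) := fun z hz =>
    e.extend_target_subset_range (mem_transition_source.1 hz).1
  have h2 : HasMFDerivWithinAt 𝓘(ℝ, EuclideanSpace ℝ (Fin (n + 1))) (𝓡∂ (n + 1))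
      ((e'.extend (𝓡∂ (n + 1))).symm ∘ transition e e') (transition e e').source w
      ((symmDeriv e' (transition e e' w)).comp (transitionDeriv e e' w)) :=
    (mdifferentiableWithinAt_extend_symm he' hψ).hasMFDerivWithinAt.comp w
      ((differentiableWithinAt_transition he he' hw).hasFDerivWithinAt.mono hsub).hasMFDerivWithinAt
      hmaps
  have h3 := (h2.mono_of_mem_nhdsWithin
    ((𝓡∂ (n + 1)).extendCoordChange_source_mem_nhdsWithin hw)).congr_of_eventuallyEq h1
      (h1.self_of_nhdsWithin hwr)
  exact h3.mfderivWithin (uniqueMDiffWithinAt_range hwr)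

/-- A field of bilinear forms, written in a chart. -/
def formInChart (h : ∀ x : M, TangentSpace (𝓡∂ (n + 1)) x →L[ℝ] TangentSpace (𝓡∂ (n + 1)) x →L[ℝ] ℝ)
    (e : OpenPartialHomeomorph M (EuclideanHalfSpace (n + 1)))
    (w : EuclideanSpace ℝ (Fin (n + 1))) :
    EuclideanSpace ℝ (Fin (n + 1)) →L[ℝ] EuclideanSpace ℝ (Fin (n + 1)) →L[ℝ] ℝ :=
  let b : EuclideanSpace ℝ (Fin (n + 1)) →L[ℝ] EuclideanSpace ℝ (Fin (n + 1)) →L[ℝ] ℝ :=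
    h ((e.extend (𝓡∂ (n + 1))).symm w)
  b.bilinearComp (symmDeriv e w) (symmDeriv e w)

lemma formInChart_apply
    (h : ∀ x : M, TangentSpace (𝓡∂ (n + 1)) x →L[ℝ] TangentSpace (𝓡∂ (n + 1)) x →L[ℝ] ℝ)
    (e : OpenPartialHomeomorph M (EuclideanHalfSpace (n + 1)))
    (w u v : EuclideanSpace ℝ (Fin (n + 1))) : formInChart h e w u v =
      h ((e.extend (𝓡∂ (n + 1))).symm w) (symmDeriv e w u) (symmDeriv e w v) := rfl

lemma chartMetric_eq [IsManifold (𝓡∂ (n + 1)) ∞ M] (g : InteriorMetric n M) :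
    chartMetric g e = formInChart g.val e := rfl

lemma formInChart_transition
    (h : ∀ x : M, TangentSpace (𝓡∂ (n + 1)) x →L[ℝ] TangentSpace (𝓡∂ (n + 1)) x →L[ℝ] ℝ)
    (he : e ∈ IsManifold.maximalAtlas (𝓡∂ (n + 1)) ∞ M)
    (he' : e' ∈ IsManifold.maximalAtlas (𝓡∂ (n + 1)) ∞ M) (hw : w ∈ (transition e e').source)
    (u v : EuclideanSpace ℝ (Fin (n + 1))) : formInChart h e w u v =
      formInChart h e' (transition e e' w) (transitionDeriv e e' w u)
        (transitionDeriv e e' w v) := by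
  rw [formInChart_apply, formInChart_apply, symmDeriv_eq_comp he he' hw]
  have h1 : (e'.extend (𝓡∂ (n + 1))).symm (transition e e' w) = (e.extend (𝓡∂ (n + 1))).symm w :=
    e'.extend_left_inv (mem_transition_source.1 hw).2
  rw [h1]
  rfl

/-- The trivialization of the tangent bundle at x is inverted by the derivative of the inverse chart
at x, so a form read in this trivialization is its expression in that chart. -/
lemma contMDiffWithinAt_form_iff [IsManifold (𝓡∂ (n + 1)) ∞ M]
    (h : ∀ x : M, TangentSpace (𝓡∂ (n + 1)) x →L[ℝ] TangentSpace (𝓡∂ (n + 1)) x →L[ℝ] ℝ)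
    (s : Set M) (x : M) :
    ContMDiffWithinAt (𝓡∂ (n + 1)) ((𝓡∂ (n + 1)).prod
      𝓘(ℝ, EuclideanSpace ℝ (Fin (n + 1)) →L[ℝ] EuclideanSpace ℝ (Fin (n + 1)) →L[ℝ] ℝ)) ∞
    (fun x => TotalSpace.mk'
      (EuclideanSpace ℝ (Fin (n + 1)) →L[ℝ] EuclideanSpace ℝ (Fin (n + 1)) →L[ℝ] ℝ)
      (E := fun x : M =>
        TangentSpace (𝓡∂ (n + 1)) x →L[ℝ] TangentSpace (𝓡∂ (n + 1)) x →L[ℝ] ℝ) x (h x)) s x ↔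
    ContMDiffWithinAt (𝓡∂ (n + 1))
      𝓘(ℝ, EuclideanSpace ℝ (Fin (n + 1)) →L[ℝ] EuclideanSpace ℝ (Fin (n + 1)) →L[ℝ] ℝ) ∞
      (fun z => formInChart h (chartAt (EuclideanHalfSpace (n + 1)) x) (extChartAt (𝓡∂ (n + 1)) x z))
      s x := by
  rw [contMDiffWithinAt_hom_bundle]
  have h1 : ContMDiffWithinAt (𝓡∂ (n + 1)) (𝓡∂ (n + 1)) ∞ (fun z : M => z) s x :=
    contMDiffWithinAt_id
  have key : ∀ z ∈ (chartAt (EuclideanHalfSpace (n + 1)) x).source,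
      ContinuousLinearMap.inCoordinates (EuclideanSpace ℝ (Fin (n + 1)))
        (fun x : M => TangentSpace (𝓡∂ (n + 1)) x) (EuclideanSpace ℝ (Fin (n + 1)) →L[ℝ] ℝ)
        (fun x : M => TangentSpace (𝓡∂ (n + 1)) x →L[ℝ] ℝ) x z x z (h z) =
      formInChart h (chartAt (EuclideanHalfSpace (n + 1)) x) (extChartAt (𝓡∂ (n + 1)) x z) := by
    intro z hz
    ext u v
    rw [inCoordinates_apply_eq₂ (F₁ := EuclideanSpace ℝ (Fin (n + 1)))
      (E₁ := fun x : M => TangentSpace (𝓡∂ (n + 1)) x) (F₂ := EuclideanSpace ℝ (Fin (n + 1)))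
      (E₂ := fun x : M => TangentSpace (𝓡∂ (n + 1)) x) (F₃ := ℝ) (E₃ := fun _ : M => ℝ)
      (by simpa using hz) (by simpa using hz) (by simp)]
    -- All tangent spaces unfold to the same model space, which permits replacing the base point
    -- along an equality.
    have h2 : ∀ (z' : M), z' = z → ∀ a b : EuclideanSpace ℝ (Fin (n + 1)),
        (h z' : EuclideanSpace ℝ (Fin (n + 1)) →L[ℝ] EuclideanSpace ℝ (Fin (n + 1)) →L[ℝ] ℝ) a b =
        (h z : EuclideanSpace ℝ (Fin (n + 1)) →L[ℝ] EuclideanSpace ℝ (Fin (n + 1)) →L[ℝ] ℝ) a b := by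
      rintro z' rfl a b
      rfl
    have h3 : ∀ a : EuclideanSpace ℝ (Fin (n + 1)),
        (trivializationAt (EuclideanSpace ℝ (Fin (n + 1)))
          (fun x : M => TangentSpace (𝓡∂ (n + 1)) x) x).symm z a =
        symmDeriv (chartAt (EuclideanHalfSpace (n + 1)) x) (extChartAt (𝓡∂ (n + 1)) x z) a := by
      intro a
      have h4 := TangentBundle.symmL_trivializationAt (I := 𝓡∂ (n + 1)) hz
      have h5 : Trivialization.symmL ℝ (trivializationAt (EuclideanSpace ℝ (Fin (n + 1)))
        (TangentSpace (𝓡∂ (n + 1))) x) z a =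
        (trivializationAt (EuclideanSpace ℝ (Fin (n + 1)))
          (fun x : M => TangentSpace (𝓡∂ (n + 1)) x) x).symm z a :=
        Trivialization.symmL_apply _ (by simpa using hz) a
      rw [← h5, h4]
      rfl
    rw [h3, h3]
    refine Eq.trans ?_ (h2 _ ((chartAt (EuclideanHalfSpace (n + 1)) x).extend_left_inv hz) _ _).symm
    simp
  have hev : ∀ᶠ z in 𝓝[s] x, z ∈ (chartAt (EuclideanHalfSpace (n + 1)) x).source :=
    mem_nhdsWithin_of_mem_nhds
      ((chartAt _ x).open_source.mem_nhds (mem_chart_source (EuclideanHalfSpace (n + 1)) x))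
  have hx := mem_chart_source (EuclideanHalfSpace (n + 1)) x
  constructor
  · intro hs
    refine ContMDiffWithinAt.congr_of_eventuallyEq hs.2 ?_ (key x hx).symm
    filter_upwards [hev] with z hz using (key z hz).symm
  · intro hs
    refine ⟨h1, ContMDiffWithinAt.congr_of_eventuallyEq hs ?_ (key x hx)⟩
    filter_upwards [hev] with z hz using key z hz

end Charts

/-! ### Coordinate changes preserve interior and boundary -/

section Transition

variable {n : ℕ} {M : Type*} [TopologicalSpace M] [ChartedSpace (EuclideanHalfSpace (n + 1)) M]
  {e e' : OpenPartialHomeomorph M (EuclideanHalfSpace (n + 1))}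
  {x : M} {w : EuclideanSpace ℝ (Fin (n + 1))}

lemma isInvertible_transitionDeriv (he : e ∈ IsManifold.maximalAtlas (𝓡∂ (n + 1)) ∞ M)
    (he' : e' ∈ IsManifold.maximalAtlas (𝓡∂ (n + 1)) ∞ M) (hw : w ∈ (transition e e').source) :
    (transitionDeriv e e' w).IsInvertible := by
  have h1 := (𝓡∂ (n + 1)).isInvertible_fderivWithin_extendCoordChange (by simp) he he' hw
  have hwr : w ∈ range (𝓡∂ (n + 1)) :=
    e.extend_target_subset_range (mem_transition_source.1 hw).1
  have h2 : transitionDeriv e e' w =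
      fderivWithin ℝ (transition e e') (transition e e').source w :=
    fderivWithin_of_mem_nhdsWithin ((𝓡∂ (n + 1)).extendCoordChange_source_mem_nhdsWithin hw)
      ((𝓡∂ (n + 1)).uniqueDiffOn w hwr)
      (((𝓡∂ (n + 1)).contDiffOn_extendCoordChange he he' w hw).differentiableWithinAt (by simp))
  rwa [h2]

lemma contDiffWithinAt_transitionDeriv (he : e ∈ IsManifold.maximalAtlas (𝓡∂ (n + 1)) ∞ M)
    (he' : e' ∈ IsManifold.maximalAtlas (𝓡∂ (n + 1)) ∞ M) (hw : w ∈ (transition e e').source) :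
    ContDiffWithinAt ℝ ∞ (transitionDeriv e e') (range (𝓡∂ (n + 1))) w :=
  ((𝓡∂ (n + 1)).contDiffWithinAt_extendCoordChange he he' hw).fderivWithin_right
    (𝓡∂ (n + 1)).uniqueDiffOn (by simp) (e.extend_target_subset_range (mem_transition_source.1 hw).1)

lemma range_mem_nhds (hw : 0 < w 0) : range (𝓡∂ (n + 1)) ∈ 𝓝 w :=
  mem_interior_iff_mem_nhds.1 (mem_interior_range_iff.2 hw)

lemma transitionDeriv_eq_fderiv (hw : 0 < w 0) :
    transitionDeriv e e' w = fderiv ℝ (transition e e') w :=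
  fderivWithin_of_mem_nhds (range_mem_nhds hw)

/-- At an interior point the derivative of the coordinate change is surjective, whereas a map into
the closed half space cannot reach the boundary hyperplane at such a point. -/
lemma transition_pos (he : e ∈ IsManifold.maximalAtlas (𝓡∂ (n + 1)) ∞ M)
    (he' : e' ∈ IsManifold.maximalAtlas (𝓡∂ (n + 1)) ∞ M) (hw : w ∈ (transition e e').source)
    (hw0 : 0 < w 0) : 0 < transition e e' w 0 := by
  have h1 : (transition e e').source ∈ 𝓝 w := by
    have := (𝓡∂ (n + 1)).extendCoordChange_source_mem_nhdsWithin hw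
    rwa [nhdsWithin_eq_nhds.2 (range_mem_nhds hw0)] at this
  have h2 := isInvertible_transitionDeriv he he' hw
  rw [transitionDeriv_eq_fderiv hw0] at h2
  rw [← mem_interior_range_iff]
  exact ((differentiableWithinAt_transition he he' hw).differentiableAt
    (range_mem_nhds hw0)).mem_interior_convex_of_surjective_fderiv h1 (𝓡∂ (n + 1)).convex_range
    (𝓡∂ (n + 1)).isClosed_range (𝓡∂ (n + 1)).nonempty_interior
    (fun z hz => e'.extend_target_subset_range ((transition e e').map_source hz).1) h2.surjective

lemma extend_mem_transition_source (hx : x ∈ e.source) (hx' : x ∈ e'.source) :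
    e.extend (𝓡∂ (n + 1)) x ∈ (transition e e').source := by
  rw [mem_transition_source]
  refine ⟨(e.extend _).map_source (by rwa [e.extend_source]), ?_⟩
  rwa [e.extend_left_inv hx]

lemma transition_extend (hx : x ∈ e.source) :
    transition e e' (e.extend (𝓡∂ (n + 1)) x) = e'.extend (𝓡∂ (n + 1)) x :=
  congrArg (e'.extend (𝓡∂ (n + 1))) (e.extend_left_inv hx)

/-- The image in a chart of the interior of the manifold. -/
def chartInterior (e : OpenPartialHomeomorph M (EuclideanHalfSpace (n + 1))) :
    Set (EuclideanSpace ℝ (Fin (n + 1))) :=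
  (e.extend (𝓡∂ (n + 1))).target ∩ {y | 0 < y 0}

lemma isOpen_chartInterior : IsOpen (chartInterior e) := by
  have h1 : chartInterior e = (𝓡∂ (n + 1)).symm ⁻¹' e.target ∩ {y | 0 < y 0} := by
    rw [chartInterior, e.extend_target, inter_assoc]
    congr 1
    ext y
    refine ⟨fun h => h.2, fun h => ⟨mem_range_iff.2 (le_of_lt h), h⟩⟩
  rw [h1]
  exact (e.open_target.preimage (𝓡∂ (n + 1)).continuous_symm).inter
    (isOpen_lt continuous_const (by fun_prop))


lemma symm_mem_source (hw : w ∈ (e.extend (𝓡∂ (n + 1))).target) :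
    (e.extend (𝓡∂ (n + 1))).symm w ∈ e.source := by
  rw [← e.extend_source (I := 𝓡∂ (n + 1))]
  exact (e.extend _).map_target hw

lemma mem_transition_chartAt_source (hw : w ∈ (e.extend (𝓡∂ (n + 1))).target) : w ∈ (transition e
    (chartAt (EuclideanHalfSpace (n + 1)) ((e.extend (𝓡∂ (n + 1))).symm w))).source :=
  mem_transition_source.2 ⟨hw, mem_chart_source _ _⟩

variable [IsManifold (𝓡∂ (n + 1)) ∞ M]

lemma chartAt_mem_maximalAtlas (x : M) : chartAt (EuclideanHalfSpace (n + 1)) x ∈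
    IsManifold.maximalAtlas (𝓡∂ (n + 1)) ∞ M := IsManifold.chart_mem_maximalAtlas (I := 𝓡∂ (n + 1)) (n := ∞) x

/-- The interior is defined through the chart `chartAt` at x; `transition_pos` in both directions
makes every chart of the maximal atlas equally good. -/
lemma mem_interior_iff (he : e ∈ IsManifold.maximalAtlas (𝓡∂ (n + 1)) ∞ M) (hx : x ∈ e.source) :
    x ∈ (𝓡∂ (n + 1)).interior M ↔ 0 < e.extend (𝓡∂ (n + 1)) x 0 := by
  have hc := chartAt_mem_maximalAtlas (n := n) x
  have hxc := mem_chart_source (EuclideanHalfSpace (n + 1)) x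
  have h1 : x ∈ (𝓡∂ (n + 1)).interior M ↔
      0 < (chartAt (EuclideanHalfSpace (n + 1)) x).extend (𝓡∂ (n + 1)) x 0 :=
    mem_interior_range_iff
  rw [h1]
  constructor
  · intro h
    rw [← transition_extend (e' := e) hxc]
    exact transition_pos hc he (extend_mem_transition_source hxc hx) h
  · intro h
    rw [← transition_extend (e' := chartAt _ x) hx]
    exact transition_pos he hc (extend_mem_transition_source hx hxc) h

lemma mem_boundary_iff (he : e ∈ IsManifold.maximalAtlas (𝓡∂ (n + 1)) ∞ M) (hx : x ∈ e.source) :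
    x ∈ (𝓡∂ (n + 1)).boundary M ↔ e.extend (𝓡∂ (n + 1)) x 0 = 0 := by
  rw [← (𝓡∂ (n + 1)).compl_interior, mem_compl_iff, mem_interior_iff he hx]
  have h1 : 0 ≤ e.extend (𝓡∂ (n + 1)) x 0 :=
    mem_range_iff.1 (e.extend_target_subset_range ((e.extend _).map_source
      (by rwa [e.extend_source])))
  exact ⟨fun h => le_antisymm (not_lt.1 h) h1, fun h => not_lt.2 h.le⟩

lemma symm_mem_interior (he : e ∈ IsManifold.maximalAtlas (𝓡∂ (n + 1)) ∞ M)
    (hw : w ∈ chartInterior e) : (e.extend (𝓡∂ (n + 1))).symm w ∈ (𝓡∂ (n + 1)).interior M := by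
  rw [mem_interior_iff he (symm_mem_source hw.1), (e.extend _).right_inv hw.1]
  exact hw.2

/-- The tangent space at x is the model space by way of the chart at x, so this chart has identity
derivative at x itself, though not at other points. -/
lemma symmDeriv_chartAt_self (x : M) : symmDeriv (chartAt (EuclideanHalfSpace (n + 1)) x)
    (extChartAt (𝓡∂ (n + 1)) x x) = ContinuousLinearMap.id ℝ _ := by
  have : IsManifold (𝓡∂ (n + 1)) 1 M := IsManifold.of_le (n := ∞) (by simp)
  exact mfderivWithin_range_extChartAt_symm

lemma symmDeriv_eq_transitionDeriv (he : e ∈ IsManifold.maximalAtlas (𝓡∂ (n + 1)) ∞ M)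
    (hw : w ∈ (e.extend (𝓡∂ (n + 1))).target) : symmDeriv e w = transitionDeriv e
      (chartAt (EuclideanHalfSpace (n + 1)) ((e.extend (𝓡∂ (n + 1))).symm w)) w := by
  rw [symmDeriv_eq_comp he (chartAt_mem_maximalAtlas _) (mem_transition_chartAt_source hw)]
  have h1 : transition e (chartAt (EuclideanHalfSpace (n + 1)) ((e.extend (𝓡∂ (n + 1))).symm w)) w =
    extChartAt (𝓡∂ (n + 1)) ((e.extend (𝓡∂ (n + 1))).symm w) ((e.extend (𝓡∂ (n + 1))).symm w) := rfl
  rw [h1, symmDeriv_chartAt_self, ContinuousLinearMap.id_comp]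

lemma isInvertible_symmDeriv (he : e ∈ IsManifold.maximalAtlas (𝓡∂ (n + 1)) ∞ M)
    (hw : w ∈ (e.extend (𝓡∂ (n + 1))).target) : (symmDeriv e w).IsInvertible := by
  rw [symmDeriv_eq_transitionDeriv he hw]
  exact isInvertible_transitionDeriv he (chartAt_mem_maximalAtlas _)
    (mem_transition_chartAt_source hw)

end Transition

/-! ### The coordinate expressions of the metric and chart independence of scalar curvature -/

section Metric

variable {n : ℕ}

lemma contDiffWithinAt_bilinearComp {b : EuclideanSpace ℝ (Fin (n + 1)) →
      EuclideanSpace ℝ (Fin (n + 1)) →L[ℝ] EuclideanSpace ℝ (Fin (n + 1)) →L[ℝ] ℝ}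
    {A : EuclideanSpace ℝ (Fin (n + 1)) →
      EuclideanSpace ℝ (Fin (n + 1)) →L[ℝ] EuclideanSpace ℝ (Fin (n + 1))}
    {s : Set (EuclideanSpace ℝ (Fin (n + 1)))} {w : EuclideanSpace ℝ (Fin (n + 1))}
    (hb : ContDiffWithinAt ℝ ∞ b s w) (hA : ContDiffWithinAt ℝ ∞ A s w) :
    ContDiffWithinAt ℝ ∞ (fun z => (b z).bilinearComp (A z) (A z)) s w := by
  have h1 : ∀ z, (b z).bilinearComp (A z) (A z) = (((b z).comp (A z)).flip.comp (A z)).flip :=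
    fun z => rfl
  simp only [h1]
  have hf : ContDiff ℝ ∞ (fun L : EuclideanSpace ℝ (Fin (n + 1)) →L[ℝ]
      EuclideanSpace ℝ (Fin (n + 1)) →L[ℝ] ℝ => L.flip) :=
    (ContinuousLinearMap.flipₗᵢ ℝ (EuclideanSpace ℝ (Fin (n + 1))) (EuclideanSpace ℝ (Fin (n + 1)))
      ℝ).contDiff
  exact hf.contDiffAt.comp_contDiffWithinAt w
    ((hf.contDiffAt.comp_contDiffWithinAt w (hb.clm_comp hA)).clm_comp hA)

variable {M : Type*} [TopologicalSpace M] [ChartedSpace (EuclideanHalfSpace (n + 1)) M]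
  [IsManifold (𝓡∂ (n + 1)) ∞ M]
  {e e' : OpenPartialHomeomorph M (EuclideanHalfSpace (n + 1))}
  {x : M} {w : EuclideanSpace ℝ (Fin (n + 1))} (g : InteriorMetric n M)

lemma contDiffAt_chartMetric_chartAt (hx : x ∈ (𝓡∂ (n + 1)).interior M) :
    ContDiffAt ℝ ∞ (chartMetric g (chartAt (EuclideanHalfSpace (n + 1)) x))
      (extChartAt (𝓡∂ (n + 1)) x x) := by
  have hpos : 0 < extChartAt (𝓡∂ (n + 1)) x x 0 := mem_interior_range_iff.1 hx
  have h1 : ContMDiffAt _ _ ∞ _ x := ((contMDiffWithinAt_form_iff g.val _ x).1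
    (g.smooth x hx)).contMDiffAt (((𝓡∂ (n + 1)).isOpen_interior (n := ∞) (by simp)).mem_nhds hx)
  have ht : (extChartAt (𝓡∂ (n + 1)) x).target ∈ 𝓝 (extChartAt (𝓡∂ (n + 1)) x x) := by
    have := extChartAt_target_mem_nhdsWithin (I := 𝓡∂ (n + 1)) x
    rwa [nhdsWithin_eq_nhds.2 (range_mem_nhds hpos)] at this
  have h2 := (contMDiffOn_extChartAt_symm (I := 𝓡∂ (n + 1)) (n := ∞) x).contMDiffAt ht
  rw [← contMDiffAt_iff_contDiffAt]
  have h3 := ContMDiffAt.comp_of_eq (y := x) h1 h2 (extChartAt_to_inv x)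
  refine h3.congr_of_eventuallyEq ?_
  filter_upwards [ht] with z hz
  rw [Function.comp_apply, (extChartAt (𝓡∂ (n + 1)) x).right_inv hz, chartMetric_eq]

lemma isMetricOn_chartMetric (he : e ∈ IsManifold.maximalAtlas (𝓡∂ (n + 1)) ∞ M) :
    IsMetricOn (chartMetric g e) (chartInterior e) where
  smooth w hw := by
    set x := (e.extend (𝓡∂ (n + 1))).symm w with hx
    have hxi : x ∈ (𝓡∂ (n + 1)).interior M := symm_mem_interior he hw
    have hws := mem_transition_chartAt_source hw.1
    have hnhds : 𝓝[range (𝓡∂ (n + 1))] w = 𝓝 w := nhdsWithin_eq_nhds.2 (range_mem_nhds hw.2)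
    have hψ : ContDiffAt ℝ ∞ (transition e (chartAt (EuclideanHalfSpace (n + 1)) x)) w :=
      ((𝓡∂ (n + 1)).contDiffWithinAt_extendCoordChange he (chartAt_mem_maximalAtlas x)
        hws).contDiffAt (range_mem_nhds hw.2)
    have hD := (contDiffWithinAt_transitionDeriv he (chartAt_mem_maximalAtlas x) hws).contDiffAt
        (range_mem_nhds hw.2)
    have h1 : ContDiffAt ℝ ∞ (chartMetric g (chartAt (EuclideanHalfSpace (n + 1)) x))
        (transition e (chartAt (EuclideanHalfSpace (n + 1)) x) w) :=
      contDiffAt_chartMetric_chartAt g hxi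
    -- Smoothness is known at the centre of the preferred chart at x; pulling back along the
    -- coordinate change gives it at w in the chart e.
    have h2 := contDiffWithinAt_bilinearComp ((h1.comp w hψ).contDiffWithinAt (s := univ))
      hD.contDiffWithinAt
    rw [contDiffWithinAt_univ] at h2
    refine (h2.congr_of_eventuallyEq ?_).contDiffWithinAt
    have h3 := (𝓡∂ (n + 1)).extendCoordChange_source_mem_nhdsWithin hws
    rw [hnhds] at h3
    filter_upwards [h3] with z hz
    ext u v
    exact formInChart_transition g.val he (chartAt_mem_maximalAtlas x) hz u v
  symm w hw u v := g.symm _ (symm_mem_interior he hw) _ _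
  nondegenerate w hw u hu := by
    have h1 := isInvertible_symmDeriv he hw.1
    refine h1.injective ?_
    rw [map_zero]
    refine g.nondegenerate _ (symm_mem_interior he hw) _ fun v => ?_
    obtain ⟨v, rfl⟩ := h1.surjective v
    exact hu v

lemma isPullbackOn_transition (he : e ∈ IsManifold.maximalAtlas (𝓡∂ (n + 1)) ∞ M)
    (he' : e' ∈ IsManifold.maximalAtlas (𝓡∂ (n + 1)) ∞ M) :
    IsPullbackOn (transition e e') (chartMetric g e') (chartMetric g e) (chartInterior e')
      ((transition e e').source ∩ {y | 0 < y 0}) where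
  isOpen := isOpen_chartInterior
  isOpen' := by
    rw [isOpen_iff_mem_nhds]
    rintro w ⟨hw, hw0⟩
    have := (𝓡∂ (n + 1)).extendCoordChange_source_mem_nhdsWithin hw
    rw [nhdsWithin_eq_nhds.2 (range_mem_nhds hw0)] at this
    exact inter_mem this ((isOpen_lt continuous_const (by fun_prop)).mem_nhds hw0)
  metric := isMetricOn_chartMetric g he'
  metric' := (isMetricOn_chartMetric g he).mono fun z hz => ⟨(mem_transition_source.1 hz.1).1, hz.2⟩
  mapsTo z hz := ⟨((transition e e').map_source hz.1).1, transition_pos he he' hz.1 hz.2⟩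
  smooth := ((𝓡∂ (n + 1)).contDiffOn_extendCoordChange he he').mono inter_subset_left
  isInvertible z hz := by
    rw [← transitionDeriv_eq_fderiv hz.2]
    exact isInvertible_transitionDeriv he he' hz.1
  apply_eq z hz u v := by
    rw [← transitionDeriv_eq_fderiv hz.2]
    exact formInChart_transition g.val he he' hz.1 u v

/-- The scalar curvature may be computed in any chart. -/
lemma scalarCurvature_eq (he : e ∈ IsManifold.maximalAtlas (𝓡∂ (n + 1)) ∞ M)
    (hw : w ∈ chartInterior e) : scalarCurvature g ((e.extend (𝓡∂ (n + 1))).symm w) =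
      coordScalarCurvature (chartMetric g e) w :=
  ((isPullbackOn_transition g he (chartAt_mem_maximalAtlas _)).coordScalarCurvature_eq
    ⟨mem_transition_chartAt_source hw.1, hw.2⟩).symm

end Metric

/-! ### Local defining functions and the boundary tangent space in charts -/

section DefiningFunction

variable {n : ℕ} {M : Type*} [TopologicalSpace M] [ChartedSpace (EuclideanHalfSpace (n + 1)) M]
  {e e' : OpenPartialHomeomorph M (EuclideanHalfSpace (n + 1))}
  {x : M} {w : EuclideanSpace ℝ (Fin (n + 1))} {ρ : M → ℝ} {U : Set M}

lemma mvfderiv_symmDeriv (he : e ∈ IsManifold.maximalAtlas (𝓡∂ (n + 1)) ∞ M)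
    (hw : w ∈ (e.extend (𝓡∂ (n + 1))).target)
    (hρ : MDifferentiableAt (𝓡∂ (n + 1)) 𝓘(ℝ, ℝ) ρ ((e.extend (𝓡∂ (n + 1))).symm w))
    (u : EuclideanSpace ℝ (Fin (n + 1))) :
    mvfderiv (𝓡∂ (n + 1)) ρ ((e.extend (𝓡∂ (n + 1))).symm w) (symmDeriv e w u) =
      fderivWithin ℝ (ρ ∘ (e.extend (𝓡∂ (n + 1))).symm) (range (𝓡∂ (n + 1))) w u := by
  have h1 := hρ.hasMFDerivAt.comp_hasMFDerivWithinAt w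
    (mdifferentiableWithinAt_extend_symm he hw).hasMFDerivWithinAt
  have h2 := h1.mfderivWithin (uniqueMDiffWithinAt_range (e.extend_target_subset_range hw))
  rw [mfderivWithin_eq_fderivWithin] at h2
  rw [h2]
  rfl

/-- A neighbourhood of a boundary point contains a coordinate half ball. -/
lemma exists_halfBall_subset {p : EuclideanSpace ℝ (Fin (n + 1))}
    {s : Set (EuclideanSpace ℝ (Fin (n + 1)))} (hs : s ∈ 𝓝[range (𝓡∂ (n + 1))] p) :
    ∃ r > 0, halfBall p r ⊆ s := by
  obtain ⟨r, hr, h⟩ := Metric.mem_nhdsWithin_iff.1 hs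
  exact ⟨r, hr, fun y hy => h ⟨(mem_halfBall.1 hy).1, mem_range_iff.2 (mem_halfBall.1 hy).2⟩⟩

lemma halfBall_subset_range {p : EuclideanSpace ℝ (Fin (n + 1))} {r : ℝ} :
    halfBall p r ⊆ range (𝓡∂ (n + 1)) := fun _ hy => mem_range_iff.2 (mem_halfBall.1 hy).2

lemma halfBall_mem_nhdsWithin_range {p : EuclideanSpace ℝ (Fin (n + 1))} {r : ℝ}
    (hw : w ∈ halfBall p r) : halfBall p r ∈ 𝓝[range (𝓡∂ (n + 1))] w := by
  rw [range_modelWithCornersEuclideanHalfSpace]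
  exact halfBall_mem_nhdsWithin hw

variable [IsManifold (𝓡∂ (n + 1)) ∞ M]

lemma extChartAt_apply_zero (hx : x ∈ (𝓡∂ (n + 1)).boundary M) :
    extChartAt (𝓡∂ (n + 1)) x x 0 = 0 :=
  (mem_boundary_iff (chartAt_mem_maximalAtlas x) (mem_chart_source _ x)).1 hx

lemma fderivWithin_chart_self (f : M → ℝ) (hf : MDifferentiableAt (𝓡∂ (n + 1)) 𝓘(ℝ, ℝ) f x)
    (u : EuclideanSpace ℝ (Fin (n + 1))) : mvfderiv (𝓡∂ (n + 1)) f x u =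
      fderivWithin ℝ (f ∘ (extChartAt (𝓡∂ (n + 1)) x).symm) (range (𝓡∂ (n + 1)))
        (extChartAt (𝓡∂ (n + 1)) x x) u := by
  have h1 := mvfderiv_symmDeriv (chartAt_mem_maximalAtlas x) (w := extChartAt (𝓡∂ (n + 1)) x x)
    (mem_extChartAt_target x) (ρ := f) (by
      have := extChartAt_to_inv (I := 𝓡∂ (n + 1)) x
      exact this.symm ▸ hf) u
  rw [symmDeriv_chartAt_self] at h1
  refine Eq.trans ?_ h1
  have h2 : ∀ z, z = x → (mvfderiv (𝓡∂ (n + 1)) f x : EuclideanSpace ℝ (Fin (n + 1)) →L[ℝ] ℝ) u =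
      (mvfderiv (𝓡∂ (n + 1)) f z : EuclideanSpace ℝ (Fin (n + 1)) →L[ℝ] ℝ) u := by
    rintro z rfl; rfl
  exact h2 _ (extChartAt_to_inv x)

/-- Read in the chart at x, the function defining `boundaryTangent` is the linear coordinate y⁰,
which is its own derivative. -/
lemma mem_boundaryTangent_iff (v : EuclideanSpace ℝ (Fin (n + 1))) :
    v ∈ (boundaryTangent x : Set (TangentSpace (𝓡∂ (n + 1)) x)) ↔ v 0 = 0 := by
  have h0 : MDifferentiableAt (𝓡∂ (n + 1)) 𝓘(ℝ, ℝ)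
      (fun z => extChartAt (𝓡∂ (n + 1)) x z 0) x := by
    have h1 : MDifferentiableAt (𝓡∂ (n + 1)) 𝓘(ℝ, EuclideanSpace ℝ (Fin (n + 1)))
      (extChartAt (𝓡∂ (n + 1)) x) x :=
      (contMDiffAt_extChartAt (n := ∞)).mdifferentiableAt (by simp)
    exact ((EuclideanSpace.proj (𝕜 := ℝ) (0 : Fin (n + 1))).differentiableAt.mdifferentiableAt).comp
      x h1
  have h2 : mvfderiv (𝓡∂ (n + 1)) (fun z => extChartAt (𝓡∂ (n + 1)) x z 0) x v = v 0 := by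
    refine (fderivWithin_chart_self _ h0 v).trans ?_
    have h3 : (fun z => extChartAt (𝓡∂ (n + 1)) x z 0) ∘ (extChartAt (𝓡∂ (n + 1)) x).symm
        =ᶠ[𝓝[range (𝓡∂ (n + 1))] (extChartAt (𝓡∂ (n + 1)) x x)]
        EuclideanSpace.proj (𝕜 := ℝ) (0 : Fin (n + 1)) := by
      filter_upwards [extChartAt_target_mem_nhdsWithin (I := 𝓡∂ (n + 1)) x] with z hz
      simp only [Function.comp_apply, (extChartAt (𝓡∂ (n + 1)) x).right_inv hz]
      rfl
    have hr : extChartAt (𝓡∂ (n + 1)) x x ∈ range (𝓡∂ (n + 1)) := mem_range_self _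
    rw [h3.fderivWithin_eq_of_mem hr, (EuclideanSpace.proj (𝕜 := ℝ)
      (0 : Fin (n + 1))).hasFDerivWithinAt.fderivWithin ((𝓡∂ (n + 1)).uniqueDiffOn _ hr)]
    rfl
  exact ⟨fun h => h2.symm.trans h, fun h => h2.trans h⟩

/-- A local defining function is the first coordinate up to a non-vanishing factor. -/
lemma IsLocalDefiningFunction.exists_eq_mul (h : IsLocalDefiningFunction (n := n) ρ U) (hxU : x ∈ U)
    (hx : x ∈ (𝓡∂ (n + 1)).boundary M) {s : Set (EuclideanSpace ℝ (Fin (n + 1)))}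
    (hs : s ∈ 𝓝[range (𝓡∂ (n + 1))] (extChartAt (𝓡∂ (n + 1)) x x)) :
    ∃ r > 0, ∃ f : EuclideanSpace ℝ (Fin (n + 1)) → ℝ,
      halfBall (extChartAt (𝓡∂ (n + 1)) x x) r ⊆ (extChartAt (𝓡∂ (n + 1)) x).target ∧
      halfBall (extChartAt (𝓡∂ (n + 1)) x x) r ⊆ s ∧
      (∀ w ∈ halfBall (extChartAt (𝓡∂ (n + 1)) x x) r, (extChartAt (𝓡∂ (n + 1)) x).symm w ∈ U) ∧
      ContDiffOn ℝ ∞ f (halfBall (extChartAt (𝓡∂ (n + 1)) x x) r) ∧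
      (∀ w ∈ halfBall (extChartAt (𝓡∂ (n + 1)) x x) r, f w ≠ 0) ∧
      ∀ w ∈ halfBall (extChartAt (𝓡∂ (n + 1)) x x) r,
        ρ ((extChartAt (𝓡∂ (n + 1)) x).symm w) = w 0 * f w := by
  set p := extChartAt (𝓡∂ (n + 1)) x x with hp
  have hp0 : p 0 = 0 := extChartAt_apply_zero hx
  have hpr : p ∈ range (𝓡∂ (n + 1)) := mem_range_self _
  have h1 : (extChartAt (𝓡∂ (n + 1)) x).symm ⁻¹' U ∈ 𝓝[range (𝓡∂ (n + 1))] p :=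
    mem_nhdsWithin_of_mem_nhds ((continuousAt_extChartAt_symm x).preimage_mem_nhds (by
      rw [extChartAt_to_inv]; exact h.isOpen.mem_nhds hxU))
  obtain ⟨r, hr, hsub⟩ := exists_halfBall_subset
    (inter_mem (inter_mem (extChartAt_target_mem_nhdsWithin (I := 𝓡∂ (n + 1)) x) h1) hs)
  have hR : ContDiffOn ℝ ∞ (ρ ∘ (extChartAt (𝓡∂ (n + 1)) x).symm) (halfBall p r) := by
    rw [← contMDiffOn_iff_contDiffOn]
    exact h.smooth.comp ((contMDiffOn_extChartAt_symm x).mono fun y hy => (hsub hy).1.1)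
      fun y hy => (hsub hy).1.2
  have hR0 : ∀ y ∈ halfBall p r, y 0 = 0 → (ρ ∘ (extChartAt (𝓡∂ (n + 1)) x).symm) y = 0 := by
    intro y hy hy0
    rw [Function.comp_apply, h.eq_zero_iff _ (hsub hy).1.2]
    refine (mem_boundary_iff (chartAt_mem_maximalAtlas x) (symm_mem_source (hsub hy).1.1)).2 ?_
    refine Eq.trans ?_ hy0
    exact congrArg (fun z : EuclideanSpace ℝ (Fin (n + 1)) => z 0)
      ((extChartAt (𝓡∂ (n + 1)) x).right_inv (hsub hy).1.1)
  obtain ⟨f, hf, hfeq⟩ := exists_eq_mul_of_eq_zero hp0 hR hR0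
  have hpb : p ∈ halfBall p r := mem_halfBall.2 ⟨Metric.mem_ball_self hr, hp0.ge⟩
  -- At p the derivative of y⁰ f is f p times dy⁰, so f p = 0 would make dρ vanish there; continuity
  -- of f spreads the non-vanishing to a smaller half ball.
  have hfp : f p ≠ 0 := by
    intro hfp
    refine h.mvfderiv_ne_zero x hxU hx ?_
    refine ContinuousLinearMap.ext fun u => ?_
    refine (fderivWithin_chart_self ρ (((h.smooth x hxU).contMDiffAt
      (h.isOpen.mem_nhds hxU)).mdifferentiableAt (by simp)) u).trans ?_
    have h2 : HasFDerivWithinAt (fun w : EuclideanSpace ℝ (Fin (n + 1)) => w 0 * f w)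
        (p 0 • fderivWithin ℝ f (halfBall p r) p + f p • EuclideanSpace.proj (𝕜 := ℝ) 0)
        (halfBall p r) p :=
      (EuclideanSpace.proj (𝕜 := ℝ) (0 : Fin (n + 1))).hasFDerivWithinAt.mul
        ((hf p hpb).differentiableWithinAt (by simp)).hasFDerivWithinAt
    have h3 := (h2.congr hfeq (hfeq p hpb)).mono_of_mem_nhdsWithin
      (halfBall_mem_nhdsWithin_range hpb)
    have h4 : fderivWithin ℝ (ρ ∘ (extChartAt (𝓡∂ (n + 1)) x).symm) (range (𝓡∂ (n + 1))) p = 0 := by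
      rw [h3.fderivWithin ((𝓡∂ (n + 1)).uniqueDiffOn _ hpr), hp0, hfp, zero_smul, zero_smul,
        add_zero]
    rw [h4]
    rfl
  have hfn : {w | f w ≠ 0} ∈ 𝓝[range (𝓡∂ (n + 1))] p := by
    have h2 := ((hf p hpb).continuousWithinAt.mono_of_mem_nhdsWithin
      (halfBall_mem_nhdsWithin_range hpb))
    exact h2.eventually_ne hfp
  obtain ⟨r', hr', hsub'⟩ := exists_halfBall_subset
    (inter_mem (halfBall_mem_nhdsWithin_range hpb) hfn)
  exact ⟨r', hr', f, fun w hw => (hsub (hsub' hw).1).1.1, fun w hw => (hsub (hsub' hw).1).2,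
    fun w hw => (hsub (hsub' hw).1).1.2, hf.mono fun w hw => (hsub' hw).1,
    fun w hw => (hsub' hw).2, fun w hw => hfeq w (hsub' hw).1⟩

end DefiningFunction

/-! ### Reduction to the defining function y⁰ in the chart at a boundary point -/

section CompactChart

variable {n : ℕ} {M : Type*} [TopologicalSpace M] [ChartedSpace (EuclideanHalfSpace (n + 1)) M]
  [IsManifold (𝓡∂ (n + 1)) ∞ M] {g : InteriorMetric n M} {x : M}

/-- In the chart at a boundary point, the Levi-Civita connection of a projectively compact metric
becomes smooth after the projective modification by the first coordinate. -/
lemma IsProjectivelyCompact.exists_isCompactCoord (hg : IsProjectivelyCompact 2 g)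
    (hx : x ∈ (𝓡∂ (n + 1)).boundary M) :
    ∃ r > 0, halfBall (extChartAt (𝓡∂ (n + 1)) x x) r ⊆ (extChartAt (𝓡∂ (n + 1)) x).target ∧
      ∃ Γ, IsCompactCoord (extChartAt (𝓡∂ (n + 1)) x x) r
        (formComponents (chartMetric g (chartAt (EuclideanHalfSpace (n + 1)) x)))
        (christoffelComponents (chartMetric g (chartAt (EuclideanHalfSpace (n + 1)) x))) Γ := by
  obtain ⟨U, ρ, hxU, hρ, e, he, hxe, Γ', hΓ', hΓ'eq⟩ := hg x hx
  set c := chartAt (EuclideanHalfSpace (n + 1)) x with hc_def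
  have hc : c ∈ IsManifold.maximalAtlas (𝓡∂ (n + 1)) ∞ M := chartAt_mem_maximalAtlas x
  have hxc : x ∈ c.source := mem_chart_source _ x
  obtain ⟨r, hr, f, htar, hsrc, hUsub, hf, hf0, hfeq⟩ := hρ.exists_eq_mul hxU hx
    ((𝓡∂ (n + 1)).extendCoordChange_source_mem_nhdsWithin (extend_mem_transition_source hxc hxe))
  set p := extChartAt (𝓡∂ (n + 1)) x x
  set ψ := transition c e with hψ_def
  set D := transitionDeriv c e with hD_def
  set G := chartMetric g c with hG_def
  have huniq : UniqueDiffOn ℝ (halfBall p r) := uniqueDiffOn_halfBall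
  have hψ : ContDiffOn ℝ ∞ ψ (halfBall p r) :=
    ((𝓡∂ (n + 1)).contDiffOn_extendCoordChange hc he).mono hsrc
  have hD : ContDiffOn ℝ ∞ D (halfBall p r) := fun w hw =>
    (contDiffWithinAt_transitionDeriv hc he (hsrc hw)).mono halfBall_subset_range
  have hDinv : ContDiffOn ℝ ∞ (fun w => (D w).inverse) (halfBall p r) := fun w hw =>
    (isInvertible_transitionDeriv hc he (hsrc hw)).contDiffAt_map_inverse.comp_contDiffWithinAt w
      (hD w hw)
  have hmaps : MapsTo ψ (halfBall p r) (e.extend (𝓡∂ (n + 1)) '' (U ∩ e.source)) := fun w hw =>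
    ⟨(c.extend (𝓡∂ (n + 1))).symm w, ⟨hUsub w hw, (mem_transition_source.1 (hsrc hw)).2⟩, rfl⟩
  have hΓψ : ContDiffOn ℝ ∞ (fun w => Γ' (ψ w)) (halfBall p r) := hΓ'.comp hψ hmaps
  have hdf : ContDiffOn ℝ ∞ (fderivWithin ℝ f (halfBall p r)) (halfBall p r) :=
    hf.fderivWithin huniq (by simp)
  -- the modified connection in the chart at `x`
  let Γ : EuclideanSpace ℝ (Fin (n + 1)) → EuclideanSpace ℝ (Fin (n + 1)) →
      EuclideanSpace ℝ (Fin (n + 1)) → EuclideanSpace ℝ (Fin (n + 1)) := fun w u v =>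
    (D w).inverse (Γ' (ψ w) (D w u) (D w v) +
        fderivWithin ℝ (fun z => D z v) (halfBall p r) w u) -
      (1 / 2 * (f w)⁻¹) • (fderivWithin ℝ f (halfBall p r) w u • v +
        fderivWithin ℝ f (halfBall p r) w v • u)
  have hΓsm : ∀ u v, ContDiffOn ℝ ∞ (fun w => Γ w u v) (halfBall p r) := by
    intro u v
    have hDa : ∀ a, ContDiffOn ℝ ∞ (fun w => D w a) (halfBall p r) := fun a =>
      hD.clm_apply contDiffOn_const
    refine (hDinv.clm_apply (((hΓψ.clm_apply (hDa u)).clm_apply (hDa v)).add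
      (((hDa v).fderivWithin (m := ∞) huniq (by simp)).clm_apply contDiffOn_const))).sub ?_
    exact (contDiffOn_const.mul (hf.inv hf0)).smul
      (((hdf.clm_apply contDiffOn_const).smul contDiffOn_const).add
        ((hdf.clm_apply contDiffOn_const).smul contDiffOn_const))
  have hΩ : openHalfBall p r ⊆ chartInterior c := fun w hw =>
    ⟨htar (openHalfBall_subset_halfBall hw), (mem_openHalfBall.1 hw).2⟩
  -- From dρ / (2ρ) = dy⁰ / (2y⁰) + df / (2f), where the last term was subtracted in the definition
  -- of Γ.
  have hΓeq : ∀ w ∈ openHalfBall p r, ∀ u v, Γ w u v = christoffel G w u v +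
      (1 / (2 * w 0)) • (u 0 • v + v 0 • u) := by
    intro w hw u v
    have hwK := openHalfBall_subset_halfBall hw
    have hw0 : 0 < w 0 := (mem_openHalfBall.1 hw).2
    have hKn : halfBall p r ∈ 𝓝 w := halfBall_mem_nhds hw
    have hpull := isPullbackOn_transition g hc he
    have hwΩ : w ∈ (transition c e).source ∩ {y | 0 < y 0} := ⟨hsrc hwK, hw0⟩
    have hDw : ∀ a, D w a = fderiv ℝ ψ w a := fun a => by
      rw [hD_def, transitionDeriv_eq_fderiv hw0]
    -- the second derivative of the coordinate change
    have hhess : fderivWithin ℝ (fun z => D z v) (halfBall p r) w u = hessian ψ w u v := by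
      rw [fderivWithin_of_mem_nhds hKn, hessian]
      have h1 : (fun z => D z v) =ᶠ[𝓝 w] fun z => fderiv ℝ ψ z v := by
        filter_upwards [(isOpen_lt continuous_const
          (by fun_prop : Continuous fun y : EuclideanSpace ℝ (Fin (n + 1)) => y 0)).mem_nhds hw0]
          with z hz
        rw [hD_def, transitionDeriv_eq_fderiv hz]
      rw [h1.fderiv_eq]
    -- the derivative of the defining function
    have hfd : HasFDerivAt f (fderivWithin ℝ f (halfBall p r) w) w :=
      ((hf w hwK).differentiableWithinAt (by simp)).hasFDerivWithinAt.hasFDerivAt hKn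
    have hRd : HasFDerivAt (ρ ∘ (c.extend (𝓡∂ (n + 1))).symm)
        (w 0 • fderivWithin ℝ f (halfBall p r) w + f w • EuclideanSpace.proj (𝕜 := ℝ) 0) w := by
      have h1 : HasFDerivAt (fun z : EuclideanSpace ℝ (Fin (n + 1)) => z 0 * f z) _ w :=
        (EuclideanSpace.proj (𝕜 := ℝ) (0 : Fin (n + 1))).hasFDerivAt.mul hfd
      exact h1.congr_of_eventuallyEq (Filter.eventuallyEq_of_mem hKn fun z hz => hfeq z hz)
    have hψd : HasFDerivAt ψ (fderiv ℝ ψ w) w := (hpull.differentiableAt hwΩ).hasFDerivAt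
    have hsymm : (e.extend (𝓡∂ (n + 1))).symm (ψ w) = (c.extend (𝓡∂ (n + 1))).symm w :=
      e.extend_left_inv (mem_transition_source.1 (hsrc hwK)).2
    have hRe : ∀ a, fderiv ℝ (ρ ∘ (e.extend (𝓡∂ (n + 1))).symm) (ψ w) (D w a) =
        w 0 * fderivWithin ℝ f (halfBall p r) w a + f w * a 0 := by
      intro a
      have hψw := hpull.mapsTo hwΩ
      have h1 : MDifferentiableAt (𝓡∂ (n + 1)) 𝓘(ℝ, ℝ) ρ ((e.extend (𝓡∂ (n + 1))).symm (ψ w)) := by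
        rw [hsymm]
        exact ((hρ.smooth _ (hUsub w hwK)).contMDiffAt
          (hρ.isOpen.mem_nhds (hUsub w hwK))).mdifferentiableAt (by simp)
      have h2 : DifferentiableAt ℝ (ρ ∘ (e.extend (𝓡∂ (n + 1))).symm) (ψ w) := by
        rw [← mdifferentiableAt_iff_differentiableAt]
        exact h1.comp _ ((mdifferentiableWithinAt_extend_symm he hψw.1).mdifferentiableAt
          (range_mem_nhds hψw.2))
      have h3 := h2.hasFDerivAt.comp w hψd
      have h4 := h3.congr_of_eventuallyEq (f₁ := ρ ∘ (c.extend (𝓡∂ (n + 1))).symm)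
        (Filter.eventuallyEq_of_mem (hpull.isOpen'.mem_nhds hwΩ) fun z hz => by
          have h5 : (e.extend (𝓡∂ (n + 1))).symm (ψ z) = (c.extend (𝓡∂ (n + 1))).symm z :=
            e.extend_left_inv (mem_transition_source.1 hz.1).2
          simp only [Function.comp_apply, h5])
      have h5 := DFunLike.congr_fun (h4.unique hRd) a
      rw [hDw]
      refine h5.trans ?_
      simp
    have hR : ρ ((e.extend (𝓡∂ (n + 1))).symm (ψ w)) = w 0 * f w := by
      rw [hsymm]
      exact hfeq w hwK
    have hmem : ψ w ∈ e.extend (𝓡∂ (n + 1)) '' (U ∩ e.source ∩ (𝓡∂ (n + 1)).interior M) :=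
      ⟨(c.extend (𝓡∂ (n + 1))).symm w, ⟨⟨hUsub w hwK, (mem_transition_source.1 (hsrc hwK)).2⟩,
        symm_mem_interior hc (hΩ hw)⟩, rfl⟩
    have hchr := hpull.fderiv_christoffel hwΩ u v
    -- The derivative of the Jacobian is the inhomogeneous term in the transformation law of the
    -- Christoffel symbols; the modification is tensorial and transforms without one.
    have hsum : Γ' (ψ w) (D w u) (D w v) + fderivWithin ℝ (fun z => D z v) (halfBall p r) w u =
        D w (christoffel G w u v + (1 / (2 * (w 0 * f w))) •
          ((w 0 * fderivWithin ℝ f (halfBall p r) w u + f w * u 0) • v +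
            (w 0 * fderivWithin ℝ f (halfBall p r) w v + f w * v 0) • u)) := by
      rw [hΓ'eq _ hmem, hhess, hRe, hRe, hR, map_add, map_smul, map_add, map_smul, map_smul,
        hDw (christoffel G w u v), hchr, hDw u, hDw v]
      abel
    have hinv : ∀ a, (D w).inverse (D w a) = a := by
      intro a
      obtain ⟨E, hE⟩ := isInvertible_transitionDeriv hc he (hsrc hwK)
      rw [hD_def, ← hE, ContinuousLinearMap.inverse_equiv]
      exact E.symm_apply_apply a
    have hfw := hf0 w hwK
    simp only [Γ]
    rw [hsum, hinv]
    ext l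
    simp only [PiLp.add_apply, PiLp.sub_apply, PiLp.smul_apply, smul_eq_mul]
    field_simp
    ring
  refine ⟨r, hr, htar, fun l i j w => Γ w (EuclideanSpace.single i 1) (EuclideanSpace.single j 1) l,
    ?_, ?_, ?_⟩
  · exact ((isMetricOn_chartMetric g hc).mono hΩ).isCoordMetric isOpen_openHalfBall
  · intro l i j
    exact (EuclideanSpace.proj (𝕜 := ℝ) l).contDiff.comp_contDiffOn (hΓsm _ _)
  · intro l i j w hw
    rw [hΓeq w hw, christoffelComponents]
    have h1 : ∀ a b : Fin (n + 1), (EuclideanSpace.single a (1 : ℝ)) b = if b = a then 1 else 0 :=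
      fun a b => by simp
    simp only [PiLp.add_apply, PiLp.smul_apply, smul_eq_mul, h1]
    by_cases hi : i = 0 <;> by_cases hj : j = 0 <;> simp [hi, hj, eq_comm]

end CompactChart

/-! ### Smoothness and limits through charts -/

section Smoothness

variable {n : ℕ} {Ω : Set (EuclideanSpace ℝ (Fin (n + 1)))}
  {G : EuclideanSpace ℝ (Fin (n + 1)) →
    EuclideanSpace ℝ (Fin (n + 1)) →L[ℝ] EuclideanSpace ℝ (Fin (n + 1)) →L[ℝ] ℝ}

lemma IsMetricOn.contDiffOn_coordScalarCurvature (hΩ : IsOpen Ω) (h : IsMetricOn G Ω) :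
    ContDiffOn ℝ ∞ (coordScalarCurvature G) Ω := by
  have hc : ∀ l i j, ContDiffOn ℝ ∞ (christoffelComponents G l i j) Ω := fun l i j =>
    (EuclideanSpace.proj (𝕜 := ℝ) l).contDiff.comp_contDiffOn (h.contDiffOn_christoffel hΩ _ _)
  have h1 : ContDiffOn ℝ ∞ (fun y => ∑ j, ∑ k, inverseComponents (formComponents G) k j y *
      ricciComponents (fun l i j => christoffelComponents G l i j y)
        (fun m l i j => pd m (christoffelComponents G l i j) y) j k) Ω := by
    refine ContDiffOn.sum fun j _ => ContDiffOn.sum fun k _ =>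
      ((h.isCoordMetric hΩ).contDiffOn_inverse k j).mul ?_
    unfold ricciComponents
    exact ContDiffOn.sum fun i _ => (((contDiffOn_pd hΩ (hc _ _ _)).sub
      (contDiffOn_pd hΩ (hc _ _ _))).add (ContDiffOn.sum fun l _ => (hc _ _ _).mul (hc _ _ _))).sub
      (ContDiffOn.sum fun l _ => (hc _ _ _).mul (hc _ _ _))
  exact h1.congr fun y hy => h.coordScalarCurvature_eq hΩ hy

variable {M : Type*} [TopologicalSpace M] [ChartedSpace (EuclideanHalfSpace (n + 1)) M]
  [IsManifold (𝓡∂ (n + 1)) ∞ M] {x : M}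

lemma contMDiffAt_of_chart {F : Type*} [NormedAddCommGroup F] [NormedSpace ℝ F] {f : M → F}
    {k : EuclideanSpace ℝ (Fin (n + 1)) → F}
    (hk : ContDiffWithinAt ℝ ∞ k (range (𝓡∂ (n + 1))) (extChartAt (𝓡∂ (n + 1)) x x))
    (hfk : ∀ᶠ z in 𝓝 x, f z = k (extChartAt (𝓡∂ (n + 1)) x z)) :
    ContMDiffAt (𝓡∂ (n + 1)) 𝓘(ℝ, F) ∞ f x := by
  have h1 : ContMDiffAt (𝓡∂ (n + 1)) 𝓘(ℝ, F) ∞ (k ∘ extChartAt (𝓡∂ (n + 1)) x) x :=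
    ContMDiffWithinAt.comp (t := range (𝓡∂ (n + 1))) x hk.contMDiffWithinAt
      (contMDiffAt_extChartAt (n := ∞)) fun z _ => mem_range_self _
  exact h1.congr_of_eventuallyEq hfk

/-- Density of the interior is what identifies the value of `extendFrom` with any limit found from
the interior. -/
lemma mem_closure_interior (x : M) : x ∈ closure ((𝓡∂ (n + 1)).interior M) := by
  rw [mem_closure_iff_nhds]
  intro V hV
  set c := chartAt (EuclideanHalfSpace (n + 1)) x
  have hpr : extChartAt (𝓡∂ (n + 1)) x x ∈ range (𝓡∂ (n + 1)) := mem_range_self _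
  have h1 : (extChartAt (𝓡∂ (n + 1)) x).symm ⁻¹' V ∈ 𝓝 (extChartAt (𝓡∂ (n + 1)) x x) :=
    (continuousAt_extChartAt_symm x).preimage_mem_nhds (by rwa [extChartAt_to_inv])
  obtain ⟨r, hr, hsub⟩ := exists_halfBall_subset (inter_mem
    (extChartAt_target_mem_nhdsWithin (I := 𝓡∂ (n + 1)) x) (mem_nhdsWithin_of_mem_nhds h1))
  have h2 := mem_closure_openHalfBall (mem_halfBall.2
    ⟨Metric.mem_ball_self (x := extChartAt (𝓡∂ (n + 1)) x x) hr, mem_range_iff.1 hpr⟩)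
  obtain ⟨w, hw⟩ := closure_nonempty_iff.1 ⟨_, h2⟩
  have hw' := hsub (openHalfBall_subset_halfBall hw)
  exact ⟨(extChartAt (𝓡∂ (n + 1)) x).symm w, hw'.2,
    symm_mem_interior (chartAt_mem_maximalAtlas x) ⟨hw'.1, (mem_openHalfBall.1 hw).2⟩⟩

lemma eventually_extend_mem_halfBall {e : OpenPartialHomeomorph M (EuclideanHalfSpace (n + 1))}
    (hx : x ∈ e.source) {p : EuclideanSpace ℝ (Fin (n + 1))} {r : ℝ}
    (h : e.extend (𝓡∂ (n + 1)) x ∈ halfBall p r) :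
    ∀ᶠ z in 𝓝 x, z ∈ e.source ∧ e.extend (𝓡∂ (n + 1)) z ∈ halfBall p r := by
  have h1 : ∀ᶠ z in 𝓝 x, z ∈ e.source := e.open_source.mem_nhds hx
  exact h1.and (e.extend_preimage_mem_nhds_of_mem_nhdsWithin hx (halfBall_mem_nhdsWithin_range h))

/-- A function on the interior which extends continuously in a chart has the expected limits. -/
lemma tendsto_of_chart {X : Type*} [TopologicalSpace X]
    {e : OpenPartialHomeomorph M (EuclideanHalfSpace (n + 1))}
    (he : e ∈ IsManifold.maximalAtlas (𝓡∂ (n + 1)) ∞ M) {f : M → X}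
    {k : EuclideanSpace ℝ (Fin (n + 1)) → X} {p w : EuclideanSpace ℝ (Fin (n + 1))} {r : ℝ}
    (htar : halfBall p r ⊆ (e.extend (𝓡∂ (n + 1))).target)
    (hk : ContinuousWithinAt k (halfBall p r) w) (hw : w ∈ halfBall p r)
    (hfk : ∀ z ∈ openHalfBall p r, f ((e.extend (𝓡∂ (n + 1))).symm z) = k z) :
    Tendsto f (𝓝[(𝓡∂ (n + 1)).interior M] (e.extend (𝓡∂ (n + 1))).symm w) (𝓝 (k w)) := by
  set y := (e.extend (𝓡∂ (n + 1))).symm w with hy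
  have hye : y ∈ e.source := symm_mem_source (htar hw)
  have hyw : e.extend (𝓡∂ (n + 1)) y = w := (e.extend _).right_inv (htar hw)
  have hev := eventually_extend_mem_halfBall (x := y) hye (hyw.symm ▸ hw)
  have h1 : Tendsto (e.extend (𝓡∂ (n + 1))) (𝓝 y) (𝓝[halfBall p r] w) := by
    refine tendsto_nhdsWithin_iff.2 ⟨?_, hev.mono fun z hz => hz.2⟩
    have := (e.continuousAt_extend (I := 𝓡∂ (n + 1)) hye).tendsto
    rwa [hyw] at this
  refine Tendsto.congr' ?_ ((hk.tendsto.comp h1).mono_left nhdsWithin_le_nhds)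
  filter_upwards [mem_nhdsWithin_of_mem_nhds hev, self_mem_nhdsWithin] with z hz hzi
  have hz1 : e.extend (𝓡∂ (n + 1)) z ∈ openHalfBall p r := mem_openHalfBall.2
    ⟨(mem_halfBall.1 hz.2).1, (mem_interior_iff he hz.1).1 hzi⟩
  rw [Function.comp_apply, ← hfk _ hz1, e.extend_left_inv hz.1]

end Smoothness

/-! ### Extension of the scalar curvature to the boundary -/

section ScalarCurvature

variable {n : ℕ} {M : Type*} [TopologicalSpace M] [ChartedSpace (EuclideanHalfSpace (n + 1)) M]
  [IsManifold (𝓡∂ (n + 1)) ∞ M] {g : InteriorMetric n M} {x : M}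

/-- The extension of the scalar curvature to the manifold with boundary. -/
def scalarExtension (g : InteriorMetric n M) : M → ℝ :=
  extendFrom ((𝓡∂ (n + 1)).interior M) (scalarCurvature g)

/-- `scalarCurvature` uses a different chart at each point; chart independence allows the single
chart at x to be used nearby. -/
lemma scalarCurvature_eventuallyEq (hx : x ∈ (𝓡∂ (n + 1)).interior M) :
    ∀ᶠ z in 𝓝 x, scalarCurvature g z = coordScalarCurvature
      (chartMetric g (chartAt (EuclideanHalfSpace (n + 1)) x)) (extChartAt (𝓡∂ (n + 1)) x z) := by
  have hc := chartAt_mem_maximalAtlas (n := n) x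
  filter_upwards [((𝓡∂ (n + 1)).isOpen_interior (n := ∞) (by simp)).mem_nhds hx,
    (chartAt _ x).open_source.mem_nhds (mem_chart_source (EuclideanHalfSpace (n + 1)) x)]
    with z hz hzs
  have hzi : (chartAt (EuclideanHalfSpace (n + 1)) x).extend (𝓡∂ (n + 1)) z ∈
      chartInterior (chartAt (EuclideanHalfSpace (n + 1)) x) :=
    ⟨((chartAt _ x).extend _).map_source (by rwa [OpenPartialHomeomorph.extend_source]),
      (mem_interior_iff hc hzs).1 hz⟩
  have h1 := scalarCurvature_eq g hc hzi
  rwa [(chartAt (EuclideanHalfSpace (n + 1)) x).extend_left_inv hzs] at h1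

lemma contMDiffAt_scalarCurvature (hx : x ∈ (𝓡∂ (n + 1)).interior M) :
    ContMDiffAt (𝓡∂ (n + 1)) 𝓘(ℝ, ℝ) ∞ (scalarCurvature g) x := by
  have hc := chartAt_mem_maximalAtlas (n := n) x
  have hxi : extChartAt (𝓡∂ (n + 1)) x x ∈
      chartInterior (chartAt (EuclideanHalfSpace (n + 1)) x) :=
    ⟨mem_extChartAt_target x, mem_interior_range_iff.1 hx⟩
  exact contMDiffAt_of_chart ((((isMetricOn_chartMetric g hc).contDiffOn_coordScalarCurvature
    isOpen_chartInterior).contDiffAt (isOpen_chartInterior.mem_nhds hxi)).contDiffWithinAt)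
    (scalarCurvature_eventuallyEq hx)

lemma scalarExtension_eq (hx : x ∈ (𝓡∂ (n + 1)).interior M) :
    scalarExtension g x = scalarCurvature g x :=
  extendFrom_eq (mem_closure_interior x)
    ((contMDiffAt_scalarCurvature hx).continuousAt.tendsto.mono_left nhdsWithin_le_nhds)

/-- The asymptotic form of a projectively compact metric and of its scalar curvature in the chart
at a boundary point. -/
lemma IsProjectivelyCompact.exists_chart_form (hn : 1 ≤ n) (hg : IsProjectivelyCompact 2 g)
    (hx : x ∈ (𝓡∂ (n + 1)).boundary M) :
    ∃ r > 0, halfBall (extChartAt (𝓡∂ (n + 1)) x x) r ⊆ (extChartAt (𝓡∂ (n + 1)) x).target ∧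
    ∃ (C : ℝ) (H : Fin (n + 1) → Fin (n + 1) → EuclideanSpace ℝ (Fin (n + 1)) → ℝ)
      (S : EuclideanSpace ℝ (Fin (n + 1)) → ℝ), C ≠ 0 ∧
      (∀ i j, ContDiffOn ℝ ∞ (H i j) (halfBall (extChartAt (𝓡∂ (n + 1)) x x) r)) ∧
      ContDiffOn ℝ ∞ S (halfBall (extChartAt (𝓡∂ (n + 1)) x x) r) ∧
      (∀ i j, ∀ y ∈ openHalfBall (extChartAt (𝓡∂ (n + 1)) x x) r, H i j y =
        y 0 * formComponents (chartMetric g (chartAt (EuclideanHalfSpace (n + 1)) x)) i j y -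
          C / y 0 * ((if i = 0 then 1 else 0) * (if j = 0 then 1 else 0))) ∧
      (∀ y ∈ halfBall (extChartAt (𝓡∂ (n + 1)) x x) r, y 0 = 0 → ∀ w : Fin (n + 1) → ℝ, w 0 = 0 →
        (∀ j ≠ 0, ∑ i, w i * H i j y = 0) → w = 0) ∧
      (∀ y ∈ halfBall (extChartAt (𝓡∂ (n + 1)) x x) r,
        scalarExtension g ((extChartAt (𝓡∂ (n + 1)) x).symm y) = S y) ∧
      ∀ y ∈ halfBall (extChartAt (𝓡∂ (n + 1)) x x) r, y 0 = 0 → S y = -(n * (n + 1)) / (4 * C) := by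
  obtain ⟨r, hr, htar, Γ, h⟩ := hg.exists_isCompactCoord hx
  have hc := chartAt_mem_maximalAtlas (n := n) x
  obtain ⟨C, H, S, hC, hHs, hSs, hH, hnd, hS, hSb⟩ :=
    h.exists_local_form hn (extChartAt_apply_zero hx) (half_pos hr) (half_lt_self hr)
  have htar' := (halfBall_mono (half_le_self hr.le)).trans htar
  refine ⟨r / 2, half_pos hr, htar', C, H, S, hC, hHs, hSs, hH, hnd, fun y hy => ?_, hSb⟩
  refine extendFrom_eq (mem_closure_interior _)
    (tendsto_of_chart hc htar' (hSs y hy).continuousWithinAt hy fun z hz => ?_)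
  have hzi : z ∈ chartInterior (chartAt (EuclideanHalfSpace (n + 1)) x) :=
    ⟨htar' (openHalfBall_subset_halfBall hz), (mem_openHalfBall.1 hz).2⟩
  rw [scalarCurvature_eq g hc hzi,
    (isMetricOn_chartMetric g hc).coordScalarCurvature_eq isOpen_chartInterior hzi, hS z hz]

lemma self_mem_halfBall (hx : x ∈ (𝓡∂ (n + 1)).boundary M) {r : ℝ} (hr : 0 < r) :
    extChartAt (𝓡∂ (n + 1)) x x ∈ halfBall (extChartAt (𝓡∂ (n + 1)) x x) r :=
  mem_halfBall.2 ⟨Metric.mem_ball_self hr, (extChartAt_apply_zero hx).ge⟩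

lemma IsProjectivelyCompact.contMDiff_scalarExtension (hn : 1 ≤ n)
    (hg : IsProjectivelyCompact 2 g) :
    ContMDiff (𝓡∂ (n + 1)) 𝓘(ℝ, ℝ) ∞ (scalarExtension g) := by
  intro x
  by_cases hx : x ∈ (𝓡∂ (n + 1)).interior M
  · refine (contMDiffAt_scalarCurvature (g := g) hx).congr_of_eventuallyEq ?_
    filter_upwards [((𝓡∂ (n + 1)).isOpen_interior (n := ∞) (by simp)).mem_nhds hx] with z hz
      using scalarExtension_eq hz
  · have hxb : x ∈ (𝓡∂ (n + 1)).boundary M := by rwa [← (𝓡∂ (n + 1)).compl_interior]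
    obtain ⟨r, hr, htar, C, H, S, hC, hHs, hSs, hH, hnd, hS, hSb⟩ := hg.exists_chart_form hn hxb
    have hp := self_mem_halfBall hxb hr
    refine contMDiffAt_of_chart ((hSs _ hp).mono_of_mem_nhdsWithin
      (halfBall_mem_nhdsWithin_range hp)) ?_
    filter_upwards [eventually_extend_mem_halfBall (mem_chart_source _ x) hp] with z hz
    have h1 := hS _ hz.2
    have h2 : (extChartAt (𝓡∂ (n + 1)) x).symm (extChartAt (𝓡∂ (n + 1)) x z) = z :=
      (chartAt (EuclideanHalfSpace (n + 1)) x).extend_left_inv hz.1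
    exact (congrArg _ h2.symm).trans h1

/-- The scalar curvature is locally constant along the boundary, with the value given by the
constant of the asymptotic form. -/
lemma eventually_scalarExtension_eq {r C : ℝ} {S : EuclideanSpace ℝ (Fin (n + 1)) → ℝ}
    (hx : x ∈ (𝓡∂ (n + 1)).boundary M) (hr : 0 < r)
    (hS : ∀ y ∈ halfBall (extChartAt (𝓡∂ (n + 1)) x x) r,
      scalarExtension g ((extChartAt (𝓡∂ (n + 1)) x).symm y) = S y)
    (hSb : ∀ y ∈ halfBall (extChartAt (𝓡∂ (n + 1)) x x) r, y 0 = 0 →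
      S y = -(n * (n + 1)) / (4 * C)) :
    ∀ᶠ z in 𝓝 x, z ∈ (𝓡∂ (n + 1)).boundary M →
      scalarExtension g z = -(n * (n + 1)) / (4 * C) := by
  filter_upwards [eventually_extend_mem_halfBall (mem_chart_source _ x) (self_mem_halfBall hx hr)]
    with z hz hzb
  have h2 : (extChartAt (𝓡∂ (n + 1)) x).symm (extChartAt (𝓡∂ (n + 1)) x z) = z :=
    (chartAt (EuclideanHalfSpace (n + 1)) x).extend_left_inv hz.1
  rw [← hSb _ hz.2 ((mem_boundary_iff (chartAt_mem_maximalAtlas x) hz.1).1 hzb), ← hS _ hz.2]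
  exact (congrArg _ h2.symm)

end ScalarCurvature

/-! ### Extension of the form ρ g - C dρ ⊗ dρ / ρ -/

section AsymptoticForm

variable {n : ℕ} {M : Type*} [TopologicalSpace M] [ChartedSpace (EuclideanHalfSpace (n + 1)) M]
  {x : M} {ρ : M → ℝ} {C : ℝ} {U : Set M}

open Classical in
/-- The extension of a field of bilinear forms from the interior to the boundary, by taking limits
in the charts at the boundary points. -/
def formExtension
    (h : ∀ x : M, TangentSpace (𝓡∂ (n + 1)) x →L[ℝ] TangentSpace (𝓡∂ (n + 1)) x →L[ℝ] ℝ) (x : M) :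
    TangentSpace (𝓡∂ (n + 1)) x →L[ℝ] TangentSpace (𝓡∂ (n + 1)) x →L[ℝ] ℝ :=
  if x ∈ (𝓡∂ (n + 1)).interior M then h x else
    (extendFrom ((𝓡∂ (n + 1)).interior M) (fun z => formInChart h
      (chartAt (EuclideanHalfSpace (n + 1)) x) (extChartAt (𝓡∂ (n + 1)) x z)) x :
        EuclideanSpace ℝ (Fin (n + 1)) →L[ℝ] EuclideanSpace ℝ (Fin (n + 1)) →L[ℝ] ℝ)

lemma formExtension_of_mem
    (h : ∀ x : M, TangentSpace (𝓡∂ (n + 1)) x →L[ℝ] TangentSpace (𝓡∂ (n + 1)) x →L[ℝ] ℝ)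
    (hx : x ∈ (𝓡∂ (n + 1)).interior M) : formExtension h x = h x := if_pos hx

lemma formExtension_of_notMem
    (h : ∀ x : M, TangentSpace (𝓡∂ (n + 1)) x →L[ℝ] TangentSpace (𝓡∂ (n + 1)) x →L[ℝ] ℝ)
    (hx : x ∉ (𝓡∂ (n + 1)).interior M) : formExtension h x =
    (extendFrom ((𝓡∂ (n + 1)).interior M) (fun z => formInChart h
      (chartAt (EuclideanHalfSpace (n + 1)) x) (extChartAt (𝓡∂ (n + 1)) x z)) x :
        EuclideanSpace ℝ (Fin (n + 1)) →L[ℝ] EuclideanSpace ℝ (Fin (n + 1)) →L[ℝ] ℝ) := if_neg hx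

variable [IsManifold (𝓡∂ (n + 1)) ∞ M] {g : InteriorMetric n M}

/-- The form `ρ g - C / ρ dρ ⊗ dρ`. -/
def scaledForm (g : InteriorMetric n M) (ρ : M → ℝ) (C : ℝ) (x : M) :
    TangentSpace (𝓡∂ (n + 1)) x →L[ℝ] TangentSpace (𝓡∂ (n + 1)) x →L[ℝ] ℝ :=
  ρ x • g.val x - (C / ρ x) • (mvfderiv (𝓡∂ (n + 1)) ρ x).smulRight (mvfderiv (𝓡∂ (n + 1)) ρ x)

lemma scaledForm_apply (u v : TangentSpace (𝓡∂ (n + 1)) x) : scaledForm g ρ C x u v =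
    ρ x * g.val x u v -
      C / ρ x * (mvfderiv (𝓡∂ (n + 1)) ρ x u * mvfderiv (𝓡∂ (n + 1)) ρ x v) := rfl

/-- If a form has a smooth extension up to the boundary in one chart, then this is the expression
of the extended form in that chart. -/
lemma formInChart_formExtension
    (h : ∀ x : M, TangentSpace (𝓡∂ (n + 1)) x →L[ℝ] TangentSpace (𝓡∂ (n + 1)) x →L[ℝ] ℝ)
    {c : OpenPartialHomeomorph M (EuclideanHalfSpace (n + 1))}
    (hc : c ∈ IsManifold.maximalAtlas (𝓡∂ (n + 1)) ∞ M) {p : EuclideanSpace ℝ (Fin (n + 1))} {r : ℝ}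
    (htar : halfBall p r ⊆ (c.extend (𝓡∂ (n + 1))).target)
    {K : EuclideanSpace ℝ (Fin (n + 1)) →
      EuclideanSpace ℝ (Fin (n + 1)) →L[ℝ] EuclideanSpace ℝ (Fin (n + 1)) →L[ℝ] ℝ}
    (hK : ContDiffOn ℝ ∞ K (halfBall p r))
    (hKh : ∀ w ∈ openHalfBall p r, formInChart h c w = K w)
    {w : EuclideanSpace ℝ (Fin (n + 1))} (hw : w ∈ halfBall p r) :
    formInChart (formExtension h) c w = K w := by
  have hwc := symm_mem_source (htar hw)
  set y := (c.extend (𝓡∂ (n + 1))).symm w with hy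
  have hyw : c.extend (𝓡∂ (n + 1)) y = w := (c.extend _).right_inv (htar hw)
  by_cases hyi : y ∈ (𝓡∂ (n + 1)).interior M
  · have hw0 : 0 < w 0 := by
      have := (mem_interior_iff hc hwc).1 hyi
      rwa [hyw] at this
    rw [← hKh w (mem_openHalfBall.2 ⟨(mem_halfBall.1 hw).1, hw0⟩)]
    ext u v
    rw [formInChart_apply, formInChart_apply, ← hy, formExtension_of_mem h hyi]
  -- At a boundary point the extension is defined by a limit in the chart c' at that point, while K
  -- is given in the chart c; the coordinate change between the two charts compares them.
  · set c' := chartAt (EuclideanHalfSpace (n + 1)) y with hc'_def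
    have hc' : c' ∈ IsManifold.maximalAtlas (𝓡∂ (n + 1)) ∞ M := chartAt_mem_maximalAtlas y
    have hyc' : y ∈ c'.source := mem_chart_source _ y
    set q := extChartAt (𝓡∂ (n + 1)) y y with hq
    have hqs : q ∈ (transition c' c).source := extend_mem_transition_source hyc' hwc
    have hθq : transition c' c q = w := (transition_extend (e' := c) hyc').trans hyw
    have hqr : q ∈ range (𝓡∂ (n + 1)) := mem_range_self _
    -- the expression in the chart at `y`
    have hθ := (𝓡∂ (n + 1)).contDiffWithinAt_extendCoordChange hc' hc hqs
    have hmaps : MapsTo (transition c' c) (transition c' c).source (range (𝓡∂ (n + 1))) :=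
      fun z hz => c.extend_target_subset_range ((transition c' c).map_source hz).1
    have hsn := (𝓡∂ (n + 1)).extendCoordChange_source_mem_nhdsWithin hqs
    have hKr : ContDiffWithinAt ℝ ∞ K (range (𝓡∂ (n + 1))) w :=
      (hK w hw).mono_of_mem_nhdsWithin (halfBall_mem_nhdsWithin_range hw)
    have hKθ : ContDiffWithinAt ℝ ∞ (fun z => K (transition c' c z)) (range (𝓡∂ (n + 1))) q := by
      have h1 : ContDiffWithinAt ℝ ∞ K (range (𝓡∂ (n + 1))) (transition c' c q) := by rwa [hθq]
      exact (h1.comp q (hθ.mono fun z hz =>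
        c'.extend_target_subset_range (mem_transition_source.1 hz).1) hmaps).mono_of_mem_nhdsWithin hsn
    have hcont := (contDiffWithinAt_bilinearComp hKθ
      (contDiffWithinAt_transitionDeriv hc' hc hqs)).continuousWithinAt
    have hT : Tendsto (fun z => formInChart h c' (extChartAt (𝓡∂ (n + 1)) y z))
        (𝓝[(𝓡∂ (n + 1)).interior M] y) (𝓝 ((K w).bilinearComp (transitionDeriv c' c q)
          (transitionDeriv c' c q))) := by
      have h1 : Tendsto (extChartAt (𝓡∂ (n + 1)) y) (𝓝 y) (𝓝[range (𝓡∂ (n + 1))] q) :=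
        tendsto_nhdsWithin_iff.2 ⟨continuousAt_extChartAt y,
          Eventually.of_forall fun z => mem_range_self _⟩
      have h2 := hcont.tendsto.comp h1
      rw [hθq] at h2
      refine Tendsto.congr' ?_ (h2.mono_left nhdsWithin_le_nhds)
      have h3 := eventually_extend_mem_halfBall (x := y) hwc (hyw.symm ▸ hw)
      filter_upwards [mem_nhdsWithin_of_mem_nhds h3, self_mem_nhdsWithin,
        mem_nhdsWithin_of_mem_nhds (c'.open_source.mem_nhds hyc')] with z hz hzi hzc'
      have hzt := transition_extend (e' := c) hzc'
      have hz0 : transition c' c (c'.extend (𝓡∂ (n + 1)) z) ∈ openHalfBall p r := by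
        refine hzt.symm ▸ mem_openHalfBall.2 ⟨(mem_halfBall.1 hz.2).1, (mem_interior_iff hc hz.1).1 hzi⟩
      ext u v
      refine Eq.trans ?_
        (formInChart_transition h hc' hc (extend_mem_transition_source hzc' hz.1) u v).symm
      rw [hKh _ hz0]
      rfl
    have hlim := extendFrom_eq (mem_closure_interior y) hT
    -- the derivatives of the coordinate changes are inverse to each other
    have hinv : ∀ u, transitionDeriv c' c q (symmDeriv c w u) = u := by
      have h1 : (symmDeriv c w).comp (transitionDeriv c' c q) = ContinuousLinearMap.id ℝ _ := by
        have h2 := symmDeriv_eq_comp hc' hc hqs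
        rw [hθq] at h2
        rw [← h2]
        exact symmDeriv_chartAt_self y
      intro u
      refine (isInvertible_symmDeriv hc (htar hw)).injective ?_
      exact DFunLike.congr_fun h1 (symmDeriv c w u)
    ext u v
    rw [formInChart_apply, ← hy, formExtension_of_notMem h hyi]
    refine (DFunLike.congr_fun (DFunLike.congr_fun hlim (symmDeriv c w u)) (symmDeriv c w v)).trans ?_
    rw [ContinuousLinearMap.bilinearComp_apply, hinv, hinv]

/-- The coordinate expression of a bilinear form with given components. -/
def ofComponents (H : Fin (n + 1) → Fin (n + 1) → ℝ) :
    EuclideanSpace ℝ (Fin (n + 1)) →L[ℝ] EuclideanSpace ℝ (Fin (n + 1)) →L[ℝ] ℝ :=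
  ∑ i, ∑ j, H i j • (EuclideanSpace.proj (𝕜 := ℝ) i : EuclideanSpace ℝ (Fin (n + 1)) →L[ℝ]
    ℝ).smulRight (EuclideanSpace.proj (𝕜 := ℝ) j : EuclideanSpace ℝ (Fin (n + 1)) →L[ℝ] ℝ)

lemma ofComponents_apply (H : Fin (n + 1) → Fin (n + 1) → ℝ)
    (u v : EuclideanSpace ℝ (Fin (n + 1))) :
    ofComponents H u v = ∑ i, ∑ j, u i * v j * H i j := by
  simp only [ofComponents, sum_apply, smul_apply, ContinuousLinearMap.smulRight_apply,
    PiLp.proj_apply, smul_eq_mul]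
  exact Finset.sum_congr rfl fun i _ => Finset.sum_congr rfl fun j _ => by ring

/-- The form `ρ g - C / ρ dρ ⊗ dρ` extends smoothly to the boundary in the chart at a boundary
point, and the extension is a multiple of the leading part of the metric on the boundary. -/
lemma exists_scaledForm_extension (hx : x ∈ (𝓡∂ (n + 1)).boundary M) (hxU : x ∈ U)
    (hρ : IsLocalDefiningFunction (n := n) ρ U) {r : ℝ} (hr : 0 < r)
    {H : Fin (n + 1) → Fin (n + 1) → EuclideanSpace ℝ (Fin (n + 1)) → ℝ}
    (hHs : ∀ i j, ContDiffOn ℝ ∞ (H i j) (halfBall (extChartAt (𝓡∂ (n + 1)) x x) r))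
    (hH : ∀ i j, ∀ y ∈ openHalfBall (extChartAt (𝓡∂ (n + 1)) x x) r, H i j y =
      y 0 * formComponents (chartMetric g (chartAt (EuclideanHalfSpace (n + 1)) x)) i j y -
        C / y 0 * ((if i = 0 then 1 else 0) * (if j = 0 then 1 else 0))) :
    ∃ r' > 0, halfBall (extChartAt (𝓡∂ (n + 1)) x x) r' ⊆ (extChartAt (𝓡∂ (n + 1)) x).target ∧
      halfBall (extChartAt (𝓡∂ (n + 1)) x x) r' ⊆ halfBall (extChartAt (𝓡∂ (n + 1)) x x) r ∧
      ∃ K : EuclideanSpace ℝ (Fin (n + 1)) →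
        EuclideanSpace ℝ (Fin (n + 1)) →L[ℝ] EuclideanSpace ℝ (Fin (n + 1)) →L[ℝ] ℝ,
      ContDiffOn ℝ ∞ K (halfBall (extChartAt (𝓡∂ (n + 1)) x x) r') ∧
      (∀ w ∈ openHalfBall (extChartAt (𝓡∂ (n + 1)) x x) r', formInChart (scaledForm g ρ C)
        (chartAt (EuclideanHalfSpace (n + 1)) x) w = K w) ∧
      ∃ a : ℝ, a ≠ 0 ∧ ∀ u v : EuclideanSpace ℝ (Fin (n + 1)), u 0 = 0 → v 0 = 0 →
        K (extChartAt (𝓡∂ (n + 1)) x x) u v =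
          a * ∑ i, ∑ j, u i * v j * H i j (extChartAt (𝓡∂ (n + 1)) x x) := by
  have hp := self_mem_halfBall hx hr
  obtain ⟨r', hr', f, htar, hsub, hUsub, hf, hf0, hfeq⟩ := hρ.exists_eq_mul hxU hx
    (halfBall_mem_nhdsWithin_range hp)
  set p := extChartAt (𝓡∂ (n + 1)) x x
  have hp' : p ∈ halfBall p r' := self_mem_halfBall hx hr'
  set c := chartAt (EuclideanHalfSpace (n + 1)) x with hc_def
  have hc : c ∈ IsManifold.maximalAtlas (𝓡∂ (n + 1)) ∞ M := chartAt_mem_maximalAtlas x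
  have hdf : ContDiffOn ℝ ∞ (fderivWithin ℝ f (halfBall p r')) (halfBall p r') :=
    hf.fderivWithin uniqueDiffOn_halfBall (by simp)
  let ε : EuclideanSpace ℝ (Fin (n + 1)) →L[ℝ] ℝ := EuclideanSpace.proj (𝕜 := ℝ) 0
  -- Substituting ρ = y⁰ f and dρ = y⁰ df + f dy⁰, the pole of dρ ⊗ dρ / ρ is absorbed in f H and
  -- the other terms are smooth.
  let K : EuclideanSpace ℝ (Fin (n + 1)) →
      EuclideanSpace ℝ (Fin (n + 1)) →L[ℝ] EuclideanSpace ℝ (Fin (n + 1)) →L[ℝ] ℝ := fun w =>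
    f w • ofComponents (fun i j => H i j w) -
      (C • (ε.smulRight (fderivWithin ℝ f (halfBall p r') w) +
          (fderivWithin ℝ f (halfBall p r') w).smulRight ε) +
        (C * (w 0 * (f w)⁻¹)) • (fderivWithin ℝ f (halfBall p r') w).smulRight
          (fderivWithin ℝ f (halfBall p r') w))
  have hKapply : ∀ w u v, K w u v = f w * (∑ i, ∑ j, u i * v j * H i j w) -
      (C * (u 0 * fderivWithin ℝ f (halfBall p r') w v + fderivWithin ℝ f (halfBall p r') w u * v 0) +
        C * (w 0 * (f w)⁻¹) * (fderivWithin ℝ f (halfBall p r') w u *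
          fderivWithin ℝ f (halfBall p r') w v)) := by
    intro w u v
    rw [← ofComponents_apply]
    rfl
  -- On boundary directions dy⁰ vanishes and y⁰ = 0 at the centre, so only f p times H survives.
  refine ⟨r', hr', htar, hsub, K, ?_, ?_, f p, hf0 p hp', ?_⟩
  · rw [contDiffOn_clm_apply]
    intro u
    rw [contDiffOn_clm_apply]
    intro v
    simp only [hKapply]
    have hda : ∀ a, ContDiffOn ℝ ∞ (fun w => fderivWithin ℝ f (halfBall p r') w a) (halfBall p r') :=
      fun a => hdf.clm_apply contDiffOn_const
    exact (hf.mul (ContDiffOn.sum fun i _ => ContDiffOn.sum fun j _ =>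
      contDiffOn_const.mul ((hHs i j).mono hsub))).sub
      ((contDiffOn_const.mul ((contDiffOn_const.mul (hda v)).add ((hda u).mul contDiffOn_const))).add
        ((contDiffOn_const.mul ((contDiffOn_coord 0).mul (hf.inv hf0))).mul ((hda u).mul (hda v))))
  · intro w hw
    have hwK := openHalfBall_subset_halfBall hw
    have hw0 : 0 < w 0 := (mem_openHalfBall.1 hw).2
    have hKn : halfBall p r' ∈ 𝓝 w := halfBall_mem_nhds hw
    have hfd : HasFDerivAt f (fderivWithin ℝ f (halfBall p r') w) w :=
      ((hf w hwK).differentiableWithinAt (by simp)).hasFDerivWithinAt.hasFDerivAt hKn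
    have hRd : HasFDerivAt (ρ ∘ (c.extend (𝓡∂ (n + 1))).symm)
        (w 0 • fderivWithin ℝ f (halfBall p r') w + f w • EuclideanSpace.proj (𝕜 := ℝ) 0) w := by
      have h1 : HasFDerivAt (fun z : EuclideanSpace ℝ (Fin (n + 1)) => z 0 * f z) _ w :=
        (EuclideanSpace.proj (𝕜 := ℝ) (0 : Fin (n + 1))).hasFDerivAt.mul hfd
      exact h1.congr_of_eventuallyEq (Filter.eventuallyEq_of_mem hKn fun z hz => hfeq z hz)
    have hR : ρ ((c.extend (𝓡∂ (n + 1))).symm w) = w 0 * f w := hfeq w hwK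
    have hdρ : ∀ a, mvfderiv (𝓡∂ (n + 1)) ρ ((c.extend (𝓡∂ (n + 1))).symm w) (symmDeriv c w a) =
        w 0 * fderivWithin ℝ f (halfBall p r') w a + f w * a 0 := by
      intro a
      have h1 : MDifferentiableAt (𝓡∂ (n + 1)) 𝓘(ℝ, ℝ) ρ ((c.extend (𝓡∂ (n + 1))).symm w) :=
        ((hρ.smooth _ (hUsub w hwK)).contMDiffAt
          (hρ.isOpen.mem_nhds (hUsub w hwK))).mdifferentiableAt (by simp)
      rw [mvfderiv_symmDeriv hc (htar hwK) h1, fderivWithin_of_mem_nhds (range_mem_nhds hw0),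
        hRd.fderiv]
      simp
    have hfw := hf0 w hwK
    have hw' : w ∈ openHalfBall p r := mem_openHalfBall.2 ⟨(mem_halfBall.1 (hsub hwK)).1, hw0⟩
    ext u v
    have h0 : formInChart (scaledForm g ρ C) c w u v =
        ρ ((c.extend (𝓡∂ (n + 1))).symm w) * chartMetric g c w u v -
          C / ρ ((c.extend (𝓡∂ (n + 1))).symm w) *
            (mvfderiv (𝓡∂ (n + 1)) ρ ((c.extend (𝓡∂ (n + 1))).symm w) (symmDeriv c w u) *
              mvfderiv (𝓡∂ (n + 1)) ρ ((c.extend (𝓡∂ (n + 1))).symm w) (symmDeriv c w v)) := rfl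
    have hG : chartMetric g c w u v =
        ∑ i, ∑ j, u i * v j * formComponents (chartMetric g c) i j w :=
      form_apply_eq_sum (chartMetric g c w) u v
    rw [h0, hdρ, hdρ, hR, hKapply]
    have hsum : ∑ i, ∑ j, u i * v j * H i j w =
        w 0 * (∑ i, ∑ j, u i * v j * formComponents (chartMetric g c) i j w) -
          C / w 0 * (u 0 * v 0) := by
      have h1 : ∀ i j, u i * v j * H i j w =
          w 0 * (u i * v j * formComponents (chartMetric g c) i j w) -
            C / w 0 * ((u i * if i = 0 then 1 else 0) * (v j * if j = 0 then 1 else 0)) := by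
        intro i j
        rw [hH i j w hw']
        ring
      simp only [h1, Finset.sum_sub_distrib, ← Finset.mul_sum, ← Finset.sum_mul]
      simp
    rw [hG, hsum]
    field_simp
    ring
  · intro u v hu hv
    rw [hKapply, hu, hv, extChartAt_apply_zero hx]
    ring

end AsymptoticForm

/-! ### Smoothness and boundary non-degeneracy of the extended form -/

section MainTheorem

variable {n : ℕ} {M : Type*} [TopologicalSpace M] [ChartedSpace (EuclideanHalfSpace (n + 1)) M]
  [IsManifold (𝓡∂ (n + 1)) ∞ M] {g : InteriorMetric n M} {x : M} {ρ : M → ℝ} {C : ℝ} {U : Set M}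

/-- In the interior ρ does not vanish, so division by it preserves smoothness. -/
lemma contDiffAt_formInChart_scaledForm (hx : x ∈ (𝓡∂ (n + 1)).interior M) (hxU : x ∈ U)
    (hρ : IsLocalDefiningFunction (n := n) ρ U) :
    ContDiffAt ℝ ∞ (formInChart (scaledForm g ρ C) (chartAt (EuclideanHalfSpace (n + 1)) x))
      (extChartAt (𝓡∂ (n + 1)) x x) := by
  have hpos : 0 < extChartAt (𝓡∂ (n + 1)) x x 0 := mem_interior_range_iff.1 hx
  have hc := chartAt_mem_maximalAtlas (n := n) x
  have ht : (extChartAt (𝓡∂ (n + 1)) x).target ∈ 𝓝 (extChartAt (𝓡∂ (n + 1)) x x) := by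
    have := extChartAt_target_mem_nhdsWithin (I := 𝓡∂ (n + 1)) x
    rwa [nhdsWithin_eq_nhds.2 (range_mem_nhds hpos)] at this
  have hsymm := (contMDiffOn_extChartAt_symm (I := 𝓡∂ (n + 1)) (n := ∞) x).contMDiffAt ht
  have hRU : ∀ᶠ w in 𝓝 (extChartAt (𝓡∂ (n + 1)) x x), (extChartAt (𝓡∂ (n + 1)) x).symm w ∈ U :=
    (continuousAt_extChartAt_symm x).preimage_mem_nhds
      (by rw [extChartAt_to_inv]; exact hρ.isOpen.mem_nhds hxU)
  set R : EuclideanSpace ℝ (Fin (n + 1)) → ℝ := ρ ∘ (extChartAt (𝓡∂ (n + 1)) x).symm with hR_def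
  have hR : ContDiffAt ℝ ∞ R (extChartAt (𝓡∂ (n + 1)) x x) :=
    contMDiffAt_iff_contDiffAt.1 (ContMDiffAt.comp_of_eq (y := x)
      ((hρ.smooth x hxU).contMDiffAt (hρ.isOpen.mem_nhds hxU)) hsymm (extChartAt_to_inv x))
  have hR0 : R (extChartAt (𝓡∂ (n + 1)) x x) ≠ 0 := by
    rw [hR_def, Function.comp_apply, extChartAt_to_inv, Ne, hρ.eq_zero_iff x hxU,
      ← (𝓡∂ (n + 1)).compl_interior]
    exact fun h => h hx
  have hdR : ContDiffAt ℝ ∞ (fderiv ℝ R) (extChartAt (𝓡∂ (n + 1)) x x) :=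
    hR.fderiv_right (by simp)
  have hk : ContDiffAt ℝ ∞ (fun w =>
      R w • chartMetric g (chartAt (EuclideanHalfSpace (n + 1)) x) w -
        (C / R w) • (fderiv ℝ R w).smulRight (fderiv ℝ R w)) (extChartAt (𝓡∂ (n + 1)) x x) :=
    (hR.smul (contDiffAt_chartMetric_chartAt g hx)).sub
      ((contDiffAt_const.div hR hR0).smul (hdR.smulRight hdR))
  refine hk.congr_of_eventuallyEq ?_
  filter_upwards [ht, hRU, (EuclideanSpace.proj (𝕜 := ℝ) (0 : Fin (n + 1))).continuous.continuousAt.eventually_const_lt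
    hpos]
    with w hw hwU hw0
  have hdρ : ∀ a, mvfderiv (𝓡∂ (n + 1)) ρ ((extChartAt (𝓡∂ (n + 1)) x).symm w)
      (symmDeriv (chartAt (EuclideanHalfSpace (n + 1)) x) w a) = fderiv ℝ R w a := by
    intro a
    have h1 : MDifferentiableAt (𝓡∂ (n + 1)) 𝓘(ℝ, ℝ) ρ ((extChartAt (𝓡∂ (n + 1)) x).symm w) :=
      ((hρ.smooth _ hwU).contMDiffAt (hρ.isOpen.mem_nhds hwU)).mdifferentiableAt (by simp)
    have h2 := mvfderiv_symmDeriv hc hw h1 a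
    rwa [fderivWithin_of_mem_nhds (range_mem_nhds hw0)] at h2
  ext u v
  have h0 : formInChart (scaledForm g ρ C) (chartAt (EuclideanHalfSpace (n + 1)) x) w u v =
      R w * chartMetric g (chartAt (EuclideanHalfSpace (n + 1)) x) w u v - C / R w *
        (mvfderiv (𝓡∂ (n + 1)) ρ ((extChartAt (𝓡∂ (n + 1)) x).symm w)
            (symmDeriv (chartAt (EuclideanHalfSpace (n + 1)) x) w u) *
          mvfderiv (𝓡∂ (n + 1)) ρ ((extChartAt (𝓡∂ (n + 1)) x).symm w)
            (symmDeriv (chartAt (EuclideanHalfSpace (n + 1)) x) w v)) := rfl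
  rw [h0, hdρ, hdρ]
  rfl

lemma formInChart_chartAt_self
    (h : ∀ x : M, TangentSpace (𝓡∂ (n + 1)) x →L[ℝ] TangentSpace (𝓡∂ (n + 1)) x →L[ℝ] ℝ)
    (x : M) (u v : EuclideanSpace ℝ (Fin (n + 1))) :
    formInChart h (chartAt (EuclideanHalfSpace (n + 1)) x) (extChartAt (𝓡∂ (n + 1)) x x) u v =
      (h x : EuclideanSpace ℝ (Fin (n + 1)) →L[ℝ] EuclideanSpace ℝ (Fin (n + 1)) →L[ℝ] ℝ) u v := by
  rw [formInChart_apply, symmDeriv_chartAt_self]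
  have h2 : ∀ z, z = x →
      (h z : EuclideanSpace ℝ (Fin (n + 1)) →L[ℝ] EuclideanSpace ℝ (Fin (n + 1)) →L[ℝ] ℝ) u v =
      (h x : EuclideanSpace ℝ (Fin (n + 1)) →L[ℝ] EuclideanSpace ℝ (Fin (n + 1)) →L[ℝ] ℝ) u v := by
    rintro z rfl; rfl
  exact h2 _ (extChartAt_to_inv x)

/-- The extended form is smooth at the interior points. -/
lemma contMDiffAt_formExtension_of_mem_interior (hx : x ∈ (𝓡∂ (n + 1)).interior M) (hxU : x ∈ U)
    (hρ : IsLocalDefiningFunction (n := n) ρ U) :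
    ContMDiffAt (𝓡∂ (n + 1))
      𝓘(ℝ, EuclideanSpace ℝ (Fin (n + 1)) →L[ℝ] EuclideanSpace ℝ (Fin (n + 1)) →L[ℝ] ℝ) ∞
      (fun z => formInChart (formExtension (scaledForm g ρ C))
        (chartAt (EuclideanHalfSpace (n + 1)) x) (extChartAt (𝓡∂ (n + 1)) x z)) x := by
  refine contMDiffAt_of_chart
    (contDiffAt_formInChart_scaledForm (g := g) (C := C) hx hxU hρ).contDiffWithinAt ?_
  filter_upwards [((𝓡∂ (n + 1)).isOpen_interior (n := ∞) (by simp)).mem_nhds hx,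
    (chartAt _ x).open_source.mem_nhds (mem_chart_source (EuclideanHalfSpace (n + 1)) x)]
    with z hz hzs
  have h1 : (extChartAt (𝓡∂ (n + 1)) x).symm (extChartAt (𝓡∂ (n + 1)) x z) = z :=
    (chartAt (EuclideanHalfSpace (n + 1)) x).extend_left_inv hzs
  have h2 : formExtension (scaledForm g ρ C) ((extChartAt (𝓡∂ (n + 1)) x).symm
      (extChartAt (𝓡∂ (n + 1)) x z)) = scaledForm g ρ C ((extChartAt (𝓡∂ (n + 1)) x).symm
      (extChartAt (𝓡∂ (n + 1)) x z)) := formExtension_of_mem _ (h1.symm ▸ hz)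
  ext u v
  exact DFunLike.congr_fun (DFunLike.congr_fun h2 (symmDeriv _ _ u)) (symmDeriv _ _ v)

/-- The extended form at the boundary points. -/
lemma formExtension_boundary (hx : x ∈ (𝓡∂ (n + 1)).boundary M) (hxU : x ∈ U)
    (hρ : IsLocalDefiningFunction (n := n) ρ U) {r : ℝ} (hr : 0 < r)
    {H : Fin (n + 1) → Fin (n + 1) → EuclideanSpace ℝ (Fin (n + 1)) → ℝ}
    (hHs : ∀ i j, ContDiffOn ℝ ∞ (H i j) (halfBall (extChartAt (𝓡∂ (n + 1)) x x) r))
    (hH : ∀ i j, ∀ y ∈ openHalfBall (extChartAt (𝓡∂ (n + 1)) x x) r, H i j y =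
      y 0 * formComponents (chartMetric g (chartAt (EuclideanHalfSpace (n + 1)) x)) i j y -
        C / y 0 * ((if i = 0 then 1 else 0) * (if j = 0 then 1 else 0)))
    (hnd : ∀ w : Fin (n + 1) → ℝ, w 0 = 0 →
      (∀ j ≠ 0, ∑ i, w i * H i j (extChartAt (𝓡∂ (n + 1)) x x) = 0) → w = 0) :
    ContMDiffAt (𝓡∂ (n + 1))
      𝓘(ℝ, EuclideanSpace ℝ (Fin (n + 1)) →L[ℝ] EuclideanSpace ℝ (Fin (n + 1)) →L[ℝ] ℝ) ∞
      (fun z => formInChart (formExtension (scaledForm g ρ C))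
        (chartAt (EuclideanHalfSpace (n + 1)) x) (extChartAt (𝓡∂ (n + 1)) x z)) x ∧
    ∀ u ∈ boundaryTangent (n := n) x,
      (∀ v ∈ boundaryTangent (n := n) x, formExtension (scaledForm g ρ C) x u v = 0) → u = 0 := by
  obtain ⟨r', hr', htar, -, K, hK, hKh, a, ha, hKa⟩ :=
    exists_scaledForm_extension hx hxU hρ hr hHs hH
  have hc := chartAt_mem_maximalAtlas (n := n) x
  have hp := self_mem_halfBall hx hr'
  have hext : ∀ w ∈ halfBall (extChartAt (𝓡∂ (n + 1)) x x) r',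
      formInChart (formExtension (scaledForm g ρ C))
        (chartAt (EuclideanHalfSpace (n + 1)) x) w = K w :=
    fun w hw => formInChart_formExtension _ hc htar hK hKh hw
  refine ⟨contMDiffAt_of_chart ((hK _ hp).mono_of_mem_nhdsWithin
    (halfBall_mem_nhdsWithin_range hp)) ?_, ?_⟩
  · filter_upwards [eventually_extend_mem_halfBall (mem_chart_source _ x) hp] with z hz
    exact hext _ hz.2
  · have key : ∀ u : EuclideanSpace ℝ (Fin (n + 1)), u 0 = 0 →
        (∀ v : EuclideanSpace ℝ (Fin (n + 1)), v 0 = 0 →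
          K (extChartAt (𝓡∂ (n + 1)) x x) u v = 0) → u = 0 := by
      intro u hu huv
      have h1 : (fun i => u i) = 0 := by
        refine hnd _ hu fun j hj => ?_
        -- Testing against basis vectors tangent to the boundary turns the hypothesis on K into the
        -- kernel condition for H.
        have h2 := huv (EuclideanSpace.single j 1) (by simp [hj.symm])
        rw [hKa _ _ hu (by simp [hj.symm]), mul_eq_zero] at h2
        refine Eq.trans (Finset.sum_congr rfl fun i _ => ?_) (h2.resolve_left ha)
        simp
      ext i
      exact congrFun h1 i
    intro u hu huv
    refine key u ((mem_boundaryTangent_iff _).1 hu) fun v hv => ?_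
    rw [← hext _ hp]
    exact (formInChart_chartAt_self _ x u v).trans (huv v ((mem_boundaryTangent_iff _).2 hv))

end MainTheorem

end ProjCompact

end

theorem theorem2p5 (n : ℕ) (hn : 1 ≤ n)
    {M : Type*} [TopologicalSpace M] [ChartedSpace (EuclideanHalfSpace (n + 1)) M]
    [IsManifold (𝓡∂ (n + 1)) ∞ M]
    (g : ProjCompact.InteriorMetric n M) (hg : ProjCompact.IsProjectivelyCompact 2 g) :
    ∃ S : M → ℝ,
      ContMDiff (𝓡∂ (n + 1)) 𝓘(ℝ, ℝ) ∞ S ∧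
      (∀ x ∈ (𝓡∂ (n + 1)).interior M, S x = ProjCompact.scalarCurvature g x) ∧
      IsLocallyConstant (fun x : (𝓡∂ (n + 1)).boundary M => S x) ∧
      (∀ x ∈ (𝓡∂ (n + 1)).boundary M, S x ≠ 0) ∧
      ∀ x ∈ (𝓡∂ (n + 1)).boundary M, ∀ (U : Set M) (ρ : M → ℝ), x ∈ U →
        ProjCompact.IsLocalDefiningFunction (n := n) ρ U →
        ∀ C : ℝ, C = -((n : ℝ) * (n + 1)) / (4 * S x) →
        ∀ W : Set M, W = {y ∈ U | y ∈ (𝓡∂ (n + 1)).boundary M → S y = S x} →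
        W ∈ 𝓝 x ∧
        ∃ h : ∀ y : M, TangentSpace (𝓡∂ (n + 1)) y →L[ℝ] TangentSpace (𝓡∂ (n + 1)) y →L[ℝ] ℝ,
          ProjCompact.SmoothFormOn h W ∧
          (∀ y ∈ W ∩ (𝓡∂ (n + 1)).interior M, ∀ u v : TangentSpace (𝓡∂ (n + 1)) y,
            h y u v = ρ y * g.val y u v
              - C / ρ y * (mvfderiv (𝓡∂ (n + 1)) ρ y u * mvfderiv (𝓡∂ (n + 1)) ρ y v)) ∧
          (∀ y ∈ W ∩ (𝓡∂ (n + 1)).boundary M, ∀ u ∈ ProjCompact.boundaryTangent y,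
            (∀ v ∈ ProjCompact.boundaryTangent y, h y u v = 0) → u = 0) := by
  open ProjCompact in
  have hn0 : (n : ℝ) * (n + 1) ≠ 0 := by positivity
  have hconst : ∀ x ∈ (𝓡∂ (n + 1)).boundary M, scalarExtension g x ≠ 0 ∧
      ∀ᶠ z in 𝓝 x, z ∈ (𝓡∂ (n + 1)).boundary M → scalarExtension g z = scalarExtension g x := by
    intro x hx
    obtain ⟨r, hr, htar, C, H, S, hC, hHs, hSs, hH, hnd, hS, hSb⟩ := hg.exists_chart_form hn hx
    have h1 := eventually_scalarExtension_eq hx hr hS hSb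
    have h2 := h1.self_of_nhds hx
    rw [h2]
    exact ⟨div_ne_zero (neg_ne_zero.2 hn0) (mul_ne_zero four_ne_zero hC), h1⟩
  refine ⟨scalarExtension g, hg.contMDiff_scalarExtension hn, fun x hx => scalarExtension_eq hx,
    ?_, fun x hx => (hconst x hx).1, ?_⟩
  · rw [IsLocallyConstant.iff_eventually_eq]
    intro x
    filter_upwards [continuousAt_subtype_val.eventually (hconst x x.2).2] with z hz using hz z.2
  · intro x hx U ρ hxU hρ C hC W hW
    have hWU : W ⊆ U := by rw [hW]; exact fun y hy => hy.1
    have hb : ∀ y ∈ W, y ∈ (𝓡∂ (n + 1)).boundary M → ContMDiffAt (𝓡∂ (n + 1))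
          𝓘(ℝ, EuclideanSpace ℝ (Fin (n + 1)) →L[ℝ] EuclideanSpace ℝ (Fin (n + 1)) →L[ℝ] ℝ) ∞
          (fun z => formInChart (formExtension (scaledForm g ρ C))
            (chartAt (EuclideanHalfSpace (n + 1)) y) (extChartAt (𝓡∂ (n + 1)) y z)) y ∧
        ∀ u ∈ boundaryTangent (n := n) y,
          (∀ v ∈ boundaryTangent (n := n) y, formExtension (scaledForm g ρ C) y u v = 0) →
            u = 0 := by
      intro y hy hyb
      obtain ⟨r, hr, htar, C', H, S, hC', hHs, hSs, hH, hnd, hS, hSb⟩ :=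
        hg.exists_chart_form hn hyb
      have hSy := (eventually_scalarExtension_eq hyb hr hS hSb).self_of_nhds hyb
      have hyx : scalarExtension g y = scalarExtension g x := by
        rw [hW] at hy
        exact hy.2 hyb
      -- The scalar curvature at a boundary point determines the leading coefficient of the metric
      -- there. Since S y = S x on the boundary part of W, the single constant C fits at y.
      obtain rfl : C = C' := by
        rw [hC, ← hyx, hSy]
        field_simp
      exact formExtension_boundary hyb (hWU hy) hρ hr hHs hH
        (hnd _ (self_mem_halfBall hyb hr) (extChartAt_apply_zero hyb))
    refine ⟨?_, formExtension (scaledForm g ρ C), ?_, ?_, ?_⟩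
    · rw [hW]
      exact inter_mem (hρ.isOpen.mem_nhds hxU) (hconst x hx).2
    · intro y hy
      rw [contMDiffWithinAt_form_iff]
      by_cases hyi : y ∈ (𝓡∂ (n + 1)).interior M
      · exact (contMDiffAt_formExtension_of_mem_interior hyi (hWU hy) hρ).contMDiffWithinAt
      · exact (hb y hy (by rwa [← (𝓡∂ (n + 1)).compl_interior])).1.contMDiffWithinAt
    · intro y hy u v
      rw [formExtension_of_mem _ hy.2, scaledForm_apply]
    · exact fun y hy => (hb y hy.1 hy.2).2
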